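/- Let $q\ge 2$, $p\ge 1$, $D\ge 1$ be integers and $\gamma=(\gamma_1,\dots,\gamma_p)$, $\beta=(\beta_1,\dots,\beta_p)\in\mathbb R^p$. Setting. Let $G=(V,E)$ be a finite non-empty $q$-uniform hypergraph in which every vertex lies in exactly $D+1$ hyperedges and whose girth (the minimum length $k\ge2$ of a Berge cycle, i.e. of distinct vertices $v_1,\dots,v_k$ and distinct hyperedges $e_1,\dots,e_k$ with $v_i,v_{i+1}\in e_i$ cyclically) is larger than $2p+1$. Let $J\in\{\pm1\}^E$. The Max-$q$-XORSAT cost function is $C^{\rm XOR}_J(z)=\sum_{e\in E}\frac12(1+J_e\prod_{v\in e}z_v)$ for $z\in\{\pm1\}^V$, regarded as a diagonal operator. Put $C_J=\frac1{\sqrt D}\sum_{e\in E}J_e\prod_{v\in e}Z_v$, $B=\sum_{v\in V}X_v$ and $|\gamma,\beta\rangle_J=e^{-i\beta_pB}e^{-i\gamma_pC_J}\cdots e^{-i\beta_1B}e^{-i\gamma_1C_J}|+\rangle^{\otimes V}$. Iterations. Strings $a\in\{\pm1\}^{2p+1}$ are indexed as $(a_1,\dots,a_p,a_0,a_{-p},\dots,a_{-1})$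 and multiplied entrywise; $\Gamma_r=\gamma_r$, $\Gamma_0=0$, $\Gamma_{-r}=-\gamma_r$ for $1\le r\le p$; and $$f(a)=\tfrac12\langle a_1|e^{i\beta_1X}|a_2\rangle\cdots\langle a_p|e^{i\beta_pX}|a_0\rangle\langle a_0|e^{-i\beta_pX}|a_{-p}\rangle\cdots\langle a_{-2}|e^{-i\beta_1X}|a_{-1}\rangle ,$$ where $\langle x|e^{i\theta X}|y\rangle$ is $\cos\theta$ if $x=y$ and $i\sin\theta$ if $x\ne y$. Let $H_D^{(0)}(a)=1$ and, for $1\le m\le p$, $$H_D^{(m)}(a)=\Big(\sum_{b^1,\dots,b^{q-1}}\cos\big[\tfrac1{\sqrt D}\Gamma\cdot(ab^1\cdots b^{q-1})\big]\prod_{i=1}^{q-1}f(b^i)H_D^{(m-1)}(b^i)\Big)^D .$$ Let $G^{(0)}_{j,k}=\sum_af(a)a_ja_k$ and, for $1\le m\le p$, $$G^{(m)}_{j,k}=\sum_af(a)a_ja_k\exp\Big[-\tfrac12\sum_{j',k'=-p}^p\big(G^{(m-1)}_{j',k'}\big)^{q-1}\Gamma_{j'}\Gamma_{k'}a_{j'}a_{k'}\Big].$$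 Theorem. There are real numbers $\nu_p^{[q]}(D,\gamma,\beta)$, depending only on $q,p,D,\gamma,\beta$, such that: (1) for every hypergraph as above and every choice of $J$, $$\frac1{|E|}\,{}_J\langle\gamma,\beta|C^{\rm XOR}_J|\gamma,\beta\rangle_J=\frac12+\nu_p^{[q]}(D,\gamma,\beta)\sqrt{\frac q{2D}}\,;$$ (2) $\displaystyle\nu_p^{[q]}(D,\gamma,\beta)=i\sqrt{\frac D{2q}}\sum_{a^1,\dots,a^q}\sin\big[\tfrac1{\sqrt D}\Gamma\cdot(a^1\cdots a^q)\big]\prod_{i=1}^q a^i_0f(a^i)H_D^{(p)}(a^i)$; (3) $\lim_{D\to\infty}\nu_p^{[q]}(D,\gamma,\beta)$ exists, is real, and equals $\displaystyle\frac i{\sqrt{2q}}\sum_{j=-p}^p\Gamma_j\big(G^{(p)}_{0,j}\big)^q$; (4) there is one program that computes $\nu_p^{[q]}(D,\gamma,\beta)$ from $p,q,D,\gamma,\beta$ in time $O(p\,4^{pq})$ and memory $O(4^p)$; (5) there is one program that computes $\lim_{D\to\infty}\nu_p^{[q]}(D,\gamma,\beta)$ from $p,q,\gamma,\beta$ in time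 $O(p^2\,4^p)$ and memory $O(p^2)$. In (4) and (5) the implied constants are absolute. The machine is a random access machine with a fixed finite set of natural-number and complex registers and an addressable memory of exact complex numbers. It has unit-cost operations: $+$, truncated $-$, $\times$, integer division, remainder and bitwise xor on natural numbers; $+,-,\times,/$, conjugation, $\exp$, $\sin$, $\cos$ and natural-number powers on complex numbers; the complex number $i$, and the conversions $n\mapsto n$ and $n\mapsto\sqrt n$ from natural to complex numbers; loads and stores. Branches and loops test $<$ on natural-number registers only. Memory is the number of the first memory cells that are used, and all natural numbers written are at most $O(4^p+q+D)$ in (4) and $O(4^p+q)$ in (5). -/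

import Mathlib

open Filter Topology

namespace QAOA

noncomputable section

/-! ## Hypergraphs -/

section Hypergraph

variable {V : Type*}

/-- The hypergraph with hyperedge set `E` contains a Berge cycle of length `k ≥ 2`: distinct
vertices `v₁, …, v_k` and distinct hyperedges `e₁, …, e_k` such that `v_i, v_{i+1} ∈ e_i`
(indices cyclic). -/
def HasBergeCycle (E : Finset (Finset V)) (k : ℕ) : Prop :=
  2 ≤ k ∧ ∃ (v : Fin k → V) (e : Fin k → Finset V),
    Function.Injective v ∧ Function.Injective e ∧
      ∀ i, e i ∈ E ∧ v i ∈ e i ∧ v (finRotate k i) ∈ e i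

/-- The girth: the minimum length of a Berge cycle (`⊤` if there is none). -/
def bergeGirth (E : Finset (Finset V)) : ℕ∞ :=
  ⨅ (k : ℕ) (_ : HasBergeCycle E k), (k : ℕ∞)

/-- Every hyperedge has exactly `q` vertices. -/
def IsUniform (E : Finset (Finset V)) (q : ℕ) : Prop :=
  ∀ e ∈ E, e.card = q

/-- Every vertex lies in exactly `d` hyperedges. -/
def IsRegular [DecidableEq V] (E : Finset (Finset V)) (d : ℕ) : Prop :=
  ∀ v : V, (E.filter (fun e => v ∈ e)).card = d

end Hypergraph

/-! ## The QAOA state -/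

section State

variable {V : Type*} [Fintype V] [DecidableEq V]

/-- The value `J_e ∏_{v ∈ e} z_v ∈ {±1}` of the clause `e`. -/
def clause (J : Finset V → ℤˣ) (e : Finset V) (z : V → ℤˣ) : ℝ :=
  (((J e * ∏ v ∈ e, z v : ℤˣ) : ℤ) : ℝ)

/-- The number of satisfied clauses, `∑_e (1 + J_e ∏_{v ∈ e} z_v) / 2`. -/
def xorCost (E : Finset (Finset V)) (J : Finset V → ℤˣ) (z : V → ℤˣ) : ℝ :=
  ∑ e ∈ E, (1 / 2) * (1 + clause J e z)

/-- The scaled cost function `D^{-1/2} ∑_e J_e ∏_{v ∈ e} z_v` that drives the QAOA. -/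
def driverCost (D : ℕ) (E : Finset (Finset V)) (J : Finset V → ℤˣ) (z : V → ℤˣ) : ℝ :=
  (1 / √(D : ℝ)) * ∑ e ∈ E, clause J e z

/-- The operator on the qubits `V`, diagonal in the computational basis, of a cost function. -/
def costOp (c : (V → ℤˣ) → ℝ) : Matrix (V → ℤˣ) (V → ℤˣ) ℂ :=
  Matrix.diagonal (fun z => (c z : ℂ))

/-- The Pauli operator `X_v`: it flips the spin at `v`. -/
def pauliX (v : V) : Matrix (V → ℤˣ) (V → ℤˣ) ℂ :=
  Matrix.of fun z z' => if z' = Function.update z v (-z v) then 1 else 0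

/-- The mixing operator `B = ∑_v X_v`. -/
def mixer : Matrix (V → ℤˣ) (V → ℤˣ) ℂ :=
  ∑ v : V, pauliX v

/-- The uniform superposition `|+⟩^{⊗ V}`. -/
def plusState : (V → ℤˣ) → ℂ :=
  fun _ => ((1 / √((2 : ℝ) ^ Fintype.card V) : ℝ) : ℂ)

/-- The state `e^{-iβ_p B} e^{-iγ_p C} ⋯ e^{-iβ_1 B} e^{-iγ_1 C} |+⟩^{⊗ V}`, where `C` is the
diagonal operator of the cost function `c`. -/
def qaoaState (c : (V → ℤˣ) → ℝ) {p : ℕ} (γ β : Fin p → ℝ) : (V → ℤˣ) → ℂ :=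
  (List.finRange p).foldl
    (fun ψ j =>
      (NormedSpace.exp ((-Complex.I * (β j : ℂ)) • (mixer : Matrix (V → ℤˣ) (V → ℤˣ) ℂ))).mulVec
        ((NormedSpace.exp ((-Complex.I * (γ j : ℂ)) • costOp c)).mulVec ψ))
    plusState

/-- The expectation `⟨ψ|A|ψ⟩`. -/
def expectation (A : Matrix (V → ℤˣ) (V → ℤˣ) ℂ) (ψ : (V → ℤˣ) → ℂ) : ℂ :=
  dotProduct (star ψ) (A.mulVec ψ)

/-- The expected fraction of satisfied clauses in the QAOA state driven by `driverCost D E J`. -/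
def satisfiedFraction (D : ℕ) (E : Finset (Finset V)) (J : Finset V → ℤˣ) {p : ℕ}
    (γ β : Fin p → ℝ) : ℂ :=
  (1 / (E.card : ℂ)) *
    expectation (costOp (xorCost E J)) (qaoaState (driverCost D E J) γ β)

end State

/-! ## The iterations

The `2p+1` indices `1, …, p, 0, -p, …, -1` are listed in this order, as the elements
`0, …, p-1, p, p+1, …, 2p` of `Fin (2p+1)`: index `r ∈ {1, …, p}` is at position `r-1`, index `0`
at position `p`, index `-r` at position `2p+1-r`. Likewise `γ_r`, `β_r` are `γ`, `β` at `r-1`. -/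

section Iteration

variable {p : ℕ}

/-- Strings of `2p+1` spins `(a_1, …, a_p, a_0, a_{-p}, …, a_{-1})`. -/
abbrev Bits (p : ℕ) : Type := Fin (2 * p + 1) → ℤˣ

/-- The spin `a_j` as a complex number. -/
def spin (a : Bits p) (j : Fin (2 * p + 1)) : ℂ := ((a j : ℤ) : ℂ)

/-- The position of the index `0`. -/
def mid (p : ℕ) : Fin (2 * p + 1) := ⟨p, by omega⟩

/-- `Γ = (γ_1, …, γ_p, 0, -γ_p, …, -γ_1)`. -/
def Gam (γ : Fin p → ℝ) (k : Fin (2 * p + 1)) : ℝ :=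
  if h : k.val < p then γ ⟨k.val, h⟩
  else if h' : p < k.val then -γ ⟨2 * p - k.val, by omega⟩
  else 0

/-- The angles `(β_1, …, β_p, -β_p, …, -β_1)`. -/
def mixAngle (β : Fin p → ℝ) (k : Fin (2 * p)) : ℝ :=
  if h : k.val < p then β ⟨k.val, h⟩
  else -β ⟨2 * p - 1 - k.val, by omega⟩

/-- `⟨x| e^{iθX} |y⟩`. -/
def mixAmp (θ : ℝ) (x y : ℤˣ) : ℂ :=
  if x = y then (Real.cos θ : ℂ) else Complex.I * (Real.sin θ : ℂ)

/-- `f(a) = ½ ⟨a_1|e^{iβ_1X}|a_2⟩ ⋯ ⟨a_p|e^{iβ_pX}|a_0⟩ ⟨a_0|e^{-iβ_pX}|a_{-p}⟩ ⋯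
⟨a_{-2}|e^{-iβ_1X}|a_{-1}⟩`. -/
def pathWeight (β : Fin p → ℝ) (a : Bits p) : ℂ :=
  (1 / 2) * ∏ k : Fin (2 * p), mixAmp (mixAngle β k) (a k.castSucc) (a k.succ)

/-- `Γ · a`. -/
def gamDot (γ : Fin p → ℝ) (a : Bits p) : ℝ :=
  ∑ k, Gam γ k * ((a k : ℤ) : ℝ)

/-- The functions `H_D^{(m)}` (the product of spin strings is entrywise). -/
def treeH (q D : ℕ) (γ β : Fin p → ℝ) : ℕ → Bits p → ℂ
  | 0, _ => 1
  | m + 1, a =>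
    (∑ b : Fin (q - 1) → Bits p,
      (Real.cos ((1 / √(D : ℝ)) * gamDot γ (a * ∏ i, b i)) : ℂ) *
        ∏ i, (pathWeight β (b i) * treeH q D γ β m (b i))) ^ D

/-- The finite-`D` formula
`i √(D/(2q)) ∑_{a¹,…,a^q} sin[D^{-1/2} Γ·(a¹⋯a^q)] ∏_i a^i_0 f(a^i) H_D^{(p)}(a^i)`. -/
def nuFormula (q D : ℕ) (γ β : Fin p → ℝ) : ℂ :=
  Complex.I * (√((D : ℝ) / (2 * q)) : ℂ) *
    ∑ a : Fin q → Bits p,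
      (Real.sin ((1 / √(D : ℝ)) * gamDot γ (∏ i, a i)) : ℂ) *
        ∏ i, (spin (a i) (mid p) * pathWeight β (a i) * treeH q D γ β p (a i))

/-- The matrices `G^{(m)}`. -/
def matG (q : ℕ) (γ β : Fin p → ℝ) : ℕ → Matrix (Fin (2 * p + 1)) (Fin (2 * p + 1)) ℂ
  | 0 => Matrix.of fun j k => ∑ a : Bits p, pathWeight β a * spin a j * spin a k
  | m + 1 => Matrix.of fun j k =>
    ∑ a : Bits p, pathWeight β a * spin a j * spin a k *
      Complex.exp (-(1 / 2) * ∑ j', ∑ k',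
        (matG q γ β m j' k') ^ (q - 1) * (Gam γ j' : ℂ) * (Gam γ k' : ℂ) *
          spin a j' * spin a k')

/-- The infinite-`D` formula `(i/√(2q)) ∑_j Γ_j (G^{(p)}_{0,j})^q`. -/
def nuLimitFormula (q : ℕ) (γ β : Fin p → ℝ) : ℂ :=
  (Complex.I / (√(2 * (q : ℝ)) : ℂ)) *
    ∑ j, (Gam γ j : ℂ) * (matG q γ β p (mid p) j) ^ q

end Iteration

/-! ## The machine model

A random access machine with registers for natural numbers, registers for complex numbers and an
addressable memory of complex numbers. Elementary operations have unit cost, complex arithmetic is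
exact, and control flow can only depend on natural-number registers. A program is a finite text that
does not depend on the input, so that it uses a bounded number of registers. -/

section Machine

/-- A machine configuration. -/
structure Store where
  /-- natural-number registers -/
  nreg : ℕ → ℕ
  /-- complex registers -/
  creg : ℕ → ℂ
  /-- complex memory -/
  mem : ℕ → ℂ

/-- Operations on natural numbers (subtraction is truncated). -/
inductive NatOp
  | add | sub | mul | div | mod | xor

/-- The value of an operation. -/
def NatOp.eval : NatOp → ℕ → ℕ → ℕ
  | .add, x, y => x + y
  | .sub, x, y => x - y
  | .mul, x, y => x * y
  | .div, x, y => x / y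
  | .mod, x, y => x % y
  | .xor, x, y => x ^^^ y

/-- Binary operations on complex numbers. -/
inductive CpxOp
  | add | sub | mul | div

/-- The value of an operation. -/
def CpxOp.eval : CpxOp → ℂ → ℂ → ℂ
  | .add, x, y => x + y
  | .sub, x, y => x - y
  | .mul, x, y => x * y
  | .div, x, y => x / y

/-- Elementary functions on complex numbers. -/
inductive CpxFun
  | exp | sin | cos | conj

/-- The value of an elementary function. -/
def CpxFun.eval : CpxFun → ℂ → ℂ
  | .exp, x => Complex.exp x
  | .sin, x => Complex.sin x
  | .cos, x => Complex.cos x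
  | .conj, x => starRingEnd ℂ x

/-- Instructions. `d` is the register that is written. -/
inductive Instr
  /-- `N[d] ← k` -/
  | natConst (d k : ℕ)
  /-- `N[d] ← N[a] o N[b]` -/
  | natOp (o : NatOp) (d a b : ℕ)
  /-- `C[d] ← N[a]` -/
  | cpxOfNat (d a : ℕ)
  /-- `C[d] ← √N[a]` -/
  | cpxSqrt (d a : ℕ)
  /-- `C[d] ← i` -/
  | cpxI (d : ℕ)
  /-- `C[d] ← C[a] o C[b]` -/
  | cpxOp (o : CpxOp) (d a b : ℕ)
  /-- `C[d] ← g(C[a])` -/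
  | cpxFun (g : CpxFun) (d a : ℕ)
  /-- `C[d] ← C[a] ^ N[b]` -/
  | cpxPow (d a b : ℕ)
  /-- `C[d] ← M[N[a]]` -/
  | load (d a : ℕ)
  /-- `M[N[a]] ← C[b]` -/
  | store (a b : ℕ)

/-- Write a natural-number register. -/
def Store.setN (s : Store) (d x : ℕ) : Store :=
  { s with nreg := Function.update s.nreg d x }

/-- Write a complex register. -/
def Store.setC (s : Store) (d : ℕ) (x : ℂ) : Store :=
  { s with creg := Function.update s.creg d x }

/-- Write a memory cell. -/
def Store.setM (s : Store) (d : ℕ) (x : ℂ) : Store :=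
  { s with mem := Function.update s.mem d x }

/-- The effect of an instruction. -/
def Instr.run : Instr → Store → Store
  | .natConst d k, s => s.setN d k
  | .natOp o d a b, s => s.setN d (o.eval (s.nreg a) (s.nreg b))
  | .cpxOfNat d a, s => s.setC d (s.nreg a : ℂ)
  | .cpxSqrt d a, s => s.setC d ((√(s.nreg a : ℝ) : ℝ) : ℂ)
  | .cpxI d, s => s.setC d Complex.I
  | .cpxOp o d a b, s => s.setC d (o.eval (s.creg a) (s.creg b))
  | .cpxFun g d a, s => s.setC d (g.eval (s.creg a))
  | .cpxPow d a b, s => s.setC d (s.creg a ^ s.nreg b)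
  | .load d a, s => s.setC d (s.mem (s.nreg a))
  | .store a b, s => s.setM (s.nreg a) (s.creg b)

/-- The number of the first memory cells that an instruction needs: the address it accesses,
plus one. -/
def Instr.space : Instr → Store → ℕ
  | .load _ a, s => s.nreg a + 1
  | .store a _, s => s.nreg a + 1
  | _, _ => 0

/-- The natural number that an instruction writes (`0` if it writes none). -/
def Instr.word : Instr → Store → ℕ
  | .natConst _ k, _ => k
  | .natOp o _ a b, s => o.eval (s.nreg a) (s.nreg b)
  | _, _ => 0

/-- Programs: instructions, sequences, `if N[a] < N[b] then P else Q`, and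
`while N[a] < N[b] do P`. -/
inductive Prog
  | instr (i : Instr)
  | seq (P Q : Prog)
  | cond (a b : ℕ) (P Q : Prog)
  | loop (a b : ℕ) (P : Prog)

/-- `Exec P s s' t m w`: started in `s`, the program `P` halts in `s'` after `t` steps (executed
instructions and tests), accesses only the memory cells `0, …, m-1`, and `w` is the largest natural
number that it writes. -/
inductive Exec : Prog → Store → Store → ℕ → ℕ → ℕ → Prop
  | instr (i : Instr) (s : Store) : Exec (.instr i) s (i.run s) 1 (i.space s) (i.word s)
  | seq {P Q : Prog} {s s₁ s₂ : Store} {t₁ m₁ w₁ t₂ m₂ w₂ : ℕ} :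
      Exec P s s₁ t₁ m₁ w₁ → Exec Q s₁ s₂ t₂ m₂ w₂ →
        Exec (.seq P Q) s s₂ (t₁ + t₂) (max m₁ m₂) (max w₁ w₂)
  | cond_true {a b : ℕ} {P Q : Prog} {s s' : Store} {t m w : ℕ} :
      s.nreg a < s.nreg b → Exec P s s' t m w → Exec (.cond a b P Q) s s' (1 + t) m w
  | cond_false {a b : ℕ} {P Q : Prog} {s s' : Store} {t m w : ℕ} :
      ¬ s.nreg a < s.nreg b → Exec Q s s' t m w → Exec (.cond a b P Q) s s' (1 + t) m w
  | loop_done {a b : ℕ} {P : Prog} {s : Store} :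
      ¬ s.nreg a < s.nreg b → Exec (.loop a b P) s s 1 0 0
  | loop_step {a b : ℕ} {P : Prog} {s s₁ s₂ : Store} {t₁ m₁ w₁ t₂ m₂ w₂ : ℕ} :
      s.nreg a < s.nreg b → Exec P s s₁ t₁ m₁ w₁ → Exec (.loop a b P) s₁ s₂ t₂ m₂ w₂ →
        Exec (.loop a b P) s s₂ (1 + t₁ + t₂) (max m₁ m₂) (max w₁ w₂)

/-- The initial configuration: `p, q, D` are in the first three natural-number registers,
`γ_1, …, γ_p, β_1, …, β_p` are in the first `2p` memory cells, and everything else is `0`. -/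
def inputStore (p q D : ℕ) (γ β : Fin p → ℝ) : Store where
  nreg := fun k => if k = 0 then p else if k = 1 then q else if k = 2 then D else 0
  creg := fun _ => 0
  mem := fun k =>
    if h : k < p then (γ ⟨k, h⟩ : ℂ)
    else if h' : k < 2 * p then (β ⟨k - p, by omega⟩ : ℂ)
    else 0

/-- On input `s`, the program `P` halts with `x` in the first complex register, within `t` steps,
with `m` memory cells, and all natural numbers that it writes are at most `w`. -/
def ComputesWithin (P : Prog) (s : Store) (x : ℂ) (t m w : ℕ) : Prop :=
  ∃ (s' : Store) (t' m' w' : ℕ),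
    Exec P s s' t' m' w' ∧ s'.creg 0 = x ∧ t' ≤ t ∧ m' ≤ m ∧ w' ≤ w

end Machine

end

end QAOA

/-! Path sums. Resolving the identity between the exponentials writes the expectation of a diagonal
observable as a sum over one string of 2p+1 spins per vertex (`expectation_costOp`): the weight is
the product of the f(a_v), the phase is the exponential of the action paired with Γ, and the
observable sees only central spins. The weights are complex but sum to 1 (`sum_pathWeight`), so
`avg` obeys the rules of an expectation over independent strings. The phase is a product of one
local factor per hyperedge (`exp_action`).

Light cone. Since e^{iβX}e^{-iβX} = 1, summing out a central spin on which nothing depends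
identifies its two neighbours and leaves the weight of a string with one angle fewer (`avg_dup`).
The last angle then pairs with two equal spins and drops out of Γ. As Γ_0 = 0, no phase sees a
central spin, so away from the measured hyperedge every string can be shortened. `avg_forest` trades
one angle for one generation of a tree: each vertex has D child hyperedges, independent given its
string, and they produce the D-th power in H_D. After p generations no angle is left and all
remaining phases are 1. The girth bound makes these p generations a tree (`isForest_of_girth`).
Negating one string preserves f and H, so below the root only cosines survive and the signs J
disappear; at the root the odd central spins select the sine, and its sign cancels that of the
clause. Complex conjugation amounts to reversing strings, which makes ν real.

Limit. The normalisation ∑ f·H = 1 (`sum_pathWeight_treeH`) turns the base of the D-th power into 1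
+ g_D, where D·g_D tends to -1/2 times a quadratic form whose coefficients factor into powers of G;
hence the exponential (`tendsto_treeH`).

Programs. Up to a global sign a string is a number below 4^p, and multiplication of strings is xor.
The sums over several strings are therefore iterated convolutions (`codeConv_iterate`), of total
cost O(p·q·16^p), which is O(p·4^{pq}) because q ≥ 2. For the limit, entries of G away from the
centre are entries for one angle fewer (`matG_collapse`), with the innermost two positions collapsed
to the centre. So the quadratic form for d angles is assembled from the central rows for 0, …, d-1
angles (`codeForm_eq`). Storing these rows takes O(p²) cells; row d costs O(p²·4^d) and the costs
sum geometrically. -/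

namespace QAOA

/-! ## Product averages -/

section Average

variable {V κ X : Type*} [Fintype V] [Fintype κ] [Fintype X]

/-- The average of `F` over independent labels of the sites, each with (complex) weight `w`. -/
def avg [DecidableEq V] (w : X → ℂ) (F : (V → X) → ℂ) : ℂ := ∑ a : V → X, (∏ v, w (a v)) * F a

variable [DecidableEq V] [DecidableEq κ] {w : X → ℂ}

theorem avg_const (hw : ∑ x, w x = 1) (c : ℂ) : avg w (fun _ : V → X => c) = c := by
  rw [avg, ← Finset.sum_mul, ← Fintype.prod_sum (fun _ : V => w)]
  simp [hw]

theorem avg_const_mul (c : ℂ) (F : (V → X) → ℂ) : avg w (fun a => c * F a) = c * avg w F := by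
  simp only [avg, Finset.mul_sum]
  exact Finset.sum_congr rfl fun a _ => by ring

theorem avg_mul_const (c : ℂ) (F : (V → X) → ℂ) : avg w (fun a => F a * c) = avg w F * c := by
  simp only [avg, Finset.sum_mul]
  exact Finset.sum_congr rfl fun a _ => by ring

theorem avg_add (F G : (V → X) → ℂ) : avg w (fun a => F a + G a) = avg w F + avg w G := by
  simp only [avg, ← Finset.sum_add_distrib]
  exact Finset.sum_congr rfl fun a _ => by ring

theorem avg_sum {ι : Type*} (s : Finset ι) (F : ι → (V → X) → ℂ) :
    avg w (fun a => ∑ i ∈ s, F i a) = ∑ i ∈ s, avg w (F i) := by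
  simp only [avg, Finset.mul_sum]
  exact Finset.sum_comm

/-- Resampling: exchanging two independent labelings outside `S` is an involution of pairs that
preserves the product weight. -/
theorem avg_piecewise (hw : ∑ x, w x = 1) (S : Finset V) (F : (V → X) → ℂ) :
    avg w F = avg w fun x => avg w fun y => F (S.piecewise x y) := by
  have h1 : avg w F = ∑ z : (V → X) × (V → X), ((∏ v, w (z.1 v)) * ∏ v, w (z.2 v)) * F z.1 := by
    rw [Fintype.sum_prod_type]
    refine Finset.sum_congr rfl fun x _ => ?_
    have : ∑ y : V → X, ∏ v, w (y v) = 1 := by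
      rw [← Fintype.prod_sum (fun _ : V => w)]; simp [hw]
    calc _ = (∏ v, w (x v)) * F x * ∑ y : V → X, ∏ v, w (y v) := by rw [this, mul_one]
      _ = _ := by rw [Finset.mul_sum]; exact Finset.sum_congr rfl fun y _ => by ring
  have h2 : (avg w fun x => avg w fun y => F (S.piecewise x y)) =
      ∑ z : (V → X) × (V → X), ((∏ v, w (z.1 v)) * ∏ v, w (z.2 v)) * F (S.piecewise z.1 z.2) := by
    rw [Fintype.sum_prod_type]
    refine Finset.sum_congr rfl fun x _ => ?_
    simp only [avg, Finset.mul_sum]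
    exact Finset.sum_congr rfl fun y _ => by ring
  rw [h1, h2]
  let e : (V → X) × (V → X) → (V → X) × (V → X) :=
    fun z => (S.piecewise z.1 z.2, S.piecewise z.2 z.1)
  have he : Function.Involutive e := by
    intro z
    refine Prod.ext ?_ ?_ <;> funext v <;> by_cases hv : v ∈ S <;> simp [e, hv]
  refine (Fintype.sum_bijective e he.bijective _ _ fun z => ?_).symm
  congr 1
  rw [← Finset.prod_mul_distrib, ← Finset.prod_mul_distrib]
  refine Finset.prod_congr rfl fun v _ => ?_
  by_cases hv : v ∈ S <;> simp [e, hv, mul_comm]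

theorem avg_mul (hw : ∑ x, w x = 1) (S : Finset V) {F G : (V → X) → ℂ}
    (hF : DependsOn F (S : Set V)) (hG : DependsOn G ((S : Set V)ᶜ)) :
    avg w (fun a => F a * G a) = avg w F * avg w G := by
  rw [avg_piecewise hw S, ← avg_mul_const]
  congr 1
  funext x
  rw [← avg_const_mul]
  congr 1
  funext y
  congr 1
  · exact hF fun v hv => by simp [Finset.mem_coe.1 hv]
  · exact hG fun v hv => Finset.piecewise_eq_of_notMem _ _ _ (by simpa using hv)

theorem avg_prod (hw : ∑ x, w x = 1) {ι : Type*} [DecidableEq ι] (s : Finset ι) (B : ι → Finset V)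
    (hB : ∀ i ∈ s, ∀ j ∈ s, i ≠ j → Disjoint (B i) (B j)) (F : ι → (V → X) → ℂ)
    (hF : ∀ i ∈ s, DependsOn (F i) (B i : Set V)) :
    avg w (fun a => ∏ i ∈ s, F i a) = ∏ i ∈ s, avg w (F i) := by
  induction s using Finset.induction_on with
  | empty => simp [avg_const hw]
  | insert i s hi ih =>
    simp only [Finset.prod_insert hi]
    rw [avg_mul hw (B i) (hF i (by simp)), ih]
    · exact fun j hj k hk => hB j (by simp [hj]) k (by simp [hk])
    · exact fun j hj => hF j (by simp [hj])
    · intro a b hab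
      refine Finset.prod_congr rfl fun j hj => hF j (by simp [hj]) fun v hv => hab v ?_
      have := hB i (by simp) j (by simp [hj]) (fun h => hi (h ▸ hj))
      simpa using Finset.disjoint_right.1 this hv

theorem avg_comp_equiv (e : κ ≃ V) (F : (κ → X) → ℂ) :
    avg w (fun a : V → X => F (a ∘ e)) = avg w F := by
  refine Fintype.sum_equiv (e.arrowCongr (Equiv.refl X)).symm _ _ fun a => ?_
  congr 1
  exact (Fintype.prod_equiv e _ _ fun _ => rfl).symm

/-- Marginalisation: the sites outside the range of `ι` sum to 1. -/
theorem avg_comp_injective (hw : ∑ x, w x = 1) (ι : κ → V) (hι : Function.Injective ι)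
    (F : (κ → X) → ℂ) : avg w (fun a : V → X => F (a ∘ ι)) = avg w F := by
  classical
  let e : κ ⊕ {v // v ∉ Set.range ι} ≃ V :=
    (Equiv.sumCongr (Equiv.ofInjective ι hι) (Equiv.refl _)).trans (Equiv.Set.sumCompl _)
  rw [← avg_comp_equiv e.symm]
  have h : avg w (fun a : (κ ⊕ {v // v ∉ Set.range ι}) → X => F (a ∘ Sum.inl)) = avg w F := by
    rw [avg, avg, ← (Equiv.sumArrowEquivProdArrow _ _ _).symm.sum_comp, Fintype.sum_prod_type]
    refine Finset.sum_congr rfl fun x _ => ?_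
    have h2 : ∑ y : {v // v ∉ Set.range ι} → X, ∏ v, w (y v) = 1 := by
      rw [← Fintype.prod_sum (fun _ : {v // v ∉ Set.range ι} => w)]; simp [hw]
    calc _ = ∑ y : {v // v ∉ Set.range ι} → X, ((∏ v, w (x v)) * F x) * ∏ v, w (y v) := by
          refine Finset.sum_congr rfl fun y _ => ?_
          rw [Fintype.prod_sum_type]
          simp only [Equiv.sumArrowEquivProdArrow_symm_apply_inl,
            Equiv.sumArrowEquivProdArrow_symm_apply_inr]
          have : (Equiv.sumArrowEquivProdArrow κ _ X).symm (x, y) ∘ Sum.inl = x := rfl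
          rw [this]; ring
      _ = _ := by rw [← Finset.mul_sum, h2, mul_one]
  rw [← h]
  congr 1
  funext a
  congr 1
  funext k
  have : e.symm (ι k) = Sum.inl k := by
    rw [Equiv.symm_apply_eq]; rfl
  simp [this]

end Average

/-! ## Spin strings -/

section Strings

variable {p : ℕ}

/-- The position of `r ∈ {1, …, p+1}` (shifted by one), where `p+1` stands for the centre. -/
def fpos (p r : ℕ) (h : r ≤ p) : Fin (2 * p + 1) := ⟨r, by omega⟩

/-- The position of `-r`. -/
def bpos (p r : ℕ) (h : r ≤ p) : Fin (2 * p + 1) := ⟨2 * p - r, by omega⟩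

/-- Γ is antisymmetric about its vanishing centre, so every pairing with it is a sum of
forward-minus-backward differences. In this form the last angle can be split off. -/
theorem gam_sum {M : Type*} [AddCommGroup M] [Module ℝ M] (γ : Fin p → ℝ)
    (F : Fin (2 * p + 1) → M) :
    ∑ k, Gam γ k • F k =
      ∑ r : Fin p, γ r • (F (fpos p r r.2.le) - F (bpos p r r.2.le)) := by
  have hsplit : ∀ g : Fin (2 * p + 1) → M, ∑ k, g k =
      ∑ r : Fin p, (g (fpos p r r.2.le) + g (bpos p r r.2.le)) + g (mid p) := by
    intro g
    have hc : ∀ n m : ℕ, ∀ h : n = m, ∀ g : Fin m → M, ∑ k, g k = ∑ k, g (Fin.cast h k) := by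
      rintro n m rfl g; rfl
    rw [hc ((p + 1) + p) (2 * p + 1) (by omega), Fin.sum_univ_add, Fin.sum_univ_castSucc,
      Finset.sum_add_distrib, ← Equiv.sum_comp Fin.revPerm (fun i : Fin p => g (Fin.cast _ (Fin.natAdd _ i)))]
    have h1 : ∀ i : Fin p, Fin.cast (by omega : (p+1)+p = 2 * p + 1)
        (Fin.natAdd (p + 1) (Fin.revPerm i)) = bpos p i i.2.le := by
      intro i; ext; simp [bpos, Fin.rev]; omega
    simp only [h1]
    have h2 : ∀ i : Fin p, Fin.cast (by omega : (p+1)+p = 2 * p + 1)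
        (Fin.castAdd p i.castSucc) = fpos p i i.2.le := by
      intro i; ext; simp [fpos]
    have h3 : Fin.cast (by omega : (p+1)+p = 2 * p + 1)
        (Fin.castAdd p (Fin.last p)) = mid p := by
      ext; simp [mid]
    simp only [h2, h3]
    abel
  rw [hsplit]
  have hm : Gam γ (mid p) = 0 := by simp [Gam, mid]
  rw [hm, zero_smul, add_zero]
  refine Finset.sum_congr rfl fun r _ => ?_
  have h1 : Gam γ (fpos p r r.2.le) = γ r := by simp [Gam, fpos]
  have h2 : Gam γ (bpos p r r.2.le) = -γ r := by
    have := r.2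
    have h3 : ¬ (bpos p r r.2.le).val < p := by simp only [bpos]; omega
    have h4 : p < (bpos p r r.2.le).val := by simp only [bpos]; omega
    rw [Gam, dif_neg h3, dif_pos h4]
    have h5 : (⟨2 * p - (bpos p r r.2.le).val, by omega⟩ : Fin p) = r :=
      Fin.ext (by simp only [bpos]; omega)
    rw [h5]
  rw [h1, h2, neg_smul, smul_sub, sub_eq_add_neg]

theorem Gam_mid (γ : Fin p → ℝ) : Gam γ (mid p) = 0 := by simp [Gam, mid]

theorem mixAmp_comm (θ : ℝ) (x y : ℤˣ) : mixAmp θ x y = mixAmp θ y x := by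
  simp only [mixAmp, eq_comm]

theorem mixAmp_neg (θ : ℝ) (x y : ℤˣ) : mixAmp θ (-x) (-y) = mixAmp θ x y := by
  simp only [mixAmp, neg_inj]

theorem conj_mixAmp (θ : ℝ) (x y : ℤˣ) :
    (starRingEnd ℂ) (mixAmp θ x y) = mixAmp (-θ) x y := by
  unfold mixAmp
  split_ifs <;> simp [Complex.conj_ofReal, -Complex.ofReal_cos, -Complex.ofReal_sin]

/-- The weight of a string whose backward part ends at `y` instead of the centre. -/
noncomputable def openWeight (β : Fin p → ℝ) (a : Bits p) (y : ℤˣ) : ℂ :=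
  (1 / 2) * ∏ r : Fin p, (mixAmp (β r) (a (fpos p r r.2.le)) (a (fpos p (r + 1) r.2)) *
    mixAmp (-β r) (if r.val + 1 = p then y else a (bpos p (r + 1) r.2)) (a (bpos p r r.2.le)))

/-- The forward half of a string comes from the bra and the backward half from the ket. Open strings
let their inner ends differ, which the induction over layers in `sum_two_point` needs; closing them
gives f. -/
theorem openWeight_mid (β : Fin p → ℝ) (a : Bits p) :
    openWeight β a (a (mid p)) = pathWeight β a := by
  have hc : ∀ n m : ℕ, ∀ h : n = m, ∀ g : Fin m → ℂ, ∏ k, g k = ∏ k, g (Fin.cast h k) := by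
    rintro n m rfl g; rfl
  rw [openWeight, pathWeight]
  congr 1
  rw [hc (p + p) (2 * p) (by omega), Fin.prod_univ_add, Finset.prod_mul_distrib]
  congr 1
  · refine Finset.prod_congr rfl fun r _ => ?_
    congr 1
    simp [mixAngle]
  · rw [← Equiv.prod_comp Fin.revPerm
      (fun i : Fin p => mixAmp (mixAngle β (Fin.cast _ (Fin.natAdd _ i))) _ _)]
    refine Finset.prod_congr rfl fun r _ => ?_
    have hr := r.2
    congr 1
    · simp only [mixAngle, Fin.revPerm_apply, Fin.val_cast, Fin.val_natAdd, Fin.val_rev]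
      rw [dif_neg (by omega)]
      congr 2; ext; simp; omega
    · split_ifs with h
      · congr 1; ext; simp [mid, Fin.val_rev]; omega
      · congr 1; ext; simp [bpos, Fin.val_rev]; omega
    · congr 1; ext; simp [bpos, Fin.val_rev]; omega

/-- Insert two spins next to the centre: the old centre stays at position `p`. -/
def ins (a : Bits p) (y x : ℤˣ) : Bits (p + 1) := fun k =>
  if h : k.val ≤ p then a ⟨k, by omega⟩
  else if k.val = p + 1 then x
  else if k.val = p + 2 then y
  else a ⟨k.val - 2, by omega⟩

/-- The map of positions that collapses the three innermost ones to the centre. -/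
def collapse (k : Fin (2 * (p + 1) + 1)) : Fin (2 * p + 1) :=
  if h : k.val ≤ p then ⟨k, by omega⟩
  else if k.val ≤ p + 2 then mid p
  else ⟨k.val - 2, by omega⟩

/-- Repeat the central spin. -/
def dup (a : Bits p) : Bits (p + 1) := a ∘ collapse

theorem ins_of_lt (a : Bits p) (y x : ℤˣ) (k : Fin (2 * (p + 1) + 1)) (h : p + 2 < k.val) :
    ins a y x k = a ⟨k.val - 2, by omega⟩ := by
  rw [ins, dif_neg (by omega), if_neg (by omega), if_neg (by omega)]

theorem ins_of_eq (a : Bits p) (y x : ℤˣ) (k : Fin (2 * (p + 1) + 1)) (h : k.val = p + 2) :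
    ins a y x k = y := by
  rw [ins, dif_neg (by omega), if_neg (by omega), if_pos h]

theorem ins_mid (a : Bits p) : ins a (a (mid p)) (a (mid p)) = dup a := by
  funext k
  simp only [ins, dup, collapse, Function.comp]
  split_ifs <;> first | rfl | omega

theorem update_ins (a : Bits p) (y x x' : ℤˣ) :
    Function.update (ins a y x) (mid (p + 1)) x' = ins a y x' := by
  funext k
  by_cases h : k = mid (p + 1)
  · subst h; simp [ins, mid]
  · rw [Function.update_of_ne h]
    have : k.val ≠ p + 1 := fun h' => h (Fin.ext h')
    simp [ins, this]

/-- Every longer string arises from exactly one insertion. -/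
def insEquiv (p : ℕ) : Bits p × ℤˣ × ℤˣ ≃ Bits (p + 1) where
  toFun z := ins z.1 z.2.1 z.2.2
  invFun b := (fun k => if k.val ≤ p then b ⟨k, by omega⟩ else b ⟨k + 2, by omega⟩,
      b ⟨p + 2, by omega⟩, b ⟨p + 1, by omega⟩)
  left_inv := by
    rintro ⟨a, y, x⟩
    refine Prod.ext ?_ (Prod.ext ?_ ?_)
    · funext k
      simp only [ins]
      split_ifs <;> first | rfl | omega
    · simp [ins]
    · simp [ins]
  right_inv := by
    intro b
    funext k
    simp only [ins]
    split_ifs <;> first | rfl | omega | (congr 1; ext; simp; omega)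

theorem ins_fpos (a : Bits p) (y x : ℤˣ) (r : ℕ) (h : r ≤ p) :
    ins a y x (fpos (p + 1) r (by omega)) = a (fpos p r h) := by
  simp [ins, fpos, h]

theorem ins_bpos (a : Bits p) (y x : ℤˣ) (r : ℕ) (h : r < p) :
    ins a y x (bpos (p + 1) r (by omega)) = a (bpos p r h.le) := by
  rw [ins_of_lt _ _ _ _ (by simp only [bpos]; omega)]
  congr 1; ext; simp only [bpos]; omega

theorem ins_bpos_last (a : Bits p) (y x : ℤˣ) : ins a y x (bpos (p + 1) p (by omega)) = y :=
  ins_of_eq _ _ _ _ (by simp only [bpos]; omega)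

theorem openWeight_ins (β : Fin (p + 1) → ℝ) (a : Bits p) (y x x' : ℤˣ) :
    openWeight β (ins a y x) x' = openWeight (β ∘ Fin.castSucc) a y *
      (mixAmp (β (Fin.last p)) (a (mid p)) x * mixAmp (-β (Fin.last p)) x' y) := by
  rw [openWeight, openWeight, Fin.prod_univ_castSucc, mul_assoc]
  congr 1
  congr 1
  · refine Finset.prod_congr rfl fun r _ => ?_
    have hr := r.2
    simp only [Fin.val_castSucc, Function.comp]
    rw [ins_fpos _ _ _ _ hr.le, ins_fpos _ _ _ _ hr, ins_bpos _ _ _ _ hr, if_neg (by omega)]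
    congr 2
    split_ifs with h
    · exact ins_of_eq _ _ _ _ (by simp only [bpos]; omega)
    · rw [ins_bpos _ _ _ _ (by omega)]
  · simp only [Fin.val_last, if_true]
    rw [ins_fpos _ _ _ _ le_rfl, ins_bpos_last]
    congr 2
    simp [ins, fpos]

theorem pathWeight_ins (β : Fin (p + 1) → ℝ) (a : Bits p) (y x : ℤˣ) :
    pathWeight β (ins a y x) = openWeight (β ∘ Fin.castSucc) a y *
      (mixAmp (β (Fin.last p)) (a (mid p)) x * mixAmp (-β (Fin.last p)) x y) := by
  rw [← openWeight_mid, openWeight_ins]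
  simp [ins, mid]

/-- Unitarity of one mixing layer: these are the matrix entries of e^{iθX}e^{-iθX} = 1. All
light-cone cancellations come from here. -/
theorem sum_mixAmp (θ : ℝ) (z y : ℤˣ) :
    ∑ x, mixAmp θ z x * mixAmp (-θ) x y = if y = z then 1 else 0 := by
  have h : (Real.cos θ : ℂ) * Real.cos θ + Real.sin θ * Real.sin θ = 1 := by
    rw [← Complex.ofReal_mul, ← Complex.ofReal_mul, ← Complex.ofReal_add]
    norm_cast
    nlinarith [Real.sin_sq_add_cos_sq θ]
  have h2 : (Finset.univ : Finset ℤˣ) = {1, -1} := rfl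
  rw [h2, Finset.sum_pair (by decide)]
  rcases Int.units_eq_one_or z with rfl | rfl <;> rcases Int.units_eq_one_or y with rfl | rfl <;>
    simp [mixAmp, -Complex.ofReal_cos, -Complex.ofReal_sin, (by decide : (1 : ℤˣ) ≠ -1),
      (by decide : (-1 : ℤˣ) ≠ 1)] <;>
    first
    | ring1
    | linear_combination h - (Real.sin θ : ℂ) ^ 2 * Complex.I_sq

theorem sum_pathWeight_ins (β : Fin (p + 1) → ℝ) (a : Bits p) (y : ℤˣ) :
    ∑ x, pathWeight β (ins a y x) =
      if y = a (mid p) then pathWeight (β ∘ Fin.castSucc) a else 0 := by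
  simp only [pathWeight_ins, ← Finset.mul_sum, sum_mixAmp]
  split_ifs with h
  · rw [h, openWeight_mid, mul_one]
  · rw [mul_zero]

theorem sum_pathWeight : ∀ {p : ℕ} (β : Fin p → ℝ), ∑ a, pathWeight β a = 1
  | 0, β => by
    have h : (Finset.univ : Finset (Bits 0)).card = 2 := by
      rw [Finset.card_univ]; simp [Bits]
    simp [pathWeight, h]
  | p + 1, β => by
    rw [← (insEquiv p).sum_comp, Fintype.sum_prod_type]
    simp only [Fintype.sum_prod_type, insEquiv, Equiv.coe_fn_mk, sum_pathWeight_ins,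
      Finset.sum_ite_eq', Finset.mem_univ, if_true]
    exact sum_pathWeight _

theorem dup_apply (a : Bits p) (k : Fin (2 * (p + 1) + 1)) : dup a k = a (collapse k) := rfl

theorem dup_mul (a b : Bits p) : dup (a * b) = dup a * dup b := rfl

theorem dup_prod {ι : Type*} (s : Finset ι) (a : ι → Bits p) :
    dup (∏ i ∈ s, a i) = ∏ i ∈ s, dup (a i) := by
  funext k; simp [dup_apply, Finset.prod_apply]

/-! ### Removing the last angle where the centre is not observed. -/

section Truncation

variable {V : Type*} [Fintype V] [DecidableEq V]

/-- `F` does not depend on the central spins of the strings at the sites outside `S`. -/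
def MidFree {M : Type*} (S : Finset V) (F : (V → Bits p) → M) : Prop :=
  ∀ b b' : V → Bits p, (∀ v ∈ S, b v = b' v) → (∀ v, ∀ k ≠ mid p, b v k = b' v k) → F b = F b'

/-- Write every long string as an insertion. The summand ignores the new centre, so unitarity turns
the sum over it into a Kronecker delta that identifies the inserted backward spin with the old
centre; only strings with a repeated centre survive. -/
theorem avg_dup (β : Fin (p + 1) → ℝ) (F : (V → Bits (p + 1)) → ℂ) (hF : MidFree ∅ F) :
    avg (pathWeight β) F =
      avg (pathWeight (β ∘ Fin.castSucc)) fun a => F fun v => dup (a v) := by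
  have hins : ∀ (a : V → Bits p) (y x x' : V → ℤˣ),
      F (fun v => ins (a v) (y v) (x v)) = F (fun v => ins (a v) (y v) (x' v)) := by
    intro a y x x'
    refine hF _ _ (by simp) fun v k hk => ?_
    have h := congrFun (update_ins (a v) (y v) (x v) (x' v)) k
    rwa [Function.update_of_ne hk] at h
  rw [avg, ← ((Equiv.refl V).arrowCongr (insEquiv p)).sum_comp,
    ← (Equiv.arrowProdEquivProdArrow V (fun _ => Bits p) (fun _ => ℤˣ × ℤˣ)).symm.sum_comp,
    Fintype.sum_prod_type]
  refine Finset.sum_congr rfl fun a _ => ?_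
  rw [← (Equiv.arrowProdEquivProdArrow V (fun _ => ℤˣ) (fun _ => ℤˣ)).symm.sum_comp,
    Fintype.sum_prod_type]
  calc _ = ∑ y : V → ℤˣ, ∑ x : V → ℤˣ, (∏ v, pathWeight β (ins (a v) (y v) (x v))) *
        F (fun v => ins (a v) (y v) (x v)) := rfl
    _ = ∑ y : V → ℤˣ, (∏ v, if y v = a v (mid p) then pathWeight (β ∘ Fin.castSucc) (a v) else 0) *
        F (fun v => ins (a v) (y v) (a v (mid p))) := by
      refine Finset.sum_congr rfl fun y _ => ?_
      simp_rw [fun x => hins a y x (fun v => a v (mid p)), ← Finset.sum_mul]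
      rw [← Fintype.prod_sum (fun v x => pathWeight β (ins (a v) (y v) x))]
      simp only [sum_pathWeight_ins]
    _ = _ := by
      rw [Finset.sum_eq_single (fun v => a v (mid p))]
      · simp [ins_mid]
      · intro y _ hy
        obtain ⟨v, hv⟩ := Function.ne_iff.1 hy
        rw [Finset.prod_eq_zero (Finset.mem_univ v) (if_neg hv), zero_mul]
      · simp

/-- One step of truncation at the sites outside `S`. -/
theorem avg_truncate (β : Fin (p + 1) → ℝ) (S : Finset V) (F : (V → Bits (p + 1)) → ℂ)
    (hF : MidFree S F) :
    avg (pathWeight β) F = avg (pathWeight β) fun x =>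
      avg (pathWeight (β ∘ Fin.castSucc)) fun y => F (S.piecewise x fun v => dup (y v)) := by
  rw [avg_piecewise (sum_pathWeight β) S]
  congr 1
  funext x
  refine avg_dup β _ fun b b' _ h => hF _ _ (fun v hv => by simp [hv]) fun v k hk => ?_
  by_cases hv : v ∈ S
  · simp [hv]
  · simpa [hv] using h v k hk

theorem sum_dup (β : Fin (p + 1) → ℝ) (φ : Bits (p + 1) → ℂ)
    (hφ : ∀ b b', (∀ k ≠ mid (p + 1), b k = b' k) → φ b = φ b') :
    ∑ b, pathWeight β b * φ b = ∑ a, pathWeight (β ∘ Fin.castSucc) a * φ (dup a) := by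
  have h := avg_dup (V := Unit) β (fun b => φ (b ())) fun b b' _ h => hφ _ _ (h ())
  rw [avg, avg, ← (Equiv.funUnique Unit (Bits (p + 1))).symm.sum_comp,
    ← (Equiv.funUnique Unit (Bits p)).symm.sum_comp] at h
  simpa using h

end Truncation

/-! ### The pairing with `Γ` -/

theorem gam_sum_mul (γ : Fin p → ℝ) (F : Fin (2 * p + 1) → ℂ) :
    ∑ k, (Gam γ k : ℂ) * F k =
      ∑ r : Fin p, (γ r : ℂ) * (F (fpos p r r.2.le) - F (bpos p r r.2.le)) := by
  simpa only [Complex.real_smul] using gam_sum γ F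

theorem gamDot_eq (γ : Fin p → ℝ) (a : Bits p) :
    gamDot γ a = ∑ r : Fin p, γ r *
      (((a (fpos p r r.2.le) : ℤ) : ℝ) - ((a (bpos p r r.2.le) : ℤ) : ℝ)) := by
  simpa only [smul_eq_mul, gamDot] using gam_sum γ fun k => ((a k : ℤ) : ℝ)

theorem collapse_fpos (r : ℕ) (h : r ≤ p) : collapse (fpos (p + 1) r (by omega)) = fpos p r h := by
  simp [collapse, fpos, h]

theorem collapse_bpos (r : ℕ) (h : r ≤ p) : collapse (bpos (p + 1) r (by omega)) = bpos p r h := by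
  have h0 : (bpos (p + 1) r (by omega)).val = 2 * (p + 1) - r := rfl
  rw [collapse, dif_neg (by omega)]
  split_ifs with h1
  · ext; simp only [mid, bpos]; omega
  · ext; simp only [bpos]; omega

/-- Both positions of the last angle collapse to the centre, so their contributions, with opposite
signs, cancel. -/
theorem gam_sum_collapse {M : Type*} [AddCommGroup M] [Module ℝ M] (γ : Fin (p + 1) → ℝ)
    (F : Fin (2 * p + 1) → M) :
    ∑ k, Gam γ k • F (collapse k) = ∑ k, Gam (γ ∘ Fin.castSucc) k • F k := by
  rw [gam_sum γ fun k => F (collapse k), gam_sum, Fin.sum_univ_castSucc]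
  simp only [Fin.val_castSucc, Fin.val_last]
  rw [collapse_fpos p le_rfl, collapse_bpos p le_rfl]
  have : bpos p p le_rfl = fpos p p le_rfl := by ext; simp [bpos, fpos]; omega
  rw [this, sub_self, smul_zero, add_zero]
  refine Finset.sum_congr rfl fun r _ => ?_
  rw [collapse_fpos _ r.2.le, collapse_bpos _ r.2.le]
  rfl

theorem gamDot_dup (γ : Fin (p + 1) → ℝ) (a : Bits p) :
    gamDot γ (dup a) = gamDot (γ ∘ Fin.castSucc) a := by
  simpa only [smul_eq_mul, gamDot, dup_apply] using gam_sum_collapse γ fun k => ((a k : ℤ) : ℝ)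

theorem gamDot_congr (γ : Fin p → ℝ) {a b : Bits p} (h : ∀ k ≠ mid p, a k = b k) :
    gamDot γ a = gamDot γ b := by
  refine Finset.sum_congr rfl fun k _ => ?_
  by_cases hk : k = mid p
  · rw [hk, Gam_mid, zero_mul, zero_mul]
  · rw [h k hk]

theorem gamDot_neg (γ : Fin p → ℝ) (a : Bits p) : gamDot γ (-a) = -gamDot γ a := by
  simp [gamDot, Finset.sum_neg_distrib]

theorem pathWeight_neg (β : Fin p → ℝ) (a : Bits p) : pathWeight β (-a) = pathWeight β a := by
  simp [pathWeight, mixAmp_neg]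

theorem spin_neg (a : Bits p) (k : Fin (2 * p + 1)) : spin (-a) k = -spin a k := by
  simp [spin]

theorem spin_mul (a b : Bits p) (k : Fin (2 * p + 1)) : spin (a * b) k = spin a k * spin b k := by
  simp [spin]

theorem spin_prod {ι : Type*} (s : Finset ι) (a : ι → Bits p) (k : Fin (2 * p + 1)) :
    spin (∏ i ∈ s, a i) k = ∏ i ∈ s, spin (a i) k := by
  simp [spin, Finset.prod_apply]

theorem spin_mul_self (a : Bits p) (k : Fin (2 * p + 1)) : spin a k * spin a k = 1 := by
  rw [← spin_mul]
  have : a * a = 1 := by funext k; simp [Int.units_mul_self]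
  rw [this]; simp [spin]

theorem spin_dup (a : Bits p) (k : Fin (2 * (p + 1) + 1)) : spin (dup a) k = spin a (collapse k) :=
  rfl

/-! ### Reversal -/

/-- The reversed string. -/
def revBits (p : ℕ) : Bits p ≃ Bits p := (Fin.revPerm.arrowCongr (Equiv.refl ℤˣ))

theorem revBits_apply (a : Bits p) (k : Fin (2 * p + 1)) : revBits p a k = a k.rev := rfl

theorem revBits_mul (a b : Bits p) : revBits p (a * b) = revBits p a * revBits p b := rfl

theorem revBits_prod {ι : Type*} (s : Finset ι) (a : ι → Bits p) :
    revBits p (∏ i ∈ s, a i) = ∏ i ∈ s, revBits p (a i) := by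
  funext k; simp [revBits_apply, Finset.prod_apply]

theorem spin_revBits (a : Bits p) (k : Fin (2 * p + 1)) : spin (revBits p a) k = spin a k.rev := rfl

theorem rev_mid : (mid p).rev = mid p := by ext; simp [mid, Fin.val_rev]; omega

theorem Gam_rev (γ : Fin p → ℝ) (k : Fin (2 * p + 1)) : Gam γ k.rev = -Gam γ k := by
  have hk := k.2
  unfold Gam
  rcases lt_trichotomy k.val p with h | h | h
  · rw [dif_neg (by rw [Fin.val_rev]; omega), dif_pos (by rw [Fin.val_rev]; omega), dif_pos h]
    congr 2; ext; simp only [Fin.val_rev]; omega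
  · rw [dif_neg (by rw [Fin.val_rev]; omega), dif_neg (by rw [Fin.val_rev]; omega),
      dif_neg (by omega), dif_neg (by omega), neg_zero]
  · rw [dif_pos (by rw [Fin.val_rev]; omega), dif_neg (by omega), dif_pos h, neg_neg]
    congr 1; ext; simp only [Fin.val_rev]; omega

theorem gamDot_revBits (γ : Fin p → ℝ) (a : Bits p) : gamDot γ (revBits p a) = -gamDot γ a := by
  rw [gamDot, gamDot, ← Equiv.sum_comp Fin.revPerm, ← Finset.sum_neg_distrib]
  refine Finset.sum_congr rfl fun k _ => ?_
  simp [revBits_apply, Gam_rev]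

/-- Conjugation negates every mixing angle, and so does reversal, because the angles are
antisymmetric and each amplitude is symmetric in its two spins. -/
theorem conj_pathWeight (β : Fin p → ℝ) (a : Bits p) :
    (starRingEnd ℂ) (pathWeight β a) = pathWeight β (revBits p a) := by
  rw [pathWeight, pathWeight, map_mul, map_prod]
  congr 1
  · simp [Complex.conj_ofNat]
  rw [← Equiv.prod_comp Fin.revPerm]
  refine Finset.prod_congr rfl fun k _ => ?_
  have hk := k.2
  rw [conj_mixAmp, mixAmp_comm]
  congr 1
  · simp only [mixAngle, Fin.revPerm_apply, Fin.val_rev]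
    by_cases h : k.val < p
    · rw [dif_neg (by omega), dif_pos h, neg_neg]
      congr 1; ext; simp; omega
    · rw [dif_pos (by omega), dif_neg h]
      congr 2; ext; simp; omega
  · rw [revBits_apply]; congr 1; ext; simp only [Fin.revPerm_apply, Fin.val_rev, Fin.val_succ, Fin.val_castSucc]; omega
  · rw [revBits_apply]; congr 1; ext; simp only [Fin.revPerm_apply, Fin.val_rev, Fin.val_succ, Fin.val_castSucc]; omega

theorem conj_spin (a : Bits p) (k : Fin (2 * p + 1)) : (starRingEnd ℂ) (spin a k) = spin a k := by
  simp [spin]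

end Strings

theorem avg_pi {V X : Type*} [Fintype V] [Fintype X] [DecidableEq V] (w : X → ℂ) (φ : V → X → ℂ) :
    avg w (fun a => ∏ v, φ v (a v)) = ∏ v, ∑ x, w x * φ v x := by
  rw [avg, Fintype.prod_sum]
  exact Finset.sum_congr rfl fun a _ => by rw [Finset.prod_mul_distrib]

theorem avg_iid {V X : Type*} [Fintype V] [Fintype X] [DecidableEq V] (w : X → ℂ) (φ : X → ℂ) :
    avg w (fun a : V → X => ∏ v, φ (a v)) = (∑ x, w x * φ x) ^ Fintype.card V := by
  rw [avg_pi, Finset.prod_const, Finset.card_univ]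

/-! ## The finite iteration -/

section Tree

variable {p : ℕ} (q D : ℕ) (γ β : Fin p → ℝ)

theorem treeH_zero (a : Bits p) : treeH q D γ β 0 a = 1 := rfl

theorem treeH_succ (m : ℕ) (a : Bits p) : treeH q D γ β (m + 1) a =
    (avg (pathWeight β) fun b : Fin (q - 1) → Bits p =>
      (Real.cos ((1 / √(D : ℝ)) * gamDot γ (a * ∏ i, b i)) : ℂ) *
        ∏ i, treeH q D γ β m (b i)) ^ D := by
  rw [treeH, avg]
  congr 1
  refine Finset.sum_congr rfl fun b _ => ?_
  rw [Finset.prod_mul_distrib]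
  ring

/-- The central spin enters only through Γ, which vanishes there. -/
theorem treeH_congr {m : ℕ} {a b : Bits p} (h : ∀ k ≠ mid p, a k = b k) :
    treeH q D γ β m a = treeH q D γ β m b := by
  cases m with
  | zero => rfl
  | succ m =>
    rw [treeH_succ, treeH_succ]
    congr 2
    funext c
    rw [gamDot_congr γ (b := b * ∏ i, c i) fun k hk => by simp [h k hk]]

theorem treeH_neg (m : ℕ) (a : Bits p) : treeH q D γ β m (-a) = treeH q D γ β m a := by
  cases m with
  | zero => rfl
  | succ m =>
    rw [treeH_succ, treeH_succ]
    congr 2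
    funext c
    rw [neg_mul, gamDot_neg, mul_neg, Real.cos_neg]

theorem conj_treeH (m : ℕ) (a : Bits p) :
    (starRingEnd ℂ) (treeH q D γ β m a) = treeH q D γ β m (revBits p a) := by
  induction m generalizing a with
  | zero => simp [treeH_zero]
  | succ m ih =>
    rw [treeH_succ, treeH_succ, map_pow, avg, avg, map_sum]
    congr 1
    refine Fintype.sum_equiv ((Equiv.refl _).arrowCongr (revBits p)) _ _ fun b => ?_
    simp only [map_mul, map_prod, conj_pathWeight, ih, Complex.conj_ofReal]
    have : gamDot γ (revBits p a * ∏ i, ((Equiv.refl _).arrowCongr (revBits p)) b i) =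
        -gamDot γ (a * ∏ i, b i) := by
      rw [← gamDot_revBits, revBits_mul, revBits_prod]; rfl
    rw [this, mul_neg, Real.cos_neg]
    rfl

/-- The level `m` is kept and only the number of angles drops. The summand at each level ignores
central spins, so `avg_dup` shortens the summed strings too. -/
theorem treeH_dup (γ β : Fin (p + 1) → ℝ) (m : ℕ) (a : Bits p) : treeH q D γ β m (dup a) =
    treeH q D (γ ∘ Fin.castSucc) (β ∘ Fin.castSucc) m a := by
  induction m generalizing a with
  | zero => rfl
  | succ m ih =>
    rw [treeH_succ, treeH_succ, avg_dup]
    · simp only [ih, ← dup_prod, ← dup_mul, gamDot_dup]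
    · intro b b' _ h
      have h1 : gamDot γ (dup a * ∏ i, b i) = gamDot γ (dup a * ∏ i, b' i) :=
        gamDot_congr γ fun k hk => by
          simp only [Pi.mul_apply, Finset.prod_apply, fun i => h i k hk]
      dsimp only
      rw [h1]
      congr 1
      exact Finset.prod_congr rfl fun i _ => treeH_congr _ _ _ _ (h i)

/-- The induction is on the number of angles, uniformly in the level: H ignores the centre, so
angles are removed one at a time until Γ is zero, where every cosine, and hence H, is 1. -/
theorem sum_pathWeight_treeH : ∀ {p : ℕ} (γ β : Fin p → ℝ) (m : ℕ),
    ∑ a, pathWeight β a * treeH q D γ β m a = 1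
  | 0, γ, β, m => by
    have hH : ∀ m a, treeH q D γ β m a = 1 := by
      intro m
      induction m with
      | zero => exact fun a => rfl
      | succ m ih =>
        intro a
        rw [treeH_succ]
        simp [ih, gamDot_eq, avg_const (sum_pathWeight β)]
    simp only [hH, mul_one, sum_pathWeight]
  | p + 1, γ, β, m => by
    rw [sum_dup β _ fun b b' h => treeH_congr q D γ β h]
    simp only [treeH_dup]
    exact sum_pathWeight_treeH _ _ m

theorem avg_prod_treeH {V : Type*} [Fintype V] [DecidableEq V] (m : ℕ) :
    avg (pathWeight β) (fun b : V → Bits p => ∏ i, treeH q D γ β m (b i)) = 1 := by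
  rw [avg_pi]
  simp [sum_pathWeight_treeH]

theorem nuFormula_eq_avg : nuFormula q D γ β =
    Complex.I * (√((D : ℝ) / (2 * q)) : ℂ) * avg (pathWeight β) fun a : Fin q → Bits p =>
      (Real.sin ((1 / √(D : ℝ)) * gamDot γ (∏ i, a i)) : ℂ) *
        ∏ i, (spin (a i) (mid p) * treeH q D γ β p (a i)) := by
  rw [nuFormula, avg]
  congr 1
  refine Finset.sum_congr rfl fun a _ => ?_
  simp only [Finset.prod_mul_distrib]
  ring

/-- Reversal realises conjugation of f and H, fixes the central spin and negates the argument of the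
sine. The average is therefore purely imaginary, and the prefactor i makes the product real. -/
theorem conj_nuFormula : (starRingEnd ℂ) (nuFormula q D γ β) = nuFormula q D γ β := by
  have h : (starRingEnd ℂ) (avg (pathWeight β) fun a : Fin q → Bits p =>
      (Real.sin ((1 / √(D : ℝ)) * gamDot γ (∏ i, a i)) : ℂ) *
        ∏ i, (spin (a i) (mid p) * treeH q D γ β p (a i))) =
      -avg (pathWeight β) fun a : Fin q → Bits p =>
      (Real.sin ((1 / √(D : ℝ)) * gamDot γ (∏ i, a i)) : ℂ) *
        ∏ i, (spin (a i) (mid p) * treeH q D γ β p (a i)) := by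
    rw [avg, map_sum, ← Finset.sum_neg_distrib]
    refine Fintype.sum_equiv ((Equiv.refl _).arrowCongr (revBits p)) _ _ fun b => ?_
    simp only [map_mul, map_prod, conj_pathWeight, conj_treeH, conj_spin, Complex.conj_ofReal]
    have : gamDot γ (∏ i, ((Equiv.refl _).arrowCongr (revBits p)) b i) =
        -gamDot γ (∏ i, b i) := by
      rw [← gamDot_revBits, revBits_prod]; rfl
    rw [this, mul_neg, Real.sin_neg, Complex.ofReal_neg, neg_mul, mul_neg, neg_neg]
    simp only [Equiv.arrowCongr_apply, Equiv.coe_refl, Function.comp, id, Equiv.refl_symm,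
      spin_revBits, rev_mid]
  rw [nuFormula_eq_avg, map_mul, map_mul, h, Complex.conj_I, Complex.conj_ofReal]
  ring

end Tree

/-! ## The infinite-degree iteration -/

section Limit

variable {p : ℕ} (q : ℕ) (γ β : Fin p → ℝ)

/-- The quadratic form in the exponent of the iteration for `G`. -/
noncomputable def quadForm (M : Matrix (Fin (2 * p + 1)) (Fin (2 * p + 1)) ℂ) (a : Bits p) : ℂ :=
  ∑ j, ∑ k, M j k ^ (q - 1) * (Gam γ j : ℂ) * (Gam γ k : ℂ) * spin a j * spin a k

/-- The limit of `treeH` as the degree tends to infinity. -/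
noncomputable def limH : ℕ → Bits p → ℂ
  | 0, _ => 1
  | m + 1, a => Complex.exp (-(1 / 2) * quadForm q γ (matG q γ β m) a)

theorem matG_apply (m : ℕ) (j k : Fin (2 * p + 1)) : matG q γ β m j k =
    ∑ a, pathWeight β a * (spin a j * spin a k * limH q γ β m a) := by
  cases m with
  | zero => simp [matG, limH, mul_assoc]
  | succ m => simp only [matG, limH, quadForm, Matrix.of_apply, mul_assoc]

theorem tendsto_sqrt_mul_sin (c : ℝ) :
    Tendsto (fun D : ℕ => √(D : ℝ) * Real.sin ((1 / √(D : ℝ)) * c)) atTop (𝓝 c) := by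
  have h0 : Tendsto (fun D : ℕ => (1 / √(D : ℝ)) * c) atTop (𝓝 0) := by
    have : Tendsto (fun D : ℕ => √(D : ℝ)) atTop atTop :=
      Real.tendsto_sqrt_atTop.comp tendsto_natCast_atTop_atTop
    simpa using (this.inv_tendsto_atTop).mul_const c
  have h1 : Tendsto (fun D : ℕ => c * Real.sinc ((1 / √(D : ℝ)) * c)) atTop (𝓝 c) := by
    have := ((Real.continuous_sinc.tendsto 0).comp h0).const_mul c
    simpa using this
  refine h1.congr' ?_
  filter_upwards [eventually_gt_atTop 0] with D hD
  have hs : 0 < √(D : ℝ) := Real.sqrt_pos.2 (by exact_mod_cast hD)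
  by_cases hc : c = 0
  · simp [hc]
  · rw [Real.sinc_of_ne_zero (by positivity)]
    field_simp

/-- Through 1 - cos x = 2 sin²(x/2) the second-order limit is the square of the first-order one. -/
theorem tendsto_mul_cos_sub_one (c : ℝ) :
    Tendsto (fun D : ℕ => (D : ℝ) * (Real.cos ((1 / √(D : ℝ)) * c) - 1)) atTop
      (𝓝 (-(c ^ 2) / 2)) := by
  have h := ((tendsto_sqrt_mul_sin (c / 2)).pow 2).const_mul (-2)
  have e : -2 * (c / 2) ^ 2 = -(c ^ 2) / 2 := by ring
  rw [e] at h
  refine h.congr fun D => ?_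
  have h1 : (1 / √(D : ℝ)) * c = 2 * ((1 / √(D : ℝ)) * (c / 2)) := by ring
  rw [h1, Real.cos_two_mul', mul_pow, Real.sq_sqrt (Nat.cast_nonneg D), Real.cos_sq']
  ring

theorem ofReal_gamDot (a : Bits p) : (gamDot γ a : ℂ) = ∑ k, (Gam γ k : ℂ) * spin a k := by
  simp [gamDot, spin]

/-- After expanding the square, the spins of the q-1 independent strings separate in each term, and
every string contributes the same entry of G; this is the source of the power q-1. -/
theorem avg_gamDot_sq (m : ℕ) (a : Bits p) :
    (avg (pathWeight β) fun b : Fin (q - 1) → Bits p =>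
      (gamDot γ (a * ∏ i, b i) : ℂ) ^ 2 * ∏ i, limH q γ β m (b i)) =
      quadForm q γ (matG q γ β m) a := by
  have h : ∀ b : Fin (q - 1) → Bits p,
      (gamDot γ (a * ∏ i, b i) : ℂ) ^ 2 * ∏ i, limH q γ β m (b i) =
      ∑ j, ∑ k, ((Gam γ j : ℂ) * (Gam γ k : ℂ) * spin a j * spin a k) *
        ∏ i, (spin (b i) j * spin (b i) k * limH q γ β m (b i)) := by
    intro b
    rw [ofReal_gamDot, sq, Finset.sum_mul_sum, Finset.sum_mul]
    refine Finset.sum_congr rfl fun j _ => ?_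
    rw [Finset.sum_mul]
    refine Finset.sum_congr rfl fun k _ => ?_
    simp only [spin_mul, spin_prod, Finset.prod_mul_distrib]
    ring
  simp only [h, avg_sum, avg_const_mul, quadForm]
  refine Finset.sum_congr rfl fun j _ => Finset.sum_congr rfl fun k _ => ?_
  rw [avg_iid _ fun x => spin x j * spin x k * limH q γ β m x, ← matG_apply, Fintype.card_fin]
  ring

/-- The average of ∏ H over the children is exactly 1 for every D, so the base of the power is 1
plus an average of (cos - 1)·∏ H. Scaled by D, this average converges termwise, and (1 + g_D)^D
tends to the exponential of the limit of D·g_D. -/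
theorem tendsto_treeH (m : ℕ) (a : Bits p) :
    Tendsto (fun D : ℕ => treeH q D γ β m a) atTop (𝓝 (limH q γ β m a)) := by
  induction m generalizing a with
  | zero => exact tendsto_const_nhds
  | succ m ih =>
    let g : ℕ → ℂ := fun D => avg (pathWeight β) fun b : Fin (q - 1) → Bits p =>
      ((Real.cos ((1 / √(D : ℝ)) * gamDot γ (a * ∏ i, b i)) - 1 : ℝ) : ℂ) *
        ∏ i, treeH q D γ β m (b i)
    have hg : ∀ D, treeH q D γ β (m + 1) a = (1 + g D) ^ D := by
      intro D
      rw [treeH_succ, ← avg_prod_treeH q D γ β (V := Fin (q - 1)) m, ← avg_add]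
      congr 2
      funext b
      push_cast
      ring
    simp only [hg]
    refine Complex.tendsto_one_add_pow_exp_of_tendsto ?_
    have ht : -(1 / 2) * quadForm q γ (matG q γ β m) a =
        ∑ b : Fin (q - 1) → Bits p, (∏ i, pathWeight β (b i)) *
          (((-(gamDot γ (a * ∏ i, b i) ^ 2) / 2 : ℝ) : ℂ) * ∏ i, limH q γ β m (b i)) := by
      rw [← avg_gamDot_sq, avg, Finset.mul_sum]
      refine Finset.sum_congr rfl fun b _ => ?_
      push_cast
      ring
    rw [ht]
    have hD : ∀ D : ℕ, (D : ℂ) * g D = ∑ b : Fin (q - 1) → Bits p, (∏ i, pathWeight β (b i)) *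
        ((((D : ℝ) * (Real.cos ((1 / √(D : ℝ)) * gamDot γ (a * ∏ i, b i)) - 1) : ℝ) : ℂ) *
          ∏ i, treeH q D γ β m (b i)) := by
      intro D
      simp only [g, avg, Finset.mul_sum]
      refine Finset.sum_congr rfl fun b _ => ?_
      push_cast
      ring
    simp only [hD]
    refine tendsto_finsetSum _ fun b _ => Tendsto.const_mul _ (Tendsto.mul ?_ ?_)
    · exact (Complex.continuous_ofReal.tendsto _).comp (tendsto_mul_cos_sub_one _)
    · exact tendsto_finsetProd _ fun i _ => ih _

/-- Inherited from finite D by passing to the limit in a finite sum. -/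
theorem sum_pathWeight_limH (m : ℕ) : ∑ a, pathWeight β a * limH q γ β m a = 1 := by
  refine tendsto_nhds_unique (f := fun D : ℕ => ∑ a, pathWeight β a * treeH q D γ β m a)
    (tendsto_finsetSum _ fun a _ => (tendsto_treeH q γ β m a).const_mul _) ?_
  simp only [sum_pathWeight_treeH]
  exact tendsto_const_nhds

theorem avg_gamDot_spin : (avg (pathWeight β) fun a : Fin q → Bits p =>
      (gamDot γ (∏ i, a i) : ℂ) * ∏ i, (spin (a i) (mid p) * limH q γ β p (a i))) =
    ∑ j, (Gam γ j : ℂ) * (matG q γ β p (mid p) j) ^ q := by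
  have h : ∀ b : Fin q → Bits p,
      (gamDot γ (∏ i, b i) : ℂ) * ∏ i, (spin (b i) (mid p) * limH q γ β p (b i)) =
      ∑ j, (Gam γ j : ℂ) * ∏ i, (spin (b i) (mid p) * spin (b i) j * limH q γ β p (b i)) := by
    intro b
    rw [ofReal_gamDot, Finset.sum_mul]
    refine Finset.sum_congr rfl fun j _ => ?_
    simp only [spin_prod, Finset.prod_mul_distrib]
    ring
  simp only [h, avg_sum, avg_const_mul]
  refine Finset.sum_congr rfl fun j _ => ?_
  rw [avg_iid _ fun x => spin x (mid p) * spin x j * limH q γ β p x, ← matG_apply,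
    Fintype.card_fin]

theorem tendsto_nuFormula :
    Tendsto (fun D : ℕ => nuFormula q D γ β) atTop (𝓝 (nuLimitFormula q γ β)) := by
  have h : ∀ D : ℕ, nuFormula q D γ β = (Complex.I / (√(2 * (q : ℝ)) : ℂ)) *
      ∑ a : Fin q → Bits p, (∏ i, pathWeight β (a i)) *
        (((√(D : ℝ) * Real.sin ((1 / √(D : ℝ)) * gamDot γ (∏ i, a i)) : ℝ) : ℂ) *
          ∏ i, (spin (a i) (mid p) * treeH q D γ β p (a i))) := by
    intro D
    rw [nuFormula_eq_avg, avg, Real.sqrt_div (Nat.cast_nonneg D), Complex.ofReal_div,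
      Finset.mul_sum, Finset.mul_sum]
    refine Finset.sum_congr rfl fun a _ => ?_
    push_cast
    ring
  simp only [h]
  rw [nuLimitFormula, ← avg_gamDot_spin, avg]
  refine Tendsto.const_mul _ (tendsto_finsetSum _ fun b _ => Tendsto.const_mul _
    (Tendsto.mul ?_ ?_))
  · exact (Complex.continuous_ofReal.tendsto _).comp (tendsto_sqrt_mul_sin _)
  · exact tendsto_finsetProd _ fun i _ => (tendsto_treeH _ _ _ _ _).const_mul _

theorem conj_nuLimitFormula : (starRingEnd ℂ) (nuLimitFormula q γ β) = nuLimitFormula q γ β := by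
  refine tendsto_nhds_unique ((Complex.continuous_conj.tendsto _).comp (tendsto_nuFormula q γ β)) ?_
  simp only [Function.comp_def, conj_nuFormula]
  exact tendsto_nuFormula q γ β

/-! ### Truncation of the matrices -/

theorem matG_comm (m : ℕ) (j k : Fin (2 * p + 1)) : matG q γ β m j k = matG q γ β m k j := by
  simp only [matG_apply, mul_comm (spin _ j)]

theorem matG_self (m : ℕ) (j : Fin (2 * p + 1)) : matG q γ β m j j = 1 := by
  simp only [matG_apply, spin_mul_self, one_mul, sum_pathWeight_limH]

theorem quadForm_congr {M M' : Matrix (Fin (2 * p + 1)) (Fin (2 * p + 1)) ℂ}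
    (h : ∀ j ≠ mid p, ∀ k ≠ mid p, M j k = M' j k) {a b : Bits p}
    (hab : ∀ k ≠ mid p, a k = b k) : quadForm q γ M a = quadForm q γ M' b := by
  refine Finset.sum_congr rfl fun j _ => Finset.sum_congr rfl fun k _ => ?_
  by_cases hj : j = mid p
  · simp [hj, Gam_mid]
  by_cases hk : k = mid p
  · simp [hk, Gam_mid]
  simp only [h j hj k hk, spin, hab j hj, hab k hk]

theorem limH_congr {m : ℕ} {a b : Bits p} (h : ∀ k ≠ mid p, a k = b k) :
    limH q γ β m a = limH q γ β m b := by
  cases m with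
  | zero => rfl
  | succ m => rw [limH, limH, quadForm_congr q γ (fun _ _ _ _ => rfl) h]

theorem quadForm_dup (γ : Fin (p + 1) → ℝ) (M : Matrix (Fin (2 * p + 1)) (Fin (2 * p + 1)) ℂ)
    (a : Bits p) : quadForm q γ (Matrix.of fun j k => M (collapse j) (collapse k)) (dup a) =
      quadForm q (γ ∘ Fin.castSucc) M a := by
  let R : Fin (2 * p + 1) → Fin (2 * p + 1) → ℂ := fun j k => M j k ^ (q - 1) * spin a j * spin a k
  have h : ∑ j, Gam γ j • ∑ k, Gam γ k • R (collapse j) (collapse k) =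
      ∑ j, Gam (γ ∘ Fin.castSucc) j • ∑ k, Gam (γ ∘ Fin.castSucc) k • R j k := by
    rw [gam_sum_collapse γ fun j => ∑ k, Gam γ k • R j (collapse k)]
    exact Finset.sum_congr rfl fun j _ => by rw [gam_sum_collapse γ (R j)]
  simp only [Complex.real_smul, Finset.mul_sum, R] at h
  simp only [quadForm, spin_dup, Matrix.of_apply]
  convert h using 1 <;>
    exact Finset.sum_congr rfl fun j _ => Finset.sum_congr rfl fun k _ => by ring

/-- Neither the two spins of an off-centre entry nor the exponential factor see the central spin, so
the last layer cancels by unitarity. -/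
theorem matG_collapse (γ β : Fin (p + 1) → ℝ) (m : ℕ) {j k : Fin (2 * (p + 1) + 1)}
    (hj : j ≠ mid (p + 1)) (hk : k ≠ mid (p + 1)) : matG q γ β m j k =
      matG q (γ ∘ Fin.castSucc) (β ∘ Fin.castSucc) m (collapse j) (collapse k) := by
  induction m generalizing j k with
  | zero =>
    simp only [matG_apply, limH, mul_one]
    rw [sum_dup β]
    · rfl
    · intro b b' h; simp only [spin, h j hj, h k hk]
  | succ m ih =>
    rw [matG_apply, sum_dup β]
    · rw [matG_apply]
      refine Finset.sum_congr rfl fun a _ => ?_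
      rw [limH, limH, ← quadForm_dup, quadForm_congr q γ (fun j hj k hk => ih hj hk)
        (fun _ _ => rfl)]
      rfl
    · intro b b' h; simp only [spin, h j hj, h k hk, limH_congr q γ β h]

/-- The exponent uses only off-centre entries, which belong to the problem with one angle fewer and
are already stationary by induction. This lets the limit program index rows by the number of angles
alone. -/
theorem matG_stable : ∀ {p : ℕ} (γ β : Fin p → ℝ) {m : ℕ}, p ≤ m → matG q γ β m = matG q γ β p
  | 0, γ, β, m, _ => by
    ext j k
    rw [matG_apply, matG_apply]
    cases m with
    | zero => rfl
    | succ m =>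
      refine Finset.sum_congr rfl fun a _ => ?_
      have hj : ∀ j : Fin (2 * 0 + 1), Gam γ j = 0 := fun j => by
        rw [(by ext; simp [mid] : j = mid 0), Gam_mid]
      simp [limH, quadForm, hj]
  | p + 1, γ, β, m, h => by
    obtain ⟨m, rfl⟩ : ∃ m', m = m' + 1 := ⟨m - 1, by omega⟩
    ext j k
    rw [matG_apply, matG_apply]
    refine Finset.sum_congr rfl fun a _ => ?_
    rw [limH, limH, quadForm_congr q γ (M' := matG q γ β p) ?_ fun _ _ => rfl]
    intro j hj k hk
    rw [matG_collapse q γ β m hj hk, matG_collapse q γ β p hj hk,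
      matG_stable _ _ (by omega : p ≤ m)]

end Limit

/-! ### The path sum for expectations in the QAOA state. -/

section PathSum

/-- For `X² = 1`, the ring homomorphism `ℂ² → Matrix` with `(1, -1) ↦ X`. -/
noncomputable def involutionHom {n : Type*} [Fintype n] [DecidableEq n] (X : Matrix n n ℂ)
    (h : X * X = 1) : ℂ × ℂ →+* Matrix n n ℂ where
  toFun c := ((c.1 + c.2) / 2) • (1 : Matrix n n ℂ) + ((c.1 - c.2) / 2) • X
  map_one' := by simp
  map_zero' := by simp
  map_add' c d := by
    simp only [Prod.fst_add, Prod.snd_add]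
    module
  map_mul' c d := by
    simp only [Prod.fst_mul, Prod.snd_mul, mul_add, add_mul, Matrix.smul_mul, Matrix.mul_smul,
      Matrix.one_mul, Matrix.mul_one, h]
    module

/-- A continuous ring homomorphism commutes with the exponential, and on ℂ² the exponential is
computed at the two eigenvalues ±iθ separately. -/
theorem exp_involution {n : Type*} [Fintype n] [DecidableEq n] (X : Matrix n n ℂ)
    (h : X * X = 1) (θ : ℝ) : NormedSpace.exp ((Complex.I * (θ : ℂ)) • X) =
      (Real.cos θ : ℂ) • (1 : Matrix n n ℂ) + (Complex.I * (Real.sin θ : ℂ)) • X := by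
  have hc : Continuous (involutionHom X h) := by
    change Continuous fun c : ℂ × ℂ => ((c.1 + c.2) / 2) • (1 : Matrix n n ℂ) +
      ((c.1 - c.2) / 2) • X
    fun_prop
  -- The norm serves only to apply `NormedSpace.map_exp`.
  let _ : NormedRing (Matrix n n ℂ) := Matrix.linftyOpNormedRing
  let _ : NormedAlgebra ℂ (Matrix n n ℂ) := Matrix.linftyOpNormedAlgebra
  have h1 := NormedSpace.map_exp (involutionHom X h) hc (Complex.I * θ, -(Complex.I * θ))
  have h2 : involutionHom X h (Complex.I * θ, -(Complex.I * θ)) = (Complex.I * (θ : ℂ)) • X := by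
    simp [involutionHom]
  rw [h2] at h1
  refine h1.symm.trans ?_
  have h3 : NormedSpace.exp ((Complex.I * θ, -(Complex.I * θ)) : ℂ × ℂ) =
      (Complex.exp (Complex.I * θ), Complex.exp (-(Complex.I * θ))) := by
    refine Prod.ext ?_ ?_
    · rw [Prod.fst_exp, Complex.exp_eq_exp_ℂ]
    · rw [Prod.snd_exp, Complex.exp_eq_exp_ℂ]
  rw [h3]
  simp only [involutionHom, RingHom.coe_mk, MonoidHom.coe_mk, OneHom.coe_mk]
  congr 2
  · rw [Complex.ofReal_cos, Complex.cos]; ring_nf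
  · rw [Complex.ofReal_sin, Complex.sin]
    ring_nf
    simp
    ring

variable {V : Type*} [Fintype V] [DecidableEq V]

theorem pauliX_mul (v : V) (M : Matrix (V → ℤˣ) (V → ℤˣ) ℂ) (z z' : V → ℤˣ) :
    (pauliX v * M) z z' = M (Function.update z v (-z v)) z' := by
  simp [Matrix.mul_apply, pauliX]

theorem pauliX_mul_self (v : V) : (pauliX v * pauliX v : Matrix (V → ℤˣ) (V → ℤˣ) ℂ) = 1 := by
  ext z z'
  rw [pauliX_mul]
  simp [pauliX, Matrix.one_apply, eq_comm]

theorem pauliX_commute (v w : V) :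
    Commute (pauliX v : Matrix (V → ℤˣ) (V → ℤˣ) ℂ) (pauliX w) := by
  by_cases hvw : v = w
  · rw [hvw]
  ext z z'
  rw [pauliX_mul, pauliX_mul]
  simp only [pauliX, Matrix.of_apply]
  rw [Function.update_of_ne hvw, Function.update_of_ne (Ne.symm hvw), Function.update_comm hvw]

/-- The flips commute, so the exponential factors over sites. During the induction on `s` the spins
outside `s` are frozen, which the indicator records. -/
theorem exp_sum_pauliX (θ : ℝ) (s : Finset V) (z z' : V → ℤˣ) :
    NormedSpace.exp ((Complex.I * (θ : ℂ)) • ∑ v ∈ s, pauliX v) z z' =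
      if ∀ v ∉ s, z v = z' v then ∏ v ∈ s, mixAmp θ (z v) (z' v) else 0 := by
  induction s using Finset.induction_on generalizing z with
  | empty =>
    simp [Matrix.one_apply, funext_iff]
  | insert w s hw ih =>
    rw [Finset.sum_insert hw, smul_add, Matrix.exp_add_of_commute, exp_involution _
      (pauliX_mul_self w), add_mul, Matrix.add_apply, Matrix.smul_mul, Matrix.smul_mul,
      Matrix.one_mul, Matrix.smul_apply, Matrix.smul_apply, pauliX_mul, ih, ih]
    · have hne : ∀ v ∈ s, v ≠ w := fun v hv h => hw (h ▸ hv)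
      have hp : ∏ v ∈ s, mixAmp θ (Function.update z w (-z w) v) (z' v) =
          ∏ v ∈ s, mixAmp θ (z v) (z' v) :=
        Finset.prod_congr rfl fun v hv => by rw [Function.update_of_ne (hne v hv)]
      rw [hp, Finset.prod_insert hw]
      have h1 : (∀ v ∉ s, z v = z' v) ↔ (∀ v ∉ insert w s, z v = z' v) ∧ z w = z' w := by
        constructor
        · exact fun h => ⟨fun v hv => h v fun h' => hv (by simp [h']), h w hw⟩
        · rintro ⟨h, h'⟩ v hv
          by_cases hvw : v = w
          · rwa [hvw]
          · exact h v (by simp [hvw, hv])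
      have h2 : (∀ v ∉ s, Function.update z w (-z w) v = z' v) ↔
          (∀ v ∉ insert w s, z v = z' v) ∧ ¬ z w = z' w := by
        have hneg : -z w = z' w ↔ ¬ z w = z' w := by
          rcases Int.units_eq_one_or (z w) with h | h <;>
            rcases Int.units_eq_one_or (z' w) with h' | h' <;> simp [h, h']
        constructor
        · refine fun h => ⟨fun v hv => ?_, ?_⟩
          · have hvw : v ≠ w := fun h' => hv (by simp [h'])
            rw [← h v fun h' => hv (by simp [h']), Function.update_of_ne hvw]
          · have := h w hw
            rwa [Function.update_self, hneg] at this
        · rintro ⟨h, h'⟩ v hv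
          by_cases hvw : v = w
          · subst hvw; rwa [Function.update_self, hneg]
          · rw [Function.update_of_ne hvw]; exact h v (by simp [hvw, hv])
      by_cases h : ∀ v ∉ insert w s, z v = z' v
      · by_cases h' : z w = z' w
        · rw [if_pos (h1.2 ⟨h, h'⟩), if_neg (fun h3 => (h2.1 h3).2 h'), if_pos h, mixAmp,
            if_pos h']
          simp
        · rw [if_neg (fun h3 => h' (h1.1 h3).2), if_pos (h2.2 ⟨h, h'⟩), if_pos h, mixAmp,
            if_neg h']
          simp
      · rw [if_neg (fun h3 => h (h1.1 h3).1), if_neg (fun h3 => h (h2.1 h3).1), if_neg h]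
        simp
    · exact ((Commute.sum_right _ _ _ fun v _ => pauliX_commute w v).smul_left _).smul_right _

theorem exp_mixer (θ : ℝ) (z z' : V → ℤˣ) :
    NormedSpace.exp ((Complex.I * (θ : ℂ)) • (mixer : Matrix (V → ℤˣ) (V → ℤˣ) ℂ)) z z' =
      ∏ v, mixAmp θ (z v) (z' v) := by
  rw [mixer, exp_sum_pauliX]; simp

theorem exp_costOp (c : (V → ℤˣ) → ℝ) (s : ℂ) :
    NormedSpace.exp (s • costOp c) = Matrix.diagonal fun z => Complex.exp (s * c z) := by
  rw [costOp, ← Matrix.diagonal_smul, Matrix.exp_diagonal]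
  congr 1
  funext z
  rw [Pi.coe_exp, Complex.exp_eq_exp_ℂ]
  rfl

theorem qaoaState_succ (c : (V → ℤˣ) → ℝ) {p : ℕ} (γ β : Fin (p + 1) → ℝ) (x : V → ℤˣ) :
    qaoaState c γ β x = ∑ z, (∏ v, mixAmp (-β (Fin.last p)) (x v) (z v)) *
      (Complex.exp (-(Complex.I * (γ (Fin.last p) * c z : ℝ))) *
        qaoaState c (γ ∘ Fin.castSucc) (β ∘ Fin.castSucc) z) := by
  rw [qaoaState, List.finRange_succ_last, List.foldl_append, List.foldl_map]
  simp only [List.foldl_cons, List.foldl_nil, Matrix.mulVec, dotProduct, exp_costOp]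
  refine Finset.sum_congr rfl fun z _ => ?_
  have h1 : -Complex.I * ((β (Fin.last p) : ℝ) : ℂ) =
      Complex.I * ((-β (Fin.last p) : ℝ) : ℂ) := by push_cast; ring
  rw [h1, exp_mixer]
  congr 1
  simp only [Matrix.diagonal_apply, ite_mul, zero_mul, Finset.sum_ite_eq, Finset.mem_univ, if_true]
  congr 1
  · push_cast
    ring_nf
  · simp only [qaoaState, exp_costOp]
    rfl

/-- The classical action `∑_k Γ_k c(a_k)` of a path. -/
noncomputable def action {V : Type*} (c : (V → ℤˣ) → ℝ) {p : ℕ} (γ : Fin p → ℝ) (a : V → Bits p) : ℝ :=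
  ∑ k, Gam γ k * c fun v => a v k

/-- The old centre acquires coefficient γ_p and the inserted backward spin -γ_p; the new centre has
coefficient 0. -/
theorem action_ins {V : Type*} (c : (V → ℤˣ) → ℝ) {p : ℕ} (γ : Fin (p + 1) → ℝ) (a : V → Bits p)
    (y x : V → ℤˣ) : action c γ (fun v => ins (a v) (y v) (x v)) =
      action c (γ ∘ Fin.castSucc) a +
        γ (Fin.last p) * (c (fun v => a v (mid p)) - c y) := by
  have h1 := gam_sum γ fun k => c fun v => ins (a v) (y v) (x v) k
  have h2 := gam_sum (γ ∘ Fin.castSucc) fun k => c fun v => a v k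
  simp only [smul_eq_mul] at h1 h2
  rw [action, action, h1, h2, Fin.sum_univ_castSucc]
  congr 1
  · refine Finset.sum_congr rfl fun r _ => ?_
    simp only [Fin.val_castSucc, ins_fpos _ _ _ _ r.2.le, ins_bpos _ _ _ _ r.2, Function.comp]
  · simp only [Fin.val_last, ins_fpos _ _ _ _ le_rfl, ins_bpos_last]
    rfl

theorem sum_arrow_ins {p : ℕ} (F : (V → Bits (p + 1)) → ℂ) :
    ∑ b, F b = ∑ a : V → Bits p, ∑ y : V → ℤˣ, ∑ x : V → ℤˣ,
      F fun v => ins (a v) (y v) (x v) := by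
  rw [← ((Equiv.refl V).arrowCongr (insEquiv p)).sum_comp,
    ← (Equiv.arrowProdEquivProdArrow V (fun _ => Bits p) (fun _ => ℤˣ × ℤˣ)).symm.sum_comp,
    Fintype.sum_prod_type]
  refine Finset.sum_congr rfl fun a _ => ?_
  rw [← (Equiv.arrowProdEquivProdArrow V (fun _ => ℤˣ) (fun _ => ℤˣ)).symm.sum_comp,
    Fintype.sum_prod_type]
  rfl

/-- A general kernel `T` is required: peeling off the last layer conjugates `T` by it, and the
result need not be diagonal even when `T` is. The conjugated kernel supplies the amplitudes of the
inserted spins. -/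
theorem sum_two_point (c : (V → ℤˣ) → ℝ) : ∀ {p : ℕ} (γ β : Fin p → ℝ)
    (T : (V → ℤˣ) → (V → ℤˣ) → ℂ),
    ∑ z, ∑ z', T z z' * ((starRingEnd ℂ) (qaoaState c γ β z) * qaoaState c γ β z') =
      ∑ a : V → Bits p, ∑ y : V → ℤˣ, (∏ v, openWeight β (a v) (y v)) *
        (Complex.exp (Complex.I * (action c γ a : ℝ)) * T (fun v => a v (mid p)) y)
  | 0, γ, β, T => by
    let e : (V → Bits 0) ≃ (V → ℤˣ) := (Equiv.refl V).arrowCongr (Equiv.funUnique (Fin 1) ℤˣ)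
    symm
    refine Fintype.sum_equiv e _ _ fun a => ?_
    refine Finset.sum_congr rfl fun y _ => ?_
    have h1 : (fun v => a v (mid 0)) = e a := rfl
    have h2 : action c γ a = 0 := by
      rw [action]
      refine Finset.sum_eq_zero fun k _ => ?_
      rw [(by ext; simp [mid] : k = mid 0), Gam_mid, zero_mul]
    rw [h1, h2]
    have h3 : ∀ z : V → ℤˣ, qaoaState c γ β z = plusState z := fun z => rfl
    simp only [h3, plusState, openWeight, Finset.univ_eq_empty, Finset.prod_empty, mul_one,
      Finset.prod_const, Finset.card_univ, Complex.conj_ofReal, Complex.ofReal_zero, mul_zero,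
      Complex.exp_zero, one_mul, ← Complex.ofReal_mul]
    -- The two amplitudes of the plus state multiply to 2^{-|V|}, matching one factor 1/2 per open
    -- weight.
    rw [div_mul_div_comm, Real.mul_self_sqrt (by positivity)]
    push_cast
    rw [one_div_pow, mul_one, mul_comm]
  | p + 1, γ, β, T => by
    let B := β (Fin.last p)
    let g := γ (Fin.last p)
    have hq : ∀ x x' : V → ℤˣ, (starRingEnd ℂ) (qaoaState c γ β x) * qaoaState c γ β x' =
        ∑ z, ∑ z', ((∏ v, mixAmp B (x v) (z v)) * Complex.exp (Complex.I * (g * c z : ℝ)) *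
          ((∏ v, mixAmp (-B) (x' v) (z' v)) * Complex.exp (-(Complex.I * (g * c z' : ℝ))))) *
          ((starRingEnd ℂ) (qaoaState c (γ ∘ Fin.castSucc) (β ∘ Fin.castSucc) z) *
            qaoaState c (γ ∘ Fin.castSucc) (β ∘ Fin.castSucc) z') := by
      intro x x'
      rw [qaoaState_succ, qaoaState_succ, map_sum, Finset.sum_mul_sum]
      refine Finset.sum_congr rfl fun z _ => Finset.sum_congr rfl fun z' _ => ?_
      simp only [map_mul, map_prod, conj_mixAmp, neg_neg, ← Complex.exp_conj, map_neg,
        Complex.conj_I, Complex.conj_ofReal, neg_mul]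
      ring
    have hL : ∑ x, ∑ x', T x x' * ((starRingEnd ℂ) (qaoaState c γ β x) * qaoaState c γ β x') =
        ∑ z, ∑ z', (∑ x, ∑ x', T x x' * ((∏ v, mixAmp B (x v) (z v)) *
          Complex.exp (Complex.I * (g * c z : ℝ)) * ((∏ v, mixAmp (-B) (x' v) (z' v)) *
            Complex.exp (-(Complex.I * (g * c z' : ℝ)))))) *
          ((starRingEnd ℂ) (qaoaState c (γ ∘ Fin.castSucc) (β ∘ Fin.castSucc) z) *
            qaoaState c (γ ∘ Fin.castSucc) (β ∘ Fin.castSucc) z') := by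
      simp only [hq, Finset.mul_sum, Finset.sum_mul]
      calc _ = ∑ w : ((V → ℤˣ) × (V → ℤˣ)), ∑ w' : ((V → ℤˣ) × (V → ℤˣ)), T w.1 w.2 *
            ((∏ v, mixAmp B (w.1 v) (w'.1 v)) * Complex.exp (Complex.I * (g * c w'.1 : ℝ)) *
            ((∏ v, mixAmp (-B) (w.2 v) (w'.2 v)) *
              Complex.exp (-(Complex.I * (g * c w'.2 : ℝ)))) *
            ((starRingEnd ℂ) (qaoaState c (γ ∘ Fin.castSucc) (β ∘ Fin.castSucc) w'.1) *
            qaoaState c (γ ∘ Fin.castSucc) (β ∘ Fin.castSucc) w'.2)) := by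
              simp only [Fintype.sum_prod_type]
        _ = _ := by
              rw [Finset.sum_comm]
              simp only [Fintype.sum_prod_type, mul_assoc]
    rw [hL, sum_two_point c, sum_arrow_ins]
    refine Finset.sum_congr rfl fun a _ => Finset.sum_congr rfl fun y _ => ?_
    simp only [Finset.mul_sum]
    refine Finset.sum_congr rfl fun x _ => Finset.sum_congr rfl fun x' _ => ?_
    have hm : (fun v => ins (a v) (y v) (x v) (mid (p + 1))) = x := by
      funext v; simp [ins, mid]
    rw [hm, action_ins]
    simp only [openWeight_ins, Finset.prod_mul_distrib, fun v => mixAmp_comm (β (Fin.last p)) (a v (mid p))]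
    have he : Complex.exp (Complex.I * ((action c (γ ∘ Fin.castSucc) a +
        γ (Fin.last p) * (c (fun v => a v (mid p)) - c y) : ℝ) : ℂ)) =
        Complex.exp (Complex.I * (action c (γ ∘ Fin.castSucc) a : ℝ)) *
        Complex.exp (Complex.I * (g * c (fun v => a v (mid p)) : ℝ)) *
        Complex.exp (-(Complex.I * (g * c y : ℝ))) := by
      rw [← Complex.exp_add, ← Complex.exp_add]
      congr 1
      push_cast
      ring
    rw [he]
    ring

/-- The path sum for the expectation of a diagonal operator. -/
theorem expectation_costOp (c o : (V → ℤˣ) → ℝ) {p : ℕ} (γ β : Fin p → ℝ) :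
    expectation (costOp o) (qaoaState c γ β) = avg (pathWeight β) fun a : V → Bits p =>
      Complex.exp (Complex.I * (action c γ a : ℝ)) * (o fun v => a v (mid p)) := by
  have h := sum_two_point c γ β fun z z' => if z' = z then (o z : ℂ) else 0
  have h1 : expectation (costOp o) (qaoaState c γ β) = ∑ z, ∑ z', (if z' = z then (o z : ℂ) else 0) *
      ((starRingEnd ℂ) (qaoaState c γ β z) * qaoaState c γ β z') := by
    simp only [expectation, dotProduct, costOp, Matrix.mulVec_diagonal, ite_mul, zero_mul,
      Finset.sum_ite_eq', Finset.mem_univ, if_true, Pi.star_apply]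
    exact Finset.sum_congr rfl fun z _ => by rw [starRingEnd_apply]; ring
  rw [h1, h, avg]
  refine Finset.sum_congr rfl fun a _ => ?_
  simp only [mul_ite, mul_zero, Finset.sum_ite_eq', Finset.mem_univ, if_true, openWeight_mid]

end PathSum

/-! ### Berge cycles as cycles of the incidence graph. -/

section Girth

variable {V : Type*}

/-- The incidence graph of a hypergraph. -/
def incidence (E : Finset (Finset V)) : SimpleGraph (V ⊕ Finset V) where
  Adj
    | .inl v, .inr e => v ∈ e ∧ e ∈ E
    | .inr e, .inl v => v ∈ e ∧ e ∈ E
    | _, _ => False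
  symm := ⟨by rintro (v | e) (w | f) h <;> exact h⟩
  loopless := ⟨by rintro (v | e) h <;> exact h⟩

variable {E : Finset (Finset V)}

theorem incidence_inl_inr {v : V} {e : Finset V} :
    (incidence E).Adj (.inl v) (.inr e) ↔ v ∈ e ∧ e ∈ E := Iff.rfl

theorem incidence_inr_inl {v : V} {e : Finset V} :
    (incidence E).Adj (.inr e) (.inl v) ↔ v ∈ e ∧ e ∈ E := Iff.rfl

theorem incidence_isLeft {x y : V ⊕ Finset V} (h : (incidence E).Adj x y) :
    y.isLeft = !x.isLeft := by
  rcases x with v | e <;> rcases y with w | f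
  · exact h.elim
  · rfl
  · rfl
  · exact h.elim

theorem isLeft_getVert {v : V} {y : V ⊕ Finset V} (c : (incidence E).Walk (.inl v) y) (i : ℕ)
    (hi : i ≤ c.length) : (c.getVert i).isLeft = decide (Even i) := by
  induction i with
  | zero => simp
  | succ i ih =>
    rw [incidence_isLeft (c.adj_getVert_succ (by omega)), ih (by omega)]
    by_cases h : Even i <;> simp [Nat.even_add_one, h]

/-- Positions alternate between vertices and hyperedges, so the even ones give the vertices and the
odd ones the hyperedges. The length is even and at least 3, hence at least 4, which gives k ≥ 2. -/
theorem hasBergeCycle_of_isCycle_inl {v : V} (c : (incidence E).Walk (.inl v) (.inl v))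
    (hc : c.IsCycle) : ∃ k, 2 * k = c.length ∧ HasBergeCycle E k := by
  have h3 := hc.three_le_length
  have heven : Even c.length := by
    have := isLeft_getVert c c.length le_rfl
    rw [c.getVert_length] at this
    simpa using this
  obtain ⟨k, hk⟩ := heven
  have hv : ∀ i : Fin k, ∃ w, c.getVert (2 * i) = .inl w := fun i => by
    have := isLeft_getVert c (2 * i) (by omega)
    rw [decide_eq_true (by simp)] at this
    exact Sum.isLeft_iff.1 this
  have he : ∀ i : Fin k, ∃ e, c.getVert (2 * i + 1) = .inr e := fun i => by
    have := isLeft_getVert c (2 * i + 1) (by omega)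
    rw [decide_eq_false (by simp)] at this
    exact Sum.isRight_iff.1 (by simpa using this)
  choose vs hvs using hv
  choose es hes using he
  refine ⟨k, by omega, by omega, vs, es, ?_, ?_, fun i => ?_⟩
  · intro i j hij
    have := hc.getVert_injOn' (show 2 * i.val ≤ c.length - 1 by omega)
      (show 2 * j.val ≤ c.length - 1 by omega) (by rw [hvs, hvs, hij])
    ext; omega
  · intro i j hij
    have := hc.getVert_injOn' (show 2 * i.val + 1 ≤ c.length - 1 by omega)
      (show 2 * j.val + 1 ≤ c.length - 1 by omega) (by rw [hes, hes, hij])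
    ext; omega
  · have h1 := c.adj_getVert_succ (i := 2 * i.val) (by omega)
    have h2 := c.adj_getVert_succ (i := 2 * i.val + 1) (by omega)
    rw [hvs, hes, incidence_inl_inr] at h1
    have h3 : c.getVert (2 * i.val + 1 + 1) = .inl (vs (finRotate k i)) := by
      obtain ⟨n, rfl⟩ : ∃ n, k = n + 1 := ⟨k - 1, by omega⟩
      rw [← hvs, coe_finRotate]
      split_ifs with h
      · have : i.val = n := by rw [h]; rfl
        rw [mul_zero, c.getVert_zero, show 2 * i.val + 1 + 1 = c.length by omega, c.getVert_length]
      · congr 1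
    rw [hes, h3, incidence_inr_inl] at h2
    exact ⟨h1.2, h1.1, h2.1⟩

theorem hasBergeCycle_of_isCycle {x : V ⊕ Finset V} (c : (incidence E).Walk x x)
    (hc : c.IsCycle) : ∃ k, 2 * k = c.length ∧ HasBergeCycle E k := by
  classical
  rcases x with v | e
  · exact hasBergeCycle_of_isCycle_inl c hc
  · have hadj := c.adj_snd hc.not_nil
    have hmem : c.snd ∈ c.support := c.getVert_mem_support 1
    rcases hs : c.snd with v | f
    · rw [hs] at hmem
      obtain ⟨k, hk, h⟩ := hasBergeCycle_of_isCycle_inl (c.rotate _ hmem) (hc.rotate hmem)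
      exact ⟨k, by rw [hk, SimpleGraph.Walk.length_rotate], h⟩
    · rw [hs] at hadj; exact hadj.elim

/-- Two different paths with the same ends prevent the graph `H` formed by their edges from being
acyclic. A cycle of `H` uses at most the edges of both paths, so it has length at most 2n and gives
a Berge cycle of length at most n. -/
theorem path_unique_of_girth {n : ℕ} (hg : (n : ℕ∞) < bergeGirth E) {x y : V ⊕ Finset V}
    {P Q : (incidence E).Walk x y} (hP : P.IsPath) (hQ : Q.IsPath)
    (hl : P.length + Q.length ≤ 2 * n) : P = Q := by
  classical
  by_contra hne
  let s : Finset (Sym2 (V ⊕ Finset V)) := (P.edges ++ Q.edges).toFinset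
  have hsE : ∀ e ∈ s, e ∈ (incidence E).edgeSet := by
    intro e he
    rcases List.mem_append.1 (List.mem_toFinset.1 he) with h | h
    · exact P.edges_subset_edgeSet h
    · exact Q.edges_subset_edgeSet h
  let H : SimpleGraph (V ⊕ Finset V) := SimpleGraph.fromEdgeSet (s : Set _)
  have hmem : ∀ e ∈ s, e ∈ H.edgeSet := by
    intro e he
    rw [SimpleGraph.edgeSet_fromEdgeSet]
    exact ⟨he, (incidence E).not_isDiag_of_mem_edgeSet (hsE e he)⟩
  have hP' : ∀ e ∈ P.edges, e ∈ H.edgeSet := fun e he => hmem e (by simp [s, he])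
  have hQ' : ∀ e ∈ Q.edges, e ∈ H.edgeSet := fun e he => hmem e (by simp [s, he])
  have hle : H ≤ incidence E := by
    rw [← SimpleGraph.edgeSet_subset_edgeSet, SimpleGraph.edgeSet_fromEdgeSet]
    exact fun e he => hsE e he.1
  have hnot : ¬ H.IsAcyclic := by
    intro hac
    have h := (hac.subsingleton_path x y).elim ⟨P.transfer H hP', hP.transfer hP'⟩
      ⟨Q.transfer H hQ', hQ.transfer hQ'⟩
    have h' : P.transfer H hP' = Q.transfer H hQ' := congrArg Subtype.val h
    apply hne
    have hm := congrArg (SimpleGraph.Walk.mapLe hle) h'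
    have ht : ∀ (R : (incidence E).Walk x y) (hR : ∀ e ∈ R.edges, e ∈ H.edgeSet),
        (R.transfer H hR).mapLe hle = R := by
      intro R hR
      rw [SimpleGraph.Walk.mapLe, ← SimpleGraph.Walk.transfer_eq_map_ofLE,
        SimpleGraph.Walk.transfer_transfer, SimpleGraph.Walk.transfer_self]
      intro e he
      rw [SimpleGraph.Walk.edges_transfer] at he
      exact R.edges_subset_edgeSet he
    rwa [ht, ht] at hm
  rw [SimpleGraph.IsAcyclic] at hnot
  push Not at hnot
  obtain ⟨v, c, hc⟩ := hnot
  obtain ⟨k, hk, hB⟩ := hasBergeCycle_of_isCycle (c.mapLe hle) (hc.mapLe hle)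
  rw [SimpleGraph.Walk.length_mapLe] at hk
  have hcard : c.length ≤ 2 * n := by
    rw [← SimpleGraph.Walk.length_edges, ← List.toFinset_card_of_nodup hc.edges_nodup]
    refine (Finset.card_le_card (t := s) ?_).trans ((List.toFinset_card_le _).trans ?_)
    · intro e he
      have := c.edges_subset_edgeSet (List.mem_toFinset.1 he)
      rw [SimpleGraph.edgeSet_fromEdgeSet] at this
      exact this.1
    · simpa using hl
  have hkn : (k : ℕ∞) ≤ n := by exact_mod_cast (by omega : k ≤ n)
  have : bergeGirth E ≤ k := iInf₂_le k hB
  exact absurd (hg.trans_le (this.trans hkn)) (lt_irrefl _)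

end Girth

/-! ## Trees of hyperedges -/

section Forest

variable {V : Type*} [DecidableEq V]

/-- The vertices outside `S` that share a hyperedge with `S`. -/
def shell (S : Finset V) (A : Finset (Finset V)) : Finset V :=
  ((A.filter fun e => ¬ Disjoint e S).biUnion id) \ S

/-- Up to distance `n`, the hyperedges in `A` form disjoint trees rooted at the vertices in `S`,
where every vertex has `D` children. -/
def IsForest (D : ℕ) : ℕ → Finset V → Finset (Finset V) → Prop
  | 0, _, _ => True
  | n + 1, S, A =>
    (∀ v ∈ S, (A.filter fun e => v ∈ e).card = D) ∧
    (∀ e ∈ A, ∀ u ∈ e, ∀ u' ∈ e, u ∈ S → u' ∈ S → u = u') ∧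
    (∀ w ∉ S, ∀ e ∈ A, ∀ e' ∈ A, w ∈ e → w ∈ e' → ¬ Disjoint e S → ¬ Disjoint e' S → e = e') ∧
    IsForest D n (shell S A) (A.filter fun e => Disjoint e S)

theorem mem_shell {S : Finset V} {A : Finset (Finset V)} {w : V} :
    w ∈ shell S A ↔ w ∉ S ∧ ∃ e ∈ A, ¬ Disjoint e S ∧ w ∈ e := by
  simp only [shell, Finset.mem_sdiff, Finset.mem_biUnion, Finset.mem_filter, id]
  tauto

theorem isForest_empty (D : ℕ) (n : ℕ) (A : Finset (Finset V)) : IsForest D n ∅ A := by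
  induction n generalizing A with
  | zero => trivial
  | succ n ih =>
    refine ⟨by simp, by simp, by simp, ?_⟩
    have : shell ∅ A = ∅ := by ext; simp [mem_shell]
    rw [this]
    exact ih _

/-- Exploration from `r` by generations: `U` is the set of vertices seen, `S` the latest generation,
`A` the unused hyperedges, and each vertex of `S` has a path from `r` of length 2d+1 that meets no
vertex outside `U` and no hyperedge of `A`. A collision in the next generation would give two
different paths with common ends, each of length at most 2d+3. Since d < p, this is at most 2p+1,
and uniqueness of short paths forbids it. -/
theorem isForest_of_paths {E : Finset (Finset V)} {D p : ℕ} (hreg : IsRegular E (D + 1))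
    (hg : ((2 * p + 1 : ℕ) : ℕ∞) < bergeGirth E) (r : Finset V) (n d : ℕ) (hnd : d + n = p)
    (S U : Finset V) (A : Finset (Finset V)) (h1 : A ⊆ E) (h2 : S ⊆ U)
    (h3 : ∀ e ∈ A, ∀ v ∈ e, v ∈ U → v ∈ S) (h4 : ∀ e ∈ E, e ∉ A → e ⊆ U)
    (h5 : ∀ v ∈ S, (A.filter fun e => v ∈ e).card = D)
    (h6 : ∀ v ∈ S, ∃ P : (incidence E).Walk (.inr r) (.inl v), P.IsPath ∧ P.length = 2 * d + 1 ∧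
      (∀ w, Sum.inl w ∈ P.support → w ∈ U) ∧ ∀ e, Sum.inr e ∈ P.support → e ∉ A) :
    IsForest D n S A := by
  induction n generalizing d S U A with
  | zero => trivial
  | succ n ih =>
    have hc : ∀ w ∉ S, ∀ e ∈ A, ∀ e' ∈ A, w ∈ e → w ∈ e' → ¬ Disjoint e S → ¬ Disjoint e' S →
        e = e' := by
      intro w hw e he e' he' hwe hwe' hd hd'
      obtain ⟨u, hue, huS⟩ := Finset.not_disjoint_iff.1 hd
      obtain ⟨u', hue', huS'⟩ := Finset.not_disjoint_iff.1 hd'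
      obtain ⟨P, hP, hPl, hPU, hPA⟩ := h6 u huS
      obtain ⟨P', hP', hPl', hPU', hPA'⟩ := h6 u' huS'
      have hwU : w ∉ U := fun h => hw (h3 e he w hwe h)
      have a1 : (incidence E).Adj (.inl u) (.inr e) := ⟨hue, h1 he⟩
      have a1' : (incidence E).Adj (.inl u') (.inr e') := ⟨hue', h1 he'⟩
      have a2 : (incidence E).Adj (.inr e) (.inl w) := ⟨hwe, h1 he⟩
      have a2' : (incidence E).Adj (.inr e') (.inl w) := ⟨hwe', h1 he'⟩
      have key := path_unique_of_girth hg
        (P := (P.concat a1).concat a2) (Q := (P'.concat a1').concat a2')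
        ((hP.concat (fun h => hPA e h he) a1).concat (by
          rw [SimpleGraph.Walk.support_concat]; simpa using fun h => hwU (hPU w h)) a2)
        ((hP'.concat (fun h => hPA' e' h he') a1').concat (by
          rw [SimpleGraph.Walk.support_concat]; simpa using fun h => hwU (hPU' w h)) a2')
        (by simp only [SimpleGraph.Walk.length_concat]; omega)
      obtain ⟨hv, -⟩ := SimpleGraph.Walk.concat_inj key
      exact Sum.inr_injective hv
    refine ⟨h5, ?_, hc, ?_⟩
    · intro e he u hu u' hu' huS huS'
      obtain ⟨P, hP, hPl, hPU, hPA⟩ := h6 u huS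
      obtain ⟨P', hP', hPl', hPU', hPA'⟩ := h6 u' huS'
      have a1 : (incidence E).Adj (.inl u) (.inr e) := ⟨hu, h1 he⟩
      have a1' : (incidence E).Adj (.inl u') (.inr e) := ⟨hu', h1 he⟩
      have key := path_unique_of_girth hg (P := P.concat a1) (Q := P'.concat a1')
        (hP.concat (fun h => hPA e h he) a1) (hP'.concat (fun h => hPA' e h he) a1')
        (by simp only [SimpleGraph.Walk.length_concat]; omega)
      obtain ⟨hv, -⟩ := SimpleGraph.Walk.concat_inj key
      exact Sum.inl_injective hv
    · refine ih (d + 1) (by omega) _ (U ∪ shell S A) _ ((Finset.filter_subset _ _).trans h1)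
        Finset.subset_union_right ?_ ?_ ?_ ?_
      · intro e he v hv hvU
        rw [Finset.mem_filter] at he
        rcases Finset.mem_union.1 hvU with h | h
        · exact absurd (h3 e he.1 v hv h) (Finset.disjoint_left.1 he.2 hv)
        · exact h
      · intro e he heA v hv
        rw [Finset.mem_filter] at heA
        by_cases hA : e ∈ A
        · by_cases hvS : v ∈ S
          · exact Finset.mem_union_left _ (h2 hvS)
          · exact Finset.mem_union_right _ (mem_shell.2 ⟨hvS, e, hA, fun h => heA ⟨hA, h⟩, hv⟩)
        · exact Finset.mem_union_left _ (h4 e he hA hv)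
      · intro w hw
        obtain ⟨hwS, e, heA, hed, hwe⟩ := mem_shell.1 hw
        have hwU : w ∉ U := fun h => hwS (h3 e heA w hwe h)
        -- Exactly one hyperedge at `w` leads back to the previous generation, so D of its D+1
        -- hyperedges remain.
        have hE : (E.filter fun e => w ∈ e) =
            insert e ((A.filter fun e => Disjoint e S).filter fun e => w ∈ e) := by
          ext f
          simp only [Finset.mem_filter, Finset.mem_insert]
          constructor
          · rintro ⟨hf, hwf⟩
            have hfA : f ∈ A := by
              by_contra h
              exact hwU (h4 f hf h hwf)
            by_cases hfd : Disjoint f S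
            · exact Or.inr ⟨⟨hfA, hfd⟩, hwf⟩
            · exact Or.inl (hc w hwS f hfA e heA hwf hwe hfd hed)
          · rintro (rfl | h)
            · exact ⟨h1 heA, hwe⟩
            · exact ⟨h1 h.1.1, h.2⟩
        have := hreg w
        rw [hE, Finset.card_insert_of_notMem (by simp [hed])] at this
        omega
      · intro w hw
        obtain ⟨hwS, e, heA, hed, hwe⟩ := mem_shell.1 hw
        have hwU : w ∉ U := fun h => hwS (h3 e heA w hwe h)
        obtain ⟨u, hue, huS⟩ := Finset.not_disjoint_iff.1 hed
        obtain ⟨P, hP, hPl, hPU, hPA⟩ := h6 u huS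
        have a1 : (incidence E).Adj (.inl u) (.inr e) := ⟨hue, h1 heA⟩
        have a2 : (incidence E).Adj (.inr e) (.inl w) := ⟨hwe, h1 heA⟩
        refine ⟨(P.concat a1).concat a2, (hP.concat (fun h => hPA e h heA) a1).concat (by
          rw [SimpleGraph.Walk.support_concat]; simpa using fun h => hwU (hPU w h)) a2,
          by simp only [SimpleGraph.Walk.length_concat]; omega, ?_, ?_⟩
        · intro v hv
          simp only [SimpleGraph.Walk.support_concat, List.mem_append, List.mem_singleton,
            Sum.inl.injEq, reduceCtorEq, or_false] at hv
          rcases hv with h | rfl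
          · exact Finset.mem_union_left _ (hPU v h)
          · exact Finset.mem_union_right _ hw
        · intro f hf
          simp only [SimpleGraph.Walk.support_concat, List.mem_append, List.mem_singleton,
            Sum.inr.injEq, reduceCtorEq, or_false] at hf
          rw [Finset.mem_filter]
          rcases hf with h | rfl
          · exact fun h' => hPA f h h'.1
          · exact fun h' => hed h'.2

/-- Around every hyperedge, a regular hypergraph of girth larger than `2p+1` looks like a tree up to
distance `p`. -/
theorem isForest_of_girth {E : Finset (Finset V)} {D p : ℕ} (hreg : IsRegular E (D + 1))
    (hg : ((2 * p + 1 : ℕ) : ℕ∞) < bergeGirth E) {r : Finset V} (hr : r ∈ E) :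
    IsForest D p r (E.erase r) := by
  refine isForest_of_paths hreg hg r p 0 (by simp) r r _ (Finset.erase_subset _ _) subset_rfl
    (fun _ _ _ _ h => h) ?_ ?_ ?_
  · intro e he heA
    have : e = r := by by_contra h; exact heA (Finset.mem_erase.2 ⟨h, he⟩)
    rw [this]
  · intro v hv
    have hE : (E.filter fun e => v ∈ e) = insert r ((E.erase r).filter fun e => v ∈ e) := by
      ext f
      simp only [Finset.mem_filter, Finset.mem_insert, Finset.mem_erase]
      constructor
      · rintro ⟨hf, hvf⟩
        by_cases h : f = r
        · exact Or.inl h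
        · exact Or.inr ⟨⟨h, hf⟩, hvf⟩
      · rintro (rfl | h)
        · exact ⟨hr, hv⟩
        · exact ⟨h.1.2, h.2⟩
    have := hreg v
    rw [hE, Finset.card_insert_of_notMem (by simp)] at this
    omega
  · intro v hv
    have a : (incidence E).Adj (.inr r) (.inl v) := ⟨hv, hr⟩
    refine ⟨SimpleGraph.Walk.cons a .nil, by simp, by simp, ?_, ?_⟩
    · intro w hw
      simp at hw
      rwa [hw]
    · intro e he
      simp at he
      simp [he]

end Forest

/-! ### Evaluation of the path sum on the tree. -/

section TreeEvaluation

variable {V : Type*} [Fintype V] [DecidableEq V]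

/-- Negating the label of one site preserves the weight, so the average equals its own negative. -/
theorem avg_eq_zero_of_flip {X : Type*} [Fintype X] [InvolutiveNeg X] {w : X → ℂ}
    (hw : ∀ x, w (-x) = w x) (i : V) (F : (V → X) → ℂ)
    (hF : ∀ b, F (Function.update b i (-b i)) = -F b) : avg w F = 0 := by
  let e : (V → X) → (V → X) := fun b => Function.update b i (-b i)
  have he : Function.Involutive e := fun b => by simp [e]
  have h : avg w F = -avg w F := by
    conv_lhs => rw [avg]
    rw [avg, ← Finset.sum_neg_distrib]
    refine Fintype.sum_bijective e he.bijective _ _ fun b => ?_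
    have h1 : ∏ v, w (e b v) = ∏ v, w (b v) := by
      refine Finset.prod_congr rfl fun v _ => ?_
      by_cases hv : v = i
      · subst hv; simp [e, hw]
      · simp [e, hv]
    rw [h1, hF, mul_neg, neg_neg]
  exact self_eq_neg.1 h

theorem prod_update_neg {M : Type*} [CommRing M] (b : V → M) (i : V) :
    ∏ v, Function.update b i (-b i) v = -∏ v, b v := by
  rw [Finset.prod_update_of_mem (Finset.mem_univ i), ← Finset.prod_erase_mul _ _ (Finset.mem_univ i),
    Finset.sdiff_singleton_eq_erase]
  ring

variable {p : ℕ}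

theorem prod_bits_update_neg (b : V → Bits p) (i : V) :
    ∏ v, Function.update b i (-b i) v = -∏ v, b v := by
  rw [Finset.prod_update_of_mem (Finset.mem_univ i), ← Finset.mul_prod_erase _ _ (Finset.mem_univ i),
    Finset.sdiff_singleton_eq_erase, neg_mul]

theorem exp_units_mul (J : ℤˣ) (t : ℝ) : Complex.exp (Complex.I * (t * ((J : ℤ) : ℝ) : ℝ)) =
    (Real.cos t : ℂ) + Complex.I * ((J : ℤ) : ℂ) * (Real.sin t : ℂ) := by
  rcases Int.units_eq_one_or J with rfl | rfl
  · rw [mul_comm Complex.I, Complex.exp_mul_I]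
    push_cast
    ring_nf
  · rw [mul_comm Complex.I, Complex.exp_mul_I]
    push_cast
    simp
    ring

/-- The signs of the clauses do not matter below the root. -/
theorem avg_exp_treeH (q D : ℕ) (γ β : Fin p → ℝ) (m : ℕ) (J : ℤˣ) (a : Bits p) (i : V) :
    (avg (pathWeight β) fun b : V → Bits p =>
      Complex.exp (Complex.I * ((1 / √(D : ℝ)) * gamDot γ (a * ∏ v, b v) * ((J : ℤ) : ℝ) : ℝ)) *
        ∏ v, treeH q D γ β m (b v)) =
      avg (pathWeight β) fun b : V → Bits p =>
        (Real.cos ((1 / √(D : ℝ)) * gamDot γ (a * ∏ v, b v)) : ℂ) *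
          ∏ v, treeH q D γ β m (b v) := by
  simp only [exp_units_mul, add_mul, avg_add]
  -- Only the sine carries the sign, and it is odd under negating the string at one site, while f
  -- and H are even.
  rw [add_eq_left]
  refine avg_eq_zero_of_flip (pathWeight_neg β) i _ fun b => ?_
  have h : ∏ v, treeH q D γ β m (Function.update b i (-b i) v) = ∏ v, treeH q D γ β m (b v) := by
    refine Finset.prod_congr rfl fun v _ => ?_
    by_cases hv : v = i
    · subst hv; simp [treeH_neg]
    · simp [hv]
  rw [prod_bits_update_neg, h, mul_neg, gamDot_neg, mul_neg, Real.sin_neg]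
  push_cast
  ring

/-- Each string now carries its odd central spin, so parity removes the cosine instead. The sign `J`
remains, to be cancelled by the sign of the measured clause. -/
theorem avg_exp_spin_treeH (q D : ℕ) (γ β : Fin p → ℝ) (m : ℕ) (J : ℤˣ) (i : V) :
    (avg (pathWeight β) fun b : V → Bits p =>
      Complex.exp (Complex.I * ((1 / √(D : ℝ)) * gamDot γ (∏ v, b v) * ((J : ℤ) : ℝ) : ℝ)) *
        ∏ v, (spin (b v) (mid p) * treeH q D γ β m (b v))) =
      Complex.I * ((J : ℤ) : ℂ) * avg (pathWeight β) fun b : V → Bits p =>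
        (Real.sin ((1 / √(D : ℝ)) * gamDot γ (∏ v, b v)) : ℂ) *
          ∏ v, (spin (b v) (mid p) * treeH q D γ β m (b v)) := by
  simp only [exp_units_mul, add_mul, avg_add]
  rw [← avg_const_mul]
  simp only [← mul_assoc]
  rw [add_eq_right]
  refine avg_eq_zero_of_flip (pathWeight_neg β) i _ fun b => ?_
  have h : ∏ v, (spin (Function.update b i (-b i) v) (mid p) *
      treeH q D γ β m (Function.update b i (-b i) v)) =
      -∏ v, (spin (b v) (mid p) * treeH q D γ β m (b v)) := by
    rw [← prod_update_neg _ i]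
    refine Finset.prod_congr rfl fun v _ => ?_
    by_cases hv : v = i
    · subst hv; simp [treeH_neg, spin_neg]
    · simp [hv]
  rw [prod_bits_update_neg, h, gamDot_neg, mul_neg (1 / √(D : ℝ)), Real.cos_neg]
  ring

/-- The phase of a hyperedge along a path. -/
noncomputable def edgePhase {V : Type*} (D : ℕ) (J : Finset V → ℤˣ) (γ : Fin p → ℝ) (e : Finset V)
    (a : V → Bits p) : ℂ :=
  Complex.exp (Complex.I * ((1 / √(D : ℝ)) * gamDot γ (∏ v ∈ e, a v) * ((J e : ℤ) : ℝ) : ℝ))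

theorem edgePhase_dependsOn {V : Type*} (D : ℕ) (J : Finset V → ℤˣ) (γ : Fin p → ℝ) (e : Finset V) :
    DependsOn (edgePhase D J γ e) (e : Set V) := by
  intro a b h
  rw [edgePhase, edgePhase, Finset.prod_congr rfl fun v hv => h v hv]

theorem exp_action {V : Type*} (D : ℕ) (E : Finset (Finset V)) (J : Finset V → ℤˣ) (γ : Fin p → ℝ)
    (a : V → Bits p) : Complex.exp (Complex.I * (action (driverCost D E J) γ a : ℝ)) =
      ∏ e ∈ E, edgePhase D J γ e a := by
  simp only [edgePhase]
  rw [← Complex.exp_sum, ← Finset.mul_sum, ← Complex.ofReal_sum]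
  congr 3
  simp only [action, driverCost, clause, gamDot, Finset.mul_sum, Finset.sum_mul]
  rw [Finset.sum_comm]
  refine Finset.sum_congr rfl fun e _ => Finset.sum_congr rfl fun k _ => ?_
  simp only [Finset.prod_apply]
  push_cast
  ring

theorem edgePhase_dup {V : Type*} (D : ℕ) (J : Finset V → ℤˣ) (γ : Fin (p + 1) → ℝ) (e : Finset V)
    (a : V → Bits p) : edgePhase D J γ e (fun v => dup (a v)) =
      edgePhase D J (γ ∘ Fin.castSucc) e a := by
  rw [edgePhase, edgePhase, ← dup_prod, gamDot_dup]

/-- One child hyperedge, given the string at its parent `u`, contributes the base of the D-th power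
in H. The children have been shortened by one angle; `avg_dup` read backwards restores their length,
since the summand ignores their centres. -/
theorem avg_edgePhase_shell {q D : ℕ} (hq : 2 ≤ q) (J : Finset V → ℤˣ) (γ β : Fin (p + 1) → ℝ)
    {S e : Finset V} (he : e.card = q) {u : V} (hu : e ∩ S = {u}) (x : V → Bits (p + 1)) (m : ℕ) :
    (avg (pathWeight (β ∘ Fin.castSucc)) fun y : V → Bits p =>
      edgePhase D J γ e (S.piecewise x fun v => dup (y v)) *
        ∏ w ∈ e \ S, treeH q D (γ ∘ Fin.castSucc) (β ∘ Fin.castSucc) m (y w)) =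
      avg (pathWeight β) fun b : Fin (q - 1) → Bits (p + 1) =>
        (Real.cos ((1 / √(D : ℝ)) * gamDot γ (x u * ∏ i, b i)) : ℂ) *
          ∏ i, treeH q D γ β m (b i) := by
  have hcard : (e \ S).card = q - 1 := by
    have := Finset.card_sdiff_add_card_inter e S
    rw [hu, Finset.card_singleton] at this
    omega
  let f : Fin (q - 1) ≃ ↥(e \ S) := (Finset.equivFinOfCardEq hcard).symm
  let ι : Fin (q - 1) → V := fun i => (f i).1
  have hι : Function.Injective ι := Subtype.val_injective.comp f.injective
  have hprod : ∀ {M : Type} [CommMonoid M] (g : V → M), ∏ w ∈ e \ S, g w = ∏ i, g (ι i) := by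
    intro M _ g
    rw [← Finset.prod_coe_sort, ← f.prod_comp]
  -- A site to negate exists because q - 1 ≥ 1.
  rw [← avg_exp_treeH q D γ β m (J e) (x u) ⟨0, by omega⟩, avg_dup,
    ← avg_comp_injective (sum_pathWeight _) ι hι]
  · congr 1
    funext y
    simp only [hprod, treeH_dup, Function.comp]
    congr 1
    rw [edgePhase]
    have : ∏ v ∈ e, S.piecewise x (fun v => dup (y v)) v = x u * ∏ i, dup (y (ι i)) := by
      rw [← Finset.prod_inter_mul_prod_sdiff e S, hu, Finset.prod_singleton, ← hprod fun w => dup (y w)]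
      congr 1
      · have : u ∈ S := (Finset.mem_inter.1 (hu ▸ Finset.mem_singleton_self u)).2
        simp [this]
      · refine Finset.prod_congr rfl fun w hw => ?_
        simp [(Finset.mem_sdiff.1 hw).2]
    rw [this]
  · intro b b' _ h
    have h1 : gamDot γ (x u * ∏ i, b i) = gamDot γ (x u * ∏ i, b' i) :=
      gamDot_congr γ fun k hk => by
        simp only [Pi.mul_apply, Finset.prod_apply, fun i => h i k hk]
    dsimp only
    rw [h1]
    congr 1
    exact Finset.prod_congr rfl fun i _ => treeH_congr _ _ _ _ (h i)

/-- Only `g` may see central spins, and only on `S`, so all strings outside `S` are shortened by one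
angle. Hyperedges disjoint from `S` then carry phases with one angle fewer, and induction applies
with the next generation as roots and with the phases of the hyperedges touching `S` as the new
observable. Its result splits into independent factors, one per touching hyperedge, and the D
factors belonging to a root multiply to the next H. Number of angles and depth of the tree decrease
together. -/
theorem avg_forest {q D : ℕ} (hq : 2 ≤ q) (J : Finset V → ℤˣ) : ∀ {p : ℕ} (γ β : Fin p → ℝ)
    (S : Finset V) (A : Finset (Finset V)), IsUniform A q → IsForest D p S A →
    ∀ g : (V → Bits p) → ℂ, DependsOn g (S : Set V) →
    avg (pathWeight β) (fun a => (∏ e ∈ A, edgePhase D J γ e a) * g a) =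
      avg (pathWeight β) fun a => g a * ∏ v ∈ S, treeH q D γ β p (a v)
  | 0, γ, β, S, A, _, _, g, _ => by
    -- With no angles every phase is 1, whatever hyperedges remain.
    simp [edgePhase, gamDot_eq, treeH_zero]
  | p + 1, γ, β, S, A, hA, hF, g, hg => by
    obtain ⟨hdeg, hinter, huniq, hF'⟩ := hF
    rw [avg_truncate β S]
    swap
    · intro b b' hS h
      dsimp only
      rw [hg fun v hv => hS v hv]
      congr 1
      refine Finset.prod_congr rfl fun e _ => ?_
      rw [edgePhase, edgePhase, gamDot_congr γ fun k hk => ?_]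
      simp only [Finset.prod_apply, fun v => h v k hk]
    congr 1
    funext x
    set T := A.filter fun e => ¬ Disjoint e S with hT
    let G : (V → Bits p) → ℂ := fun y => ∏ e ∈ T, edgePhase D J γ e (S.piecewise x fun v => dup (y v))
    have hmemT : ∀ {e}, e ∈ T ↔ e ∈ A ∧ ¬ Disjoint e S := by simp [hT]
    have hG : DependsOn G (shell S A : Set V) := by
      intro y y' h
      refine Finset.prod_congr rfl fun e he => edgePhase_dependsOn D J γ e fun v hv => ?_
      by_cases hvS : v ∈ S
      · simp [hvS]
      · simp only [hvS, not_false_eq_true, Finset.piecewise_eq_of_notMem]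
        rw [h v (mem_shell.2 ⟨hvS, e, (hmemT.1 he).1, (hmemT.1 he).2, hv⟩)]
    have h1 : ∀ y : V → Bits p, (∏ e ∈ A, edgePhase D J γ e (S.piecewise x fun v => dup (y v))) *
        g (S.piecewise x fun v => dup (y v)) =
        g x * ((∏ e ∈ A.filter (fun e => Disjoint e S),
          edgePhase D J (γ ∘ Fin.castSucc) e y) * G y) := by
      intro y
      rw [hg (y := x) fun v hv => by simp [Finset.mem_coe.1 hv], mul_comm (g x)]
      congr 1
      rw [← Finset.prod_filter_mul_prod_filter_not A (fun e => Disjoint e S)]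
      congr 1
      refine Finset.prod_congr rfl fun e he => ?_
      rw [← edgePhase_dup]
      refine edgePhase_dependsOn D J γ e fun v hv => ?_
      have := Finset.disjoint_left.1 (Finset.mem_filter.1 he).2 hv
      simp [this]
    simp only [h1]
    rw [avg_const_mul, avg_forest hq J (γ ∘ Fin.castSucc) (β ∘ Fin.castSucc) (shell S A) _
      (fun e he => hA e (Finset.mem_filter.1 he).1) hF' G hG]
    congr 1
    have hshell : shell S A = T.biUnion fun e => e \ S := by
      ext w
      simp only [mem_shell, Finset.mem_biUnion, hmemT, Finset.mem_sdiff]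
      constructor
      · rintro ⟨h, e, he, hd, hw⟩; exact ⟨e, ⟨he, hd⟩, hw, h⟩
      · rintro ⟨e, ⟨he, hd⟩, hw, h⟩; exact ⟨h, e, he, hd, hw⟩
    have hdisj : ∀ e ∈ T, ∀ e' ∈ T, e ≠ e' → Disjoint (e \ S) (e' \ S) := by
      intro e he e' he' hne
      rw [Finset.disjoint_left]
      intro w hw hw'
      rw [Finset.mem_sdiff] at hw hw'
      exact hne (huniq w hw.2 e (hmemT.1 he).1 e' (hmemT.1 he').1 hw.1 hw'.1 (hmemT.1 he).2
        (hmemT.1 he').2)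
    have h2 : ∀ y : V → Bits p, G y * ∏ v ∈ shell S A, treeH q D (γ ∘ Fin.castSucc)
        (β ∘ Fin.castSucc) p (y v) = ∏ e ∈ T,
          (edgePhase D J γ e (S.piecewise x fun v => dup (y v)) *
          ∏ w ∈ e \ S, treeH q D (γ ∘ Fin.castSucc) (β ∘ Fin.castSucc) p (y w)) := by
      intro y
      rw [Finset.prod_mul_distrib, hshell, Finset.prod_biUnion]
      exact fun e he e' he' hne => hdisj e he e' he' hne
    simp only [h2]
    rw [avg_prod (sum_pathWeight _) T (fun e => e \ S) hdisj]
    · let K : Bits (p + 1) → ℂ := fun a => avg (pathWeight β) fun b : Fin (q - 1) → Bits (p + 1) =>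
        (Real.cos ((1 / √(D : ℝ)) * gamDot γ (a * ∏ i, b i)) : ℂ) *
          ∏ i, treeH q D γ β p (b i)
      have h3 : ∀ e ∈ T, (avg (pathWeight (β ∘ Fin.castSucc)) fun y : V → Bits p =>
          edgePhase D J γ e (S.piecewise x fun v => dup (y v)) *
          ∏ w ∈ e \ S, treeH q D (γ ∘ Fin.castSucc) (β ∘ Fin.castSucc) p (y w)) =
          ∏ v ∈ e ∩ S, K (x v) := by
        intro e he
        obtain ⟨heA, hed⟩ := hmemT.1 he
        obtain ⟨u, hue, huS⟩ := Finset.not_disjoint_iff.1 hed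
        have hu : e ∩ S = {u} := by
          ext v
          simp only [Finset.mem_inter, Finset.mem_singleton]
          constructor
          · rintro ⟨hv, hvS⟩; exact hinter e heA v hv u hue hvS huS
          · rintro rfl; exact ⟨hue, huS⟩
        rw [avg_edgePhase_shell hq J γ β (hA e heA) hu, hu, Finset.prod_singleton]
      -- Each touching hyperedge meets `S` in one vertex, so the product is regrouped by roots, D
      -- hyperedges at each.
      rw [Finset.prod_congr rfl h3,
        Finset.prod_comm' (t' := S) (s' := fun v => A.filter fun e => v ∈ e)]
      · refine Finset.prod_congr rfl fun v hv => ?_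
        rw [Finset.prod_const, hdeg v hv, treeH_succ]
      · intro e v
        simp only [hmemT, Finset.mem_inter, Finset.mem_filter, Finset.not_disjoint_iff]
        constructor
        · rintro ⟨⟨h, -⟩, h', h''⟩; exact ⟨⟨h, h'⟩, h''⟩
        · rintro ⟨⟨h, h'⟩, h''⟩; exact ⟨⟨h, v, h', h''⟩, h', h''⟩
    · intro e he y y' h
      refine congrArg₂ (· * ·) ?_ ?_
      · refine edgePhase_dependsOn D J γ e fun v hv => ?_
        by_cases hvS : v ∈ S
        · simp [hvS]
        · simp only [hvS, not_false_eq_true, Finset.piecewise_eq_of_notMem]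
          rw [h v (by simpa using ⟨hv, hvS⟩)]
      · exact Finset.prod_congr rfl fun w hw => by rw [h w (by simpa using hw)]

/-- The measured hyperedge is taken out: its phase and clause form the observable on the roots, and
the other hyperedges are the forest. The sign of the clause meets the one left by the sine, and
their product is 1. -/
theorem avg_edgePhase_clause {q D : ℕ} (hq : 2 ≤ q) {E : Finset (Finset V)} (J : Finset V → ℤˣ)
    (γ β : Fin p → ℝ) (hE : IsUniform E q) (hreg : IsRegular E (D + 1))
    (hg : ((2 * p + 1 : ℕ) : ℕ∞) < bergeGirth E) {r : Finset V} (hr : r ∈ E) :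
    (avg (pathWeight β) fun a : V → Bits p => (∏ e ∈ E, edgePhase D J γ e a) *
      (clause J r fun v => a v (mid p))) = Complex.I *
      avg (pathWeight β) fun a : Fin q → Bits p =>
        (Real.sin ((1 / √(D : ℝ)) * gamDot γ (∏ i, a i)) : ℂ) *
          ∏ i, (spin (a i) (mid p) * treeH q D γ β p (a i)) := by
  let g : (V → Bits p) → ℂ := fun a => edgePhase D J γ r a * (clause J r fun v => a v (mid p))
  have hgd : DependsOn g (r : Set V) := by
    intro a b h
    simp only [g, clause]
    rw [edgePhase_dependsOn D J γ r h, Finset.prod_congr rfl fun v hv => by rw [h v hv]]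
  have h1 : ∀ a : V → Bits p, (∏ e ∈ E, edgePhase D J γ e a) *
      (clause J r fun v => a v (mid p)) = (∏ e ∈ E.erase r, edgePhase D J γ e a) * g a := by
    intro a
    rw [← Finset.prod_erase_mul _ _ hr, mul_assoc]
  simp only [h1]
  rw [avg_forest hq J γ β r (E.erase r) (fun e he => hE e (Finset.mem_of_mem_erase he))
    (isForest_of_girth hreg hg hr) g hgd]
  let f : Fin q ≃ ↥r := (Finset.equivFinOfCardEq (hE r hr)).symm
  let ι : Fin q → V := fun i => (f i).1
  have hι : Function.Injective ι := Subtype.val_injective.comp f.injective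
  have hprod : ∀ {M : Type} [CommMonoid M] (g : V → M), ∏ w ∈ r, g w = ∏ i, g (ι i) := by
    intro M _ g
    rw [← Finset.prod_coe_sort, ← f.prod_comp]
  let F : (Fin q → Bits p) → ℂ := fun b => Complex.exp (Complex.I * ((1 / √(D : ℝ)) *
    gamDot γ (∏ v, b v) * ((J r : ℤ) : ℝ) : ℝ)) *
      ∏ v, (spin (b v) (mid p) * treeH q D γ β p (b v))
  have h2 : ∀ a : V → Bits p, g a * ∏ v ∈ r, treeH q D γ β p (a v) =
      ((J r : ℤ) : ℂ) * F (a ∘ ι) := by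
    intro a
    have h3 : ((clause J r fun v => a v (mid p) : ℝ) : ℂ) =
        ((J r : ℤ) : ℂ) * ∏ i, spin (a (ι i)) (mid p) := by
      simp only [clause, spin, hprod]
      push_cast
      ring
    simp only [g, F, edgePhase, h3, hprod, Function.comp, Finset.prod_mul_distrib]
    ring
  have hJ : ((J r : ℤ) : ℂ) * ((J r : ℤ) : ℂ) = 1 := by
    rcases Int.units_eq_one_or (J r) with h | h <;> simp [h]
  simp only [h2]
  rw [avg_const_mul, avg_comp_injective (sum_pathWeight β) ι hι F,
    avg_exp_spin_treeH q D γ β p (J r) ⟨0, by omega⟩, ← mul_assoc]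
  congr 1
  linear_combination Complex.I * hJ

/-- Normalisation of the state: a forest without roots, with constant observable, satisfies all tree
conditions vacuously. -/
theorem avg_edgePhase {q D : ℕ} (hq : 2 ≤ q) {E : Finset (Finset V)} (J : Finset V → ℤˣ)
    (γ β : Fin p → ℝ) (hE : IsUniform E q) :
    (avg (pathWeight β) fun a : V → Bits p => ∏ e ∈ E, edgePhase D J γ e a) = 1 := by
  have h := avg_forest hq J γ β ∅ E hE (isForest_empty D p E) (fun _ => 1)
    (fun _ _ _ => rfl)
  simpa [avg_const (sum_pathWeight β)] using h

theorem satisfiedFraction_eq {q D : ℕ} (hq : 2 ≤ q) (hD : 1 ≤ D) [Nonempty V]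
    {E : Finset (Finset V)} (J : Finset V → ℤˣ) (γ β : Fin p → ℝ) (hE : IsUniform E q)
    (hreg : IsRegular E (D + 1)) (hg : ((2 * p + 1 : ℕ) : ℕ∞) < bergeGirth E) :
    satisfiedFraction D E J γ β =
      1 / 2 + nuFormula q D γ β * (√((q : ℝ) / (2 * D)) : ℂ) := by
  set s := avg (pathWeight β) fun a : Fin q → Bits p =>
        (Real.sin ((1 / √(D : ℝ)) * gamDot γ (∏ i, a i)) : ℂ) *
          ∏ i, (spin (a i) (mid p) * treeH q D γ β p (a i)) with hs
  have hcard : (E.card : ℂ) ≠ 0 := by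
    obtain ⟨v⟩ := ‹Nonempty V›
    have h1 := hreg v
    have h2 := Finset.card_le_card (Finset.filter_subset (fun e => v ∈ e) E)
    exact_mod_cast (by omega : E.card ≠ 0)
  have hexp : expectation (costOp (xorCost E J)) (qaoaState (driverCost D E J) γ β) =
      E.card * ((1 / 2) * (1 + Complex.I * s)) := by
    rw [expectation_costOp]
    have h : ∀ a : V → Bits p,
        Complex.exp (Complex.I * (action (driverCost D E J) γ a : ℝ)) *
        (xorCost E J fun v => a v (mid p)) = ∑ r ∈ E, (1 / 2) *
          ((∏ e ∈ E, edgePhase D J γ e a) + (∏ e ∈ E, edgePhase D J γ e a) *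
            (clause J r fun v => a v (mid p))) := by
      intro a
      rw [exp_action, xorCost]
      push_cast
      rw [Finset.mul_sum]
      exact Finset.sum_congr rfl fun r _ => by ring
    simp only [h, avg_sum, avg_const_mul, avg_add]
    rw [Finset.sum_congr rfl fun r hr => by
      rw [avg_edgePhase hq J γ β hE, avg_edgePhase_clause hq J γ β hE hreg hg hr, ← hs],
      Finset.sum_const, nsmul_eq_mul]
  -- The scaling of ν is chosen so that this product equals the factor 1/2 in the cost function.
  have hsq : √((D : ℝ) / (2 * q)) * √((q : ℝ) / (2 * D)) = 1 / 2 := by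
    have hD' : (D : ℝ) ≠ 0 := by positivity
    have hq' : (q : ℝ) ≠ 0 := by positivity
    rw [← Real.sqrt_mul (by positivity), show (D : ℝ) / (2 * q) * ((q : ℝ) / (2 * D)) = (1 / 2) ^ 2 by
      field_simp, Real.sqrt_sq (by norm_num)]
  have hsq' : (√((D : ℝ) / (2 * q)) : ℂ) * (√((q : ℝ) / (2 * D)) : ℂ) = 1 / 2 := by
    rw [← Complex.ofReal_mul, hsq]; norm_num
  rw [satisfiedFraction, hexp, nuFormula_eq_avg, ← hs, ← mul_assoc, one_div_mul_cancel hcard]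
  linear_combination -(Complex.I * s) * hsq'

end TreeEvaluation

/-! ## Reasoning about programs -/

section Framework

/-- Started in `s`, the program halts within `T` steps, `M` memory cells and with numbers up to `W`
in a configuration that satisfies `Q`. -/
def Runs (M W : ℕ) (P : Prog) (T : ℕ) (s : Store) (Q : Store → Prop) : Prop :=
  ∃ s' t m w, Exec P s s' t m w ∧ t ≤ T ∧ m ≤ M ∧ w ≤ W ∧ Q s'

variable {M W : ℕ}

theorem Runs.mono {P : Prog} {T T' : ℕ} {s : Store} {Q Q' : Store → Prop} (h : Runs M W P T s Q)
    (hT : T ≤ T') (hQ : ∀ s', Q s' → Q' s') : Runs M W P T' s Q' := by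
  obtain ⟨s', t, m, w, he, ht, hm, hw, hq⟩ := h
  exact ⟨s', t, m, w, he, ht.trans hT, hm, hw, hQ _ hq⟩

theorem Runs.seq {P P' : Prog} {T T' : ℕ} {s : Store} {Q : Store → Prop}
    (h : Runs M W P T s fun s' => Runs M W P' T' s' Q) : Runs M W (.seq P P') (T + T') s Q := by
  obtain ⟨s', t, m, w, he, ht, hm, hw, s'', t', m', w', he', ht', hm', hw', hq⟩ := h
  exact ⟨s'', _, _, _, .seq he he', by omega, max_le hm hm', max_le hw hw', hq⟩

@[simp] theorem Store.setN_nreg (s : Store) (d x r : ℕ) :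
    (s.setN d x).nreg r = if r = d then x else s.nreg r := by
  simp [Store.setN, Function.update_apply]

@[simp] theorem Store.setN_creg (s : Store) (d x : ℕ) : (s.setN d x).creg = s.creg := rfl

@[simp] theorem Store.setN_mem (s : Store) (d x : ℕ) : (s.setN d x).mem = s.mem := rfl

@[simp] theorem Store.setC_creg (s : Store) (d : ℕ) (x : ℂ) (r : ℕ) :
    (s.setC d x).creg r = if r = d then x else s.creg r := by
  simp [Store.setC, Function.update_apply]

@[simp] theorem Store.setC_nreg (s : Store) (d : ℕ) (x : ℂ) : (s.setC d x).nreg = s.nreg := rfl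

@[simp] theorem Store.setC_mem (s : Store) (d : ℕ) (x : ℂ) : (s.setC d x).mem = s.mem := rfl

@[simp] theorem Store.setM_mem (s : Store) (d : ℕ) (x : ℂ) (r : ℕ) :
    (s.setM d x).mem r = if r = d then x else s.mem r := by
  simp [Store.setM, Function.update_apply]

@[simp] theorem Store.setM_nreg (s : Store) (d : ℕ) (x : ℂ) : (s.setM d x).nreg = s.nreg := rfl

@[simp] theorem Store.setM_creg (s : Store) (d : ℕ) (x : ℂ) : (s.setM d x).creg = s.creg := rfl

attribute [simp] Instr.run NatOp.eval CpxOp.eval CpxFun.eval Instr.space Instr.word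

/-- A sequence of instructions. -/
def code : Instr → List Instr → Prog
  | i, [] => .instr i
  | i, j :: l => .seq (.instr i) (code j l)

/-- The resources of a sequence of instructions are within the bounds. -/
@[simp] def Within (M W : ℕ) : List Instr → Store → Prop
  | [], _ => True
  | i :: l, s => i.space s ≤ M ∧ i.word s ≤ W ∧ Within M W l (i.run s)

theorem runs_code {i : Instr} {l : List Instr} {T : ℕ} {s : Store} {Q : Store → Prop}
    (h : Within M W (i :: l) s) (hT : l.length + 1 ≤ T)
    (hQ : Q ((i :: l).foldl (fun s i => i.run s) s)) : Runs M W (code i l) T s Q := by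
  induction l generalizing i s T with
  | nil => exact ⟨_, _, _, _, .instr i s, by simpa using hT, h.1, h.2.1, hQ⟩
  | cons j l ih =>
    have h2 : Runs M W (.seq (.instr i) (code j l)) (1 + (l.length + 1)) s Q :=
      Runs.seq ⟨_, _, _, _, .instr i s, le_rfl, h.1, h.2.1, ih h.2.2 le_rfl hQ⟩
    exact h2.mono (by simp at hT ⊢; omega) fun _ h => h

/-- The two configurations agree on the natural-number registers below `n` and on the complex
registers below `c`. -/
def SameBelow (n c : ℕ) (s s' : Store) : Prop :=
  (∀ r < n, s'.nreg r = s.nreg r) ∧ ∀ r < c, s'.creg r = s.creg r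

theorem SameBelow.refl (n c : ℕ) (s : Store) : SameBelow n c s s :=
  ⟨fun _ _ => rfl, fun _ _ => rfl⟩

theorem SameBelow.trans {n c : ℕ} {s s' s'' : Store} (h : SameBelow n c s s')
    (h' : SameBelow n c s' s'') : SameBelow n c s s'' :=
  ⟨fun r hr => (h'.1 r hr).trans (h.1 r hr), fun r hr => (h'.2 r hr).trans (h.2 r hr)⟩

theorem SameBelow.mono {n c n' c' : ℕ} {s s' : Store} (h : SameBelow n c s s') (hn : n' ≤ n)
    (hc : c' ≤ c) : SameBelow n' c' s s' :=
  ⟨fun r hr => h.1 r (hr.trans_le hn), fun r hr => h.2 r (hr.trans_le hc)⟩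

/-- The instruction writes no natural-number register below `n` and no complex register below
`c`. -/
def Instr.above (n c : ℕ) : Instr → Bool
  | .natConst d _ => n ≤ d
  | .natOp _ d _ _ => n ≤ d
  | .cpxOfNat d _ => c ≤ d
  | .cpxSqrt d _ => c ≤ d
  | .cpxI d => c ≤ d
  | .cpxOp _ d _ _ => c ≤ d
  | .cpxFun _ d _ => c ≤ d
  | .cpxPow d _ _ => c ≤ d
  | .load d _ => c ≤ d
  | .store _ _ => true

/-- The program writes no natural-number register below `n` and no complex register below `c`. -/
def Prog.above (n c : ℕ) : Prog → Bool
  | .instr i => i.above n c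
  | .seq P Q => P.above n c && Q.above n c
  | .cond _ _ P Q => P.above n c && Q.above n c
  | .loop _ _ P => P.above n c

/-- The program does not write to the memory. -/
def Prog.storeFree : Prog → Bool
  | .instr (.store _ _) => false
  | .instr _ => true
  | .seq P Q => P.storeFree && Q.storeFree
  | .cond _ _ P Q => P.storeFree && Q.storeFree
  | .loop _ _ P => P.storeFree

theorem Instr.sameBelow {n c : ℕ} (i : Instr) (h : i.above n c = true) (s : Store) :
    SameBelow n c s (i.run s) := by
  cases i <;> simp only [Instr.above, decide_eq_true_eq] at h <;>
    refine ⟨fun r hr => ?_, fun r hr => ?_⟩ <;>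
    first
    | rfl
    | exact Function.update_of_ne (by omega) _ _

theorem Exec.sameBelow {n c : ℕ} {P : Prog} {s s' : Store} {t m w : ℕ} (h : Exec P s s' t m w)
    (hP : P.above n c = true) : SameBelow n c s s' := by
  induction h with
  | instr i s => exact i.sameBelow hP s
  | seq _ _ ih ih' =>
    simp only [Prog.above, Bool.and_eq_true] at hP
    exact (ih hP.1).trans (ih' hP.2)
  | cond_true _ _ ih =>
    simp only [Prog.above, Bool.and_eq_true] at hP
    exact ih hP.1
  | cond_false _ _ ih =>
    simp only [Prog.above, Bool.and_eq_true] at hP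
    exact ih hP.2
  | loop_done _ => exact SameBelow.refl _ _ _
  | loop_step _ _ _ ih ih' => exact (ih hP).trans (ih' hP)

theorem Exec.mem_eq {P : Prog} {s s' : Store} {t m w : ℕ} (h : Exec P s s' t m w)
    (hP : P.storeFree = true) : s'.mem = s.mem := by
  induction h with
  | instr i s => cases i <;> first | rfl | simp [Prog.storeFree] at hP
  | seq _ _ ih ih' =>
    simp only [Prog.storeFree, Bool.and_eq_true] at hP
    exact (ih' hP.2).trans (ih hP.1)
  | cond_true _ _ ih =>
    simp only [Prog.storeFree, Bool.and_eq_true] at hP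
    exact ih hP.1
  | cond_false _ _ ih =>
    simp only [Prog.storeFree, Bool.and_eq_true] at hP
    exact ih hP.2
  | loop_done _ => rfl
  | loop_step _ _ _ ih ih' => exact (ih' hP).trans (ih hP)

/-- `above` is a Boolean check on the text of a program, so that constants and outer loop counters
survive inner code can be decided by evaluation. -/
theorem Runs.frame {n c : ℕ} {P : Prog} {T : ℕ} {s : Store} {Q : Store → Prop}
    (h : Runs M W P T s Q) (hP : P.above n c = true) :
    Runs M W P T s fun s' => Q s' ∧ SameBelow n c s s' := by
  obtain ⟨s', t, m, w, he, ht, hm, hw, hq⟩ := h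
  exact ⟨s', t, m, w, he, ht, hm, hw, hq, he.sameBelow hP⟩

theorem Runs.frame_mem {P : Prog} {T : ℕ} {s : Store} {Q : Store → Prop}
    (h : Runs M W P T s Q) (hP : P.storeFree = true) :
    Runs M W P T s fun s' => Q s' ∧ s'.mem = s.mem := by
  obtain ⟨s', t, m, w, he, ht, hm, hw, hq⟩ := h
  exact ⟨s', t, m, w, he, ht, hm, hw, hq, he.mem_eq hP⟩

/-- `for N[i] = 0, …, N[n] - 1 do P`; the register `4` holds the number `1`. -/
def forProg (i n : ℕ) (P : Prog) : Prog :=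
  .seq (.instr (.natConst i 0)) (.loop i n (.seq P (.instr (.natOp .add i i 4))))

/-- After the body the invariant is required of the store whose counter already shows k+1, because
the increment comes last. Each round costs two extra steps, its test and the increment; the final 2
counts the initialisation and the failing test. -/
theorem runs_for {i n c N : ℕ} {P : Prog} {T : ℕ → ℕ} {s : Store} (I : ℕ → Store → Prop)
    (hP : P.above (i + 1) c = true) (hi : 4 < i) (hn : n < i) (h4 : s.nreg 4 = 1)
    (hN : s.nreg n = N) (hW : N ≤ W) (h0 : I 0 (s.setN i 0))
    (hstep : ∀ k < N, ∀ s', SameBelow i c s s' → s'.nreg i = k → I k s' →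
      Runs M W P (T k) s' fun s'' => I (k + 1) (s''.setN i (k + 1))) :
    Runs M W (forProg i n P) (∑ k ∈ Finset.range N, (T k + 2) + 2) s
      fun s' => I N s' ∧ SameBelow i c s s' := by
  -- Induction on the number `j` of rounds that remain.
  have key : ∀ j ≤ N, ∀ s', SameBelow i c s s' → s'.nreg i = N - j → I (N - j) s' →
      Runs M W (.loop i n (.seq P (.instr (.natOp .add i i 4))))
        (∑ k ∈ Finset.Ico (N - j) N, (T k + 2) + 1) s' fun s'' => I N s'' ∧ SameBelow i c s s'' := by
    intro j
    induction j with
    | zero =>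
      intro _ s' hs hi' hI
      refine ⟨s', _, _, _, .loop_done ?_, by simp, by simp, by simp, hI, hs⟩
      rw [hi', hs.1 n hn, hN]
      omega
    | succ j ih =>
      intro hj s' hs hi' hI
      have hlt : N - (j + 1) < N := by omega
      obtain ⟨s₁, t, m, w, he, ht, hm, hw, hI₁⟩ := hstep _ hlt s' hs hi' hI
      have hs₁ := he.sameBelow hP
      have hi₁ : s₁.nreg i = N - (j + 1) := by rw [hs₁.1 i (by omega), hi']
      have h4₁ : s₁.nreg 4 = 1 := by rw [hs₁.1 4 (by omega), hs.1 4 hi, h4]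
      have hrun : (Instr.natOp .add i i 4).run s₁ = s₁.setN i (N - (j + 1) + 1) := by
        simp [Instr.run, NatOp.eval, hi₁, h4₁]
      have hsame : SameBelow i c s ((Instr.natOp .add i i 4).run s₁) := by
        refine (hs.trans (hs₁.mono (by omega) le_rfl)).trans ?_
        rw [hrun]
        exact ⟨fun r hr => Function.update_of_ne (by omega) _ _, fun r hr => rfl⟩
      obtain ⟨s₂, t', m', w', he', ht', hm', hw', hI', hs'⟩ := ih (by omega)
        ((Instr.natOp .add i i 4).run s₁) hsame (by rw [hrun]; simp [Store.setN]; omega)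
        (by rw [hrun, show N - j = N - (j + 1) + 1 by omega]; exact hI₁)
      refine ⟨s₂, _, _, _, .loop_step ?_ (.seq he (.instr _ s₁)) he', ?_, ?_, ?_, hI', hs'⟩
      · rw [hi', hs.1 n hn, hN]; exact hlt
      · rw [Finset.sum_eq_sum_Ico_succ_bot hlt, show N - (j + 1) + 1 = N - j by omega]
        omega
      · simp [Instr.space, hm, hm']
      · have : (Instr.natOp .add i i 4).word s₁ ≤ W := by
          simp [Instr.word, NatOp.eval, hi₁, h4₁]; omega
        exact max_le (max_le hw this) hw'
  have h := key N le_rfl (s.setN i 0)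
    ⟨fun r hr => Function.update_of_ne (by omega) _ _, fun r hr => rfl⟩
    (by simp [Store.setN]) (by simpa using h0)
  have h' : Runs M W (forProg i n P) (1 + (∑ k ∈ Finset.Ico (N - N) N, (T k + 2) + 1)) s
      fun s' => I N s' ∧ SameBelow i c s s' :=
    Runs.seq ⟨_, _, _, _, .instr _ s, le_rfl, by simp [Instr.space], by simp [Instr.word], h⟩
  refine h'.mono ?_ fun _ h => h
  simp
  omega

theorem runs_for_const {i n c N T : ℕ} {P : Prog} {s : Store} (I : ℕ → Store → Prop)
    (hP : P.above (i + 1) c = true) (hi : 4 < i) (hn : n < i) (h4 : s.nreg 4 = 1)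
    (hN : s.nreg n = N) (hW : N ≤ W) (h0 : I 0 (s.setN i 0))
    (hstep : ∀ k < N, ∀ s', SameBelow i c s s' → s'.nreg i = k → I k s' →
      Runs M W P T s' fun s'' => I (k + 1) (s''.setN i (k + 1))) :
    Runs M W (forProg i n P) (N * (T + 2) + 2) s fun s' => I N s' ∧ SameBelow i c s s' := by
  have h := runs_for (T := fun _ => T) I hP hi hn h4 hN hW h0 hstep
  simpa using h

end Framework

/-! ## Subprograms

The natural-number registers `0, …, 7` hold `p`, `q`, `D`, `0`, `1`, `2`, `4`, `2p`; the register `8`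
holds the depth `d ≤ p`. A natural number `n < 4^d` encodes the string whose spins `a_{r+1}` and
`a_{-(r+1)}` are given by the bits `2r` and `2r+1` of `n` and whose centre is `1`. The complex
register `1` holds `i`, and the complex register `2` holds `0`. -/

section Subprograms

/-- The contribution of the angle `β_r` to the weight of a string. -/
noncomputable def stepAmp (θ : ℂ) (x : ℕ) : ℂ :=
  ((Complex.I * Complex.sin θ) ^ (x % 2) * Complex.cos θ ^ (1 - x % 2)) *
    ((0 - Complex.I * Complex.sin θ) ^ (x / 2) * Complex.cos θ ^ (1 - x / 2))

/-- The weight of the string that is encoded by `n`. -/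
noncomputable def codeWeight (b : ℕ → ℂ) (d n : ℕ) : ℂ :=
  ∏ r ∈ Finset.range d, stepAmp (b r) ((n / 4 ^ r % 4) ^^^ (n / 4 ^ (r + 1) % 4))

theorem codeWeight_succ (b : ℕ → ℂ) (k n : ℕ) : codeWeight b (k + 1) n =
    codeWeight b k n * stepAmp (b k) ((n / 4 ^ k % 4) ^^^ (n / 4 ^ (k + 1) % 4)) :=
  Finset.prod_range_succ _ _

/-- The difference of the two spins that are encoded by a base-four digit. -/
noncomputable def spinDiff (x : ℕ) : ℂ :=
  (((x / 2 : ℕ) : ℂ) - ((x % 2 : ℕ) : ℂ)) + (((x / 2 : ℕ) : ℂ) - ((x % 2 : ℕ) : ℂ))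

/-- The pairing with `Γ` of the string that is encoded by `n`. -/
noncomputable def codeDot (g : ℕ → ℂ) (d n : ℕ) : ℂ :=
  ∑ r ∈ Finset.range d, spinDiff (n / 4 ^ r % 4) * g r

/-- The registers that hold constants. -/
structure Env (p d : ℕ) (s : Store) : Prop where
  n0 : s.nreg 0 = p
  n3 : s.nreg 3 = 0
  n4 : s.nreg 4 = 1
  n5 : s.nreg 5 = 2
  n6 : s.nreg 6 = 4
  n7 : s.nreg 7 = 2 * p
  n8 : s.nreg 8 = d
  c1 : s.creg 1 = Complex.I
  c2 : s.creg 2 = 0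

theorem Env.of_sameBelow {p d n c : ℕ} {s s' : Store} (h : Env p d s) (hs : SameBelow n c s s')
    (hn : 9 ≤ n) (hc : 3 ≤ c) : Env p d s' :=
  ⟨(hs.1 _ (by omega)).trans h.n0, (hs.1 _ (by omega)).trans h.n3, (hs.1 _ (by omega)).trans h.n4,
    (hs.1 _ (by omega)).trans h.n5, (hs.1 _ (by omega)).trans h.n6, (hs.1 _ (by omega)).trans h.n7,
    (hs.1 _ (by omega)).trans h.n8, (hs.2 _ (by omega)).trans h.c1, (hs.2 _ (by omega)).trans h.c2⟩

theorem xor_lt_four {x y : ℕ} (hx : x < 4) (hy : y < 4) : x ^^^ y < 4 :=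
  Nat.xor_lt_two_pow (n := 2) hx hy

/-- Compute the weight of the string in register `15` into the complex register `20`. -/
def weightProg : Prog :=
  .seq (code (.natOp .add 21 15 3) [.cpxOfNat 20 4])
    (forProg 20 8 (code (.natOp .mod 23 21 6) [.natOp .div 21 21 6, .natOp .mod 24 21 6,
      .natOp .xor 23 23 24, .natOp .add 24 0 20, .load 21 24, .cpxFun .cos 22 21,
      .cpxFun .sin 23 21, .cpxOp .mul 23 1 23, .natOp .mod 24 23 5, .natOp .div 23 23 5,
      .natOp .sub 25 4 24, .natOp .sub 26 4 23, .cpxOp .sub 24 2 23, .cpxPow 23 23 24,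
      .cpxPow 25 22 25, .cpxOp .mul 23 23 25, .cpxPow 24 24 23, .cpxPow 25 22 26,
      .cpxOp .mul 24 24 25, .cpxOp .mul 23 23 24, .cpxOp .mul 20 20 23]))

theorem runs_weight {M W p d n : ℕ} {s : Store} (b : ℕ → ℂ) (hs : Env p d s) (hd : d ≤ p)
    (hn : s.nreg 15 = n) (hb : ∀ r < d, s.mem (p + r) = b r) (hM : 2 * p ≤ M) (hW : 2 * p ≤ W)
    (hnW : n ≤ W) (h4 : 4 ≤ W) :
    Runs M W weightProg (d * 24 + 4) s fun s' => s'.creg 20 = codeWeight b d n := by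
  have h1 : Runs M W weightProg (2 + (d * (22 + 2) + 2)) s
      fun s' => s'.creg 20 = codeWeight b d n := by
    refine Runs.seq (((runs_code (Q := fun s' => s'.nreg 21 = n ∧ s'.creg 20 = 1 ∧ s'.mem = s.mem)
      ?_ le_rfl ?_).frame (n := 20) (c := 20) (by decide)).mono le_rfl ?_)
    · simp [hn, hs.n3, hnW]
    · simp [hn, hs.n3, hs.n4]
    · rintro s₁ ⟨⟨h21, hc20, hmem⟩, hs₁⟩
      have hE := hs.of_sameBelow hs₁ (by omega) (by omega)
      refine (runs_for_const (c := 20) (N := d) (fun k s' => s'.nreg 21 = n / 4 ^ k ∧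
        s'.creg 20 = codeWeight b k n ∧ s'.mem = s.mem) (by decide) (by decide) (by decide) hE.n4 hE.n8
        (by omega) ?_ ?_).mono le_rfl fun s' h => h.1.2.1
      · simp [h21, hc20, hmem, codeWeight]
      · intro k hk s₂ hs₂ hk₂ ⟨ht, hc, hm⟩
        have hE₂ := hE.of_sameBelow hs₂ (by omega) (by omega)
        have htn : n / 4 ^ k ≤ n := Nat.div_le_self _ _
        have hdiv : n / 4 ^ (k + 1) = n / 4 ^ k / 4 := by rw [pow_succ, Nat.div_div_eq_div_mul]
        have hbk : s₂.mem (p + k) = b k := by rw [hm]; exact hb k hk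
        have hcw := codeWeight_succ b k n
        rw [hdiv] at hcw ⊢
        generalize n / 4 ^ k = t at *
        have hx := xor_lt_four (Nat.mod_lt t (by decide : 4 > 0)) (Nat.mod_lt (t / 4) (by decide : 4 > 0))
        refine runs_code ?_ le_rfl ?_
        · simp [ht, hE₂.n6, hE₂.n5, hE₂.n4, hE₂.n0, hk₂]
          refine ⟨?_, ?_, ?_, ?_, ?_, ?_, ?_, ?_, ?_, ?_⟩ <;> omega
        · simp [ht, hE₂.n6, hE₂.n5, hE₂.n4, hE₂.n0, hk₂, hE₂.c1, hE₂.c2, hc, hm, hbk, hcw, stepAmp]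
  exact h1.mono (by omega) fun _ h => h

theorem codeDot_succ (g : ℕ → ℂ) (k n : ℕ) :
    codeDot g (k + 1) n = codeDot g k n + spinDiff (n / 4 ^ k % 4) * g k :=
  Finset.sum_range_succ _ _

/-- Compute the pairing with `Γ` of the string in register `15` into the complex register `20`. -/
def phaseProg : Prog :=
  .seq (code (.natOp .add 21 15 3) [.cpxOp .add 20 2 2])
    (forProg 20 8 (code (.natOp .mod 23 21 6) [.natOp .div 21 21 6, .natOp .div 24 23 5,
      .natOp .mod 23 23 5, .cpxOfNat 21 24, .cpxOfNat 22 23, .cpxOp .sub 21 21 22,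
      .cpxOp .add 21 21 21, .load 22 20, .cpxOp .mul 21 21 22, .cpxOp .add 20 20 21]))

theorem runs_phase {M W p d n : ℕ} {s : Store} (g : ℕ → ℂ) (hs : Env p d s) (hd : d ≤ p)
    (hn : s.nreg 15 = n) (hg : ∀ r < d, s.mem r = g r) (hM : 2 * p ≤ M) (hW : 2 * p ≤ W)
    (hnW : n ≤ W) (h4 : 4 ≤ W) :
    Runs M W phaseProg (d * 24 + 4) s fun s' => s'.creg 20 = codeDot g d n := by
  have h1 : Runs M W phaseProg (2 + (d * (11 + 2) + 2)) s
      fun s' => s'.creg 20 = codeDot g d n := by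
    refine Runs.seq (((runs_code (Q := fun s' => s'.nreg 21 = n ∧ s'.creg 20 = 0 ∧ s'.mem = s.mem)
      ?_ le_rfl ?_).frame (n := 20) (c := 20) (by decide)).mono le_rfl ?_)
    · simp [hn, hs.n3, hnW]
    · simp [hn, hs.n3, hs.c2]
    · rintro s₁ ⟨⟨h21, hc20, hmem⟩, hs₁⟩
      have hE := hs.of_sameBelow hs₁ (by omega) (by omega)
      refine (runs_for_const (c := 20) (N := d) (fun k s' => s'.nreg 21 = n / 4 ^ k ∧
        s'.creg 20 = codeDot g k n ∧ s'.mem = s.mem) (by decide) (by decide) (by decide) hE.n4 hE.n8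
        (by omega) ?_ ?_).mono le_rfl fun s' h => h.1.2.1
      · simp [h21, hc20, hmem, codeDot]
      · intro k hk s₂ hs₂ hk₂ ⟨ht, hc, hm⟩
        have hE₂ := hE.of_sameBelow hs₂ (by omega) (by omega)
        have htn : n / 4 ^ k ≤ n := Nat.div_le_self _ _
        have hdiv : n / 4 ^ (k + 1) = n / 4 ^ k / 4 := by rw [pow_succ, Nat.div_div_eq_div_mul]
        have hgk : s₂.mem k = g k := by rw [hm]; exact hg k hk
        have hcw := codeDot_succ g k n
        rw [hdiv]
        generalize n / 4 ^ k = t at *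
        refine runs_code ?_ le_rfl ?_
        · simp [ht, hE₂.n6, hE₂.n5, hk₂]
          refine ⟨?_, ?_, ?_, ?_, ?_⟩ <;> omega
        · simp [ht, hE₂.n6, hE₂.n5, hk₂, hc, hm, hgk, hcw, spinDiff]
  exact h1.mono (by omega) fun _ h => h

end Subprograms

/-! ## The program for finite degree -/

section FiniteProgram

/-- The memory from `base` on has been filled with `f 0, …, f (N-1)`. -/
def Filled (base N : ℕ) (f : ℕ → ℂ) (s s' : Store) : Prop :=
  (∀ n < N, s'.mem (base + n) = f n) ∧ ∀ k, k < base ∨ base + N ≤ k → s'.mem k = s.mem k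

/-- The body may read the partially filled table; every cell outside the part already written still
has its initial value. -/
theorem runs_fill {M W i n c N base T : ℕ} {P : Prog} {s : Store} (f : ℕ → ℂ)
    (hP : P.above (i + 1) c = true) (hi : 4 < i) (hn : n < i) (h4 : s.nreg 4 = 1)
    (hN : s.nreg n = N) (hW : N ≤ W)
    (hstep : ∀ k < N, ∀ s', SameBelow i c s s' → s'.nreg i = k → Filled base k f s s' →
      Runs M W P T s' fun s'' => s''.mem = Function.update s'.mem (base + k) (f k)) :
    Runs M W (forProg i n P) (N * (T + 2) + 2) s
      fun s' => Filled base N f s s' ∧ SameBelow i c s s' := by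
  refine runs_for_const (fun k s' => Filled base k f s s') hP hi hn h4 hN hW ?_ ?_
  · exact ⟨fun n hn => absurd hn (by omega), fun k _ => by simp⟩
  · intro k hk s' hs hk' hI
    refine (hstep k hk s' hs hk' hI).mono le_rfl fun s'' h => ⟨fun n hn => ?_, fun j hj => ?_⟩
    · rw [Store.setN_mem, h]
      by_cases hnk : n = k
      · rw [hnk, Function.update_self]
      · rw [Function.update_of_ne (by omega)]
        exact hI.1 n (by omega)
    · rw [Store.setN_mem, h, Function.update_of_ne (by omega)]
      exact hI.2 j (by omega)

/-- The registers that hold constants during the computation for finite degree. -/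
structure FinEnv (p q D : ℕ) (s : Store) : Prop extends Env p p s where
  n1 : s.nreg 1 = q
  n2 : s.nreg 2 = D
  n9 : s.nreg 9 = 4 ^ p
  n10 : s.nreg 10 = 2 * p + 4 ^ p
  n11 : s.nreg 11 = 2 * p + 2 * 4 ^ p
  n12 : s.nreg 12 = q - 1

theorem FinEnv.of_sameBelow {p q D n c : ℕ} {s s' : Store} (h : FinEnv p q D s)
    (hs : SameBelow n c s s') (hn : 13 ≤ n) (hc : 3 ≤ c) : FinEnv p q D s' :=
  ⟨h.toEnv.of_sameBelow hs (by omega) hc, (hs.1 _ (by omega)).trans h.n1,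
    (hs.1 _ (by omega)).trans h.n2, (hs.1 _ (by omega)).trans h.n9,
    (hs.1 _ (by omega)).trans h.n10, (hs.1 _ (by omega)).trans h.n11,
    (hs.1 _ (by omega)).trans h.n12⟩

/-- The bounds on memory and numbers. -/
structure FinBound (p q M W : ℕ) : Prop where
  mem : 2 * p + 3 * 4 ^ p ≤ M
  word : 2 * p + 3 * 4 ^ p + 2 * q + 4 ≤ W

variable {M W p q D : ℕ}

/-- Store the weights of all strings. -/
def weightTableProg : Prog :=
  forProg 15 9 (.seq weightProg (code (.natOp .add 20 7 15) [.store 20 20]))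

theorem runs_weightTable {s : Store} (b : ℕ → ℂ) (hs : FinEnv p q D s) (hB : FinBound p q M W)
    (hb : ∀ r < p, s.mem (p + r) = b r) :
    Runs M W weightTableProg (4 ^ p * (p * 24 + 8) + 2) s fun s' =>
      Filled (2 * p) (4 ^ p) (codeWeight b p) s s' ∧ SameBelow 15 10 s s' := by
  have hM := hB.mem
  have hW := hB.word
  refine (runs_fill (T := p * 24 + 4 + 2) _ (by decide) (by decide) (by decide) hs.n4 hs.n9
    (by omega) fun k hk s₁ hs₁ hk₁ hf => ?_).mono (le_of_eq (by ring)) fun _ h => h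
  have hE := hs.of_sameBelow hs₁ (by omega) (by omega)
  refine Runs.seq ((((runs_weight b hE.toEnv le_rfl hk₁ (fun r hr => ?_) (by omega) (by omega)
    (by omega) (by omega)).frame (n := 20) (c := 10) (by decide)).frame_mem (by decide)).mono le_rfl ?_)
  · rw [hf.2 _ (by omega)]; exact hb r hr
  · rintro s₂ ⟨⟨hc, hs₂⟩, hm⟩
    have hE₂ := hE.of_sameBelow hs₂ (by omega) (by omega)
    have hk₂ : s₂.nreg 15 = k := by rw [hs₂.1 _ (by omega), hk₁]
    refine runs_code ?_ le_rfl ?_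
    · simp [hE₂.n7, hk₂]; omega
    · funext j; simp [hE₂.n7, hk₂, hc, hm, Function.update_apply]

/-- Store the values of `g` at the scaled phases of all strings. -/
def kernelProg (g : CpxFun) : Prog :=
  forProg 15 9 (.seq phaseProg (code (.cpxSqrt 21 2) [.cpxOp .div 20 20 21, .cpxFun g 20 20,
    .natOp .add 20 10 15, .store 20 20]))

/-- The scaled phase of a string. -/
noncomputable def codePhase (g : ℕ → ℂ) (p D n : ℕ) : ℂ := codeDot g p n / ((√(D : ℝ) : ℝ) : ℂ)

theorem runs_kernel {s : Store} (h : CpxFun) (g : ℕ → ℂ) (hs : FinEnv p q D s)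
    (hB : FinBound p q M W) (hg : ∀ r < p, s.mem r = g r) :
    Runs M W (kernelProg h) (4 ^ p * (p * 24 + 11) + 2) s fun s' =>
      Filled (2 * p + 4 ^ p) (4 ^ p) (fun n => h.eval (codePhase g p D n)) s s' ∧
        SameBelow 15 10 s s' := by
  have hM := hB.mem
  have hW := hB.word
  refine (runs_fill (T := p * 24 + 4 + 5) _ (by rfl) (by decide) (by decide) hs.n4 hs.n9
    (by omega) fun k hk s₁ hs₁ hk₁ hf => ?_).mono (le_of_eq (by ring)) fun _ h => h
  have hE := hs.of_sameBelow hs₁ (by omega) (by omega)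
  refine Runs.seq ((((runs_phase g hE.toEnv le_rfl hk₁ (fun r hr => ?_) (by omega) (by omega)
    (by omega) (by omega)).frame (n := 20) (c := 10) (by decide)).frame_mem (by decide)).mono le_rfl ?_)
  · rw [hf.2 _ (by omega)]; exact hg r hr
  · rintro s₂ ⟨⟨hc, hs₂⟩, hm⟩
    have hE₂ := hE.of_sameBelow hs₂ (by omega) (by omega)
    have hk₂ : s₂.nreg 15 = k := by rw [hs₂.1 _ (by omega), hk₁]
    refine runs_code ?_ le_rfl ?_
    · simp [hE₂.n10, hk₂]; omega
    · funext j; simp [hE₂.n10, hE₂.n2, hk₂, hc, hm, Function.update_apply, codePhase]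

/-- Convolution on the group of bit strings. -/
noncomputable def codeConv (N : ℕ) (g K : ℕ → ℂ) (c : ℕ) : ℂ :=
  ∑ b ∈ Finset.range N, g b * K (c ^^^ b)

/-- Replace the table `K` by its convolution with the table `g`. -/
def convProg : Prog :=
  .seq (forProg 15 9 (.seq (code (.cpxOp .add 10 2 2) [])
      (.seq (forProg 16 9 (code (.natOp .add 20 7 16) [.load 11 20, .natOp .xor 20 15 16,
        .natOp .add 20 10 20, .load 12 20, .cpxOp .mul 11 11 12, .cpxOp .add 10 10 11]))
      (code (.natOp .add 20 11 15) [.store 20 10]))))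
    (forProg 15 9 (code (.natOp .add 20 11 15) [.load 10 20, .natOp .add 20 10 15, .store 20 10]))

theorem xor_lt_four_pow {p x y : ℕ} (hx : x < 4 ^ p) (hy : y < 4 ^ p) : x ^^^ y < 4 ^ p := by
  have h : 4 ^ p = 2 ^ (2 * p) := by rw [pow_mul]; norm_num
  rw [h] at hx hy ⊢
  exact Nat.xor_lt_two_pow hx hy

/-- Every output entry reads all of `K`, so results go to a third table and are copied back
afterwards. The three tables of size 4^p account for the memory bound. -/
theorem runs_conv {s : Store} (g K : ℕ → ℂ) (hs : FinEnv p q D s) (hB : FinBound p q M W)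
    (hg : ∀ n < 4 ^ p, s.mem (2 * p + n) = g n)
    (hK : ∀ n < 4 ^ p, s.mem (2 * p + 4 ^ p + n) = K n) :
    Runs M W convProg (4 ^ p * (4 ^ p * 9 + 13) + 4) s fun s' =>
      (∀ n < 4 ^ p, s'.mem (2 * p + 4 ^ p + n) = codeConv (4 ^ p) g K n) ∧
        (∀ k < 2 * p + 4 ^ p, s'.mem k = s.mem k) ∧ SameBelow 15 10 s s' := by
  have hM := hB.mem
  have hW := hB.word
  have hfirst := runs_fill (M := M) (W := W) (n := 9) (i := 15) (c := 10) (N := 4 ^ p) (s := s)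
    (base := 2 * p + 2 * 4 ^ p) (T := 1 + ((4 ^ p * (7 + 2) + 2) + 2))
    (P := .seq (code (.cpxOp .add 10 2 2) [])
      (.seq (forProg 16 9 (code (.natOp .add 20 7 16) [.load 11 20, .natOp .xor 20 15 16,
        .natOp .add 20 10 20, .load 12 20, .cpxOp .mul 11 11 12, .cpxOp .add 10 10 11]))
      (code (.natOp .add 20 11 15) [.store 20 10])))
    (codeConv (4 ^ p) g K) (by decide) (by decide) (by decide) hs.n4 hs.n9 (by omega) ?_
  · have hrun : Runs M W convProg ((4 ^ p * (1 + ((4 ^ p * (7 + 2) + 2) + 2) + 2) + 2) +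
        (4 ^ p * (4 + 2) + 2)) s fun s' =>
      (∀ n < 4 ^ p, s'.mem (2 * p + 4 ^ p + n) = codeConv (4 ^ p) g K n) ∧
        (∀ k < 2 * p + 4 ^ p, s'.mem k = s.mem k) ∧ SameBelow 15 10 s s' := by
      refine Runs.seq (hfirst.mono le_rfl ?_)
      rintro s₁ ⟨hf₁, hs₁⟩
      have hE := hs.of_sameBelow hs₁ (by omega) (by omega)
      refine (runs_fill (base := 2 * p + 4 ^ p) (c := 10) (codeConv (4 ^ p) g K) (by decide)
        (by decide) (by decide) hE.n4 hE.n9 (by omega) fun k hk s₂ hs₂ hk₂ hf₂ => ?_).mono le_rfl ?_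
      · have hE₂ := hE.of_sameBelow hs₂ (by omega) (by omega)
        have hval : s₂.mem (2 * p + 2 * 4 ^ p + k) = codeConv (4 ^ p) g K k := by
          rw [hf₂.2 _ (by omega), hf₁.1 k hk]
        refine runs_code ?_ le_rfl ?_
        · simp [hE₂.n10, hE₂.n11, hk₂]; omega
        · funext j; simp [hE₂.n10, hE₂.n11, hk₂, hval, Function.update_apply]
      · rintro s₃ ⟨hf₃, hs₃⟩
        refine ⟨hf₃.1, fun k hk => ?_, hs₁.trans hs₃⟩
        rw [hf₃.2 _ (by omega), hf₁.2 _ (by omega)]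
    exact hrun.mono (le_of_eq (by ring)) fun _ h => h
  · intro k hk s₁ hs₁ hk₁ hf₁
    have hE := hs.of_sameBelow hs₁ (by omega) (by omega)
    refine Runs.seq (((runs_code (Q := fun s' => s'.creg 10 = 0 ∧ s'.mem = s₁.mem)
      ?_ le_rfl ?_).frame (n := 16) (c := 10) (by decide)).mono le_rfl ?_)
    · simp
    · simp [hE.c2]
    · rintro s₂ ⟨⟨hc₂, hm₂⟩, hs₂⟩
      have hE₂ := hE.of_sameBelow hs₂ (by omega) (by omega)
      have hk₂ : s₂.nreg 15 = k := by rw [hs₂.1 _ (by omega), hk₁]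
      refine Runs.seq ((runs_for_const (c := 10) (N := 4 ^ p) (fun b s' =>
        s'.creg 10 = codeConv b g K k ∧ s'.mem = s₁.mem) (by decide) (by decide) (by decide) hE₂.n4
        hE₂.n9 (by omega) ?_ ?_).mono le_rfl ?_)
      · simp [hc₂, hm₂, codeConv]
      · intro b hb s₃ hs₃ hb₃ ⟨hc₃, hm₃⟩
        have hE₃ := hE₂.of_sameBelow hs₃ (by omega) (by omega)
        have hk₃ : s₃.nreg 15 = k := by rw [hs₃.1 _ (by omega), hk₂]
        have hlt := xor_lt_four_pow hk hb
        have hgb : s₃.mem (2 * p + b) = g b := by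
          rw [hm₃, hf₁.2 _ (by omega), hg b hb]
        have hKb : s₃.mem (2 * p + 4 ^ p + (k ^^^ b)) = K (k ^^^ b) := by
          rw [hm₃, hf₁.2 _ (by omega), hK _ hlt]
        have hsucc : codeConv (b + 1) g K k = codeConv b g K k + g b * K (k ^^^ b) :=
          Finset.sum_range_succ _ _
        refine runs_code ?_ le_rfl ?_
        · simp [hE₃.n10, hE₃.n7, hk₃, hb₃]
          refine ⟨?_, ?_, ?_, ?_, ?_⟩ <;> omega
        · simp [hE₃.n10, hE₃.n7, hk₃, hb₃, hgb, hKb, hsucc, hc₃, hm₃]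
      · rintro s₃ ⟨⟨hc₃, hm₃⟩, hs₃⟩
        have hE₃ := hE₂.of_sameBelow hs₃ (by omega) (by omega)
        have hk₃ : s₃.nreg 15 = k := by rw [hs₃.1 _ (by omega), hk₂]
        refine runs_code ?_ le_rfl ?_
        · simp [hE₃.n11, hk₃]; omega
        · funext j; simp [hE₃.n11, hk₃, hc₃, hm₃, Function.update_apply]

theorem runs_conv_iterate {s : Store} {n j : ℕ} (g K : ℕ → ℂ) (hs : FinEnv p q D s)
    (hB : FinBound p q M W) (hn : n < 13) (hj : s.nreg n = j) (hjq : j ≤ q)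
    (hg : ∀ n < 4 ^ p, s.mem (2 * p + n) = g n)
    (hK : ∀ n < 4 ^ p, s.mem (2 * p + 4 ^ p + n) = K n) :
    Runs M W (forProg 14 n convProg) (j * (4 ^ p * (4 ^ p * 9 + 13) + 6) + 2) s fun s' =>
      (∀ n < 4 ^ p, s'.mem (2 * p + 4 ^ p + n) = (codeConv (4 ^ p) g)^[j] K n) ∧
        (∀ k < 2 * p + 4 ^ p, s'.mem k = s.mem k) ∧ SameBelow 14 10 s s' := by
  have hM := hB.mem
  have hW := hB.word
  refine (runs_for_const (c := 10) (N := j) (T := 4 ^ p * (4 ^ p * 9 + 13) + 4) (fun i s' =>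
      (∀ n < 4 ^ p, s'.mem (2 * p + 4 ^ p + n) = (codeConv (4 ^ p) g)^[i] K n) ∧
        (∀ k < 2 * p + 4 ^ p, s'.mem k = s.mem k)) (by decide) (by decide) (by omega) hs.n4 hj
      (by omega) ⟨hK, fun _ _ => rfl⟩ ?_).mono le_rfl fun s' h => ⟨h.1.1, h.1.2, h.2⟩
  intro i hi s₁ hs₁ hi₁ ⟨hK₁, hm₁⟩
  have hE := hs.of_sameBelow hs₁ (by omega) (by omega)
  refine (runs_conv g _ hE hB (fun n hn => ?_) hK₁).mono le_rfl ?_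
  · rw [hm₁ _ (by omega), hg n hn]
  · rintro s₂ ⟨hK₂, hm₂, -⟩
    refine ⟨fun n hn => ?_, fun k hk => ?_⟩
    · rw [Function.iterate_succ_apply']
      exact hK₂ n hn
    · rw [Store.setN_mem, hm₂ k hk, hm₁ k hk]

/-- Compute the table of `f · H` from the table of convolutions. -/
def updateProg : Prog :=
  forProg 15 9 (.seq weightProg (code (.natOp .add 20 10 15) [.load 21 20, .cpxPow 21 21 2,
    .cpxOp .mul 20 20 21, .natOp .add 20 7 15, .store 20 20]))

theorem runs_update {s : Store} (b K : ℕ → ℂ) (hs : FinEnv p q D s) (hB : FinBound p q M W)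
    (hb : ∀ r < p, s.mem (p + r) = b r)
    (hK : ∀ n < 4 ^ p, s.mem (2 * p + 4 ^ p + n) = K n) :
    Runs M W updateProg (4 ^ p * (p * 24 + 12) + 2) s fun s' =>
      Filled (2 * p) (4 ^ p) (fun n => codeWeight b p n * K n ^ D) s s' ∧ SameBelow 15 10 s s' := by
  have hM := hB.mem
  have hW := hB.word
  refine (runs_fill (T := p * 24 + 4 + 6) _ (by decide) (by decide) (by decide) hs.n4 hs.n9
    (by omega) fun k hk s₁ hs₁ hk₁ hf => ?_).mono (le_of_eq (by ring)) fun _ h => h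
  have hE := hs.of_sameBelow hs₁ (by omega) (by omega)
  refine Runs.seq ((((runs_weight b hE.toEnv le_rfl hk₁ (fun r hr => ?_) (by omega) (by omega)
    (by omega) (by omega)).frame (n := 20) (c := 10) (by decide)).frame_mem (by decide)).mono le_rfl ?_)
  · rw [hf.2 _ (by omega)]; exact hb r hr
  · rintro s₂ ⟨⟨hc, hs₂⟩, hm⟩
    have hE₂ := hE.of_sameBelow hs₂ (by omega) (by omega)
    have hk₂ : s₂.nreg 15 = k := by rw [hs₂.1 _ (by omega), hk₁]
    have hKk : s₁.mem (2 * p + 4 ^ p + k) = K k := by rw [hf.2 _ (by omega), hK k hk]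
    refine runs_code ?_ le_rfl ?_
    · simp [hE₂.n7, hE₂.n10, hk₂]; omega
    · funext j
      simp [hE₂.n7, hE₂.n10, hE₂.n2, hk₂, hc, hm, hKk, Function.update_apply]

/-- The table of `f · H` after `m` iterations. -/
noncomputable def codeTable (p q D : ℕ) (g b : ℕ → ℂ) : ℕ → ℕ → ℂ
  | 0, n => codeWeight b p n
  | m + 1, n => codeWeight b p n *
      (codeConv (4 ^ p) (codeTable p q D g b m))^[q - 1] (fun k => Complex.cos (codePhase g p D k)) n ^ D

/-- The registers that hold constants are initialised. -/
def finSetupProg : Prog :=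
  .seq (code (.natConst 4 1) [.natConst 5 2, .natConst 6 4, .natOp .mul 7 5 0, .natOp .add 8 0 3,
    .natOp .sub 12 1 4, .cpxI 1, .natConst 16 1])
  (.seq (forProg 15 0 (code (.natOp .mul 16 16 6) []))
    (code (.natOp .add 9 16 3) [.natOp .add 10 7 9, .natOp .add 11 10 9]))

/-- The program for the finite formula. -/
def finProg : Prog :=
  .seq finSetupProg (.seq weightTableProg
    (.seq (forProg 13 0 (.seq (kernelProg .cos) (.seq (forProg 14 12 convProg) updateProg)))
    (.seq (kernelProg .sin) (.seq (forProg 14 1 convProg)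
      (code (.load 10 10) [.cpxSqrt 11 2, .natOp .mul 20 5 1, .cpxSqrt 12 20, .cpxOp .div 11 11 12,
        .cpxOp .mul 11 1 11, .cpxOp .mul 0 11 10])))))

theorem runs_finSetup {s : Store} (h0 : s.nreg 0 = p) (h1 : s.nreg 1 = q) (h2 : s.nreg 2 = D)
    (h3 : s.nreg 3 = 0) (hc2 : s.creg 2 = 0) (hB : FinBound p q M W) :
    Runs M W finSetupProg (p * 3 + 13) s fun s' => FinEnv p q D s' ∧ s'.mem = s.mem := by
  have hM := hB.mem
  have hW := hB.word
  have hrun : Runs M W finSetupProg (8 + ((p * (1 + 2) + 2) + 3)) s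
      fun s' => FinEnv p q D s' ∧ s'.mem = s.mem := by
    refine Runs.seq (runs_code ?_ le_rfl ?_)
    · simp [h0, h1, h3]; omega
    · set s₁ := List.foldl (fun s i => Instr.run i s) s [Instr.natConst 4 1, .natConst 5 2, .natConst 6 4, .natOp .mul 7 5 0,
        .natOp .add 8 0 3, .natOp .sub 12 1 4, .cpxI 1, .natConst 16 1] with hs₁
      have a0 : s₁.nreg 0 = p := by simp [hs₁, h0]
      have a1 : s₁.nreg 1 = q := by simp [hs₁, h1]
      have a2 : s₁.nreg 2 = D := by simp [hs₁, h2]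
      have a3 : s₁.nreg 3 = 0 := by simp [hs₁, h3]
      have a4 : s₁.nreg 4 = 1 := by simp [hs₁]
      have a5 : s₁.nreg 5 = 2 := by simp [hs₁]
      have a6 : s₁.nreg 6 = 4 := by simp [hs₁]
      have a7 : s₁.nreg 7 = 2 * p := by simp [hs₁, h0]
      have a8 : s₁.nreg 8 = p := by simp [hs₁, h0, h3]
      have a12 : s₁.nreg 12 = q - 1 := by simp [hs₁, h1]
      have a16 : s₁.nreg 16 = 1 := by simp [hs₁]
      have c1 : s₁.creg 1 = Complex.I := by simp [hs₁]
      have c2 : s₁.creg 2 = 0 := by simp [hs₁, hc2]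
      have hm : s₁.mem = s.mem := by simp [hs₁]
      clear_value s₁
      refine Runs.seq ((runs_for_const (c := 10) (N := p) (fun k s' => s'.nreg 16 = 4 ^ k ∧
        s'.mem = s.mem) (by decide) (by decide) (by decide) a4 a0 (by omega) ?_ ?_).mono le_rfl ?_)
      · simp [a16, hm]
      · intro k hk s₂ hs₂ hk₂ ⟨h16, hm₂⟩
        have a6' : s₂.nreg 6 = 4 := by rw [hs₂.1 6 (by omega), a6]
        have hpow : 4 ^ k * 4 ≤ 4 ^ p := by
          rw [← pow_succ]; exact Nat.pow_le_pow_right (by omega) hk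
        refine runs_code ?_ le_rfl ?_
        · simp [h16, a6']; omega
        · simp [h16, a6', hm₂, pow_succ]
      · rintro s₂ ⟨⟨h16, hm₂⟩, hs₂⟩
        have b3 : s₂.nreg 3 = 0 := by rw [hs₂.1 3 (by omega), a3]
        have b7 : s₂.nreg 7 = 2 * p := by rw [hs₂.1 7 (by omega), a7]
        refine runs_code ?_ le_rfl ?_
        · simp [h16, b3, b7]; omega
        · refine ⟨⟨⟨?_, ?_, ?_, ?_, ?_, ?_, ?_, ?_, ?_⟩, ?_, ?_, ?_, ?_, ?_, ?_⟩, ?_⟩ <;>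
            simp [hs₂.1, hs₂.2, *]
          omega
  exact hrun.mono (by omega) fun _ h => h

/-- The cosine table is rebuilt in every round because the convolutions overwrite it. The last pass
convolves the sine table q times and reads entry 0, the string of all ones, so that only the product
of the q summed strings enters. -/
theorem runs_fin {s : Store} (g b : ℕ → ℂ) (h0 : s.nreg 0 = p) (h1 : s.nreg 1 = q)
    (h2 : s.nreg 2 = D) (h3 : s.nreg 3 = 0) (hc2 : s.creg 2 = 0) (hB : FinBound p q M W)
    (hq : 1 ≤ q) (hg : ∀ r < p, s.mem r = g r) (hb : ∀ r < p, s.mem (p + r) = b r) :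
    Runs M W finProg ((p * 3 + 13) + ((4 ^ p * (p * 24 + 8) + 2) +
      ((p * ((4 ^ p * (p * 24 + 11) + 2) + (((q - 1) * (4 ^ p * (4 ^ p * 9 + 13) + 6) + 2) +
        (4 ^ p * (p * 24 + 12) + 2)) + 2) + 2) + ((4 ^ p * (p * 24 + 11) + 2) +
        ((q * (4 ^ p * (4 ^ p * 9 + 13) + 6) + 2) + 7))))) s fun s' =>
      s'.creg 0 = Complex.I * (((√(D : ℝ) : ℝ) : ℂ) / ((√((2 * q : ℕ) : ℝ) : ℝ) : ℂ)) *
        (codeConv (4 ^ p) (codeTable p q D g b p))^[q] (fun k => Complex.sin (codePhase g p D k)) 0 := by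
  have hM := hB.mem
  have hW := hB.word
  have hN : 0 < 4 ^ p := by positivity
  refine Runs.seq ((runs_finSetup h0 h1 h2 h3 hc2 hB).mono le_rfl ?_)
  rintro s₁ ⟨hE₁, hm₁⟩
  rw [← hm₁] at hg hb
  refine Runs.seq ((runs_weightTable b hE₁ hB hb).mono le_rfl ?_)
  rintro s₂ ⟨hf₂, hs₂⟩
  have hE₂ := hE₁.of_sameBelow hs₂ (by omega) (by omega)
  refine Runs.seq ((runs_for_const (c := 10) (N := p) (fun m s' =>
    (∀ k < 2 * p, s'.mem k = s₁.mem k) ∧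
    ∀ n < 4 ^ p, s'.mem (2 * p + n) = codeTable p q D g b m n) (by decide) (by decide) (by decide)
    hE₂.n4 hE₂.n0 (by omega) ⟨fun k hk => hf₂.2 k (by omega), fun n hn => hf₂.1 n hn⟩ ?_).mono le_rfl ?_)
  · intro m hm s₃ hs₃ hm₃ ⟨ha₃, ht₃⟩
    have hE₃ := hE₂.of_sameBelow hs₃ (by omega) (by omega)
    refine Runs.seq ((runs_kernel .cos g hE₃ hB fun r hr => ?_).mono le_rfl ?_)
    · rw [ha₃ _ (by omega), hg r hr]
    rintro s₄ ⟨hf₄, hs₄⟩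
    have hE₄ := hE₃.of_sameBelow hs₄ (by omega) (by omega)
    refine Runs.seq ((runs_conv_iterate (codeTable p q D g b m) _ hE₄ hB (by omega) hE₄.n12
      (by omega) (fun n hn => ?_) hf₄.1).mono le_rfl ?_)
    · rw [hf₄.2 _ (by omega), ht₃ n hn]
    rintro s₅ ⟨hK₅, hm₅, hs₅⟩
    have hE₅ := hE₄.of_sameBelow hs₅ (by omega) (by omega)
    have hlow : ∀ k < 2 * p, s₅.mem k = s₁.mem k := fun k hk => by
      rw [hm₅ _ (by omega), hf₄.2 _ (by omega), ha₃ k hk]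
    refine (runs_update b _ hE₅ hB (fun r hr => ?_) hK₅).mono le_rfl ?_
    · rw [hlow _ (by omega), hb r hr]
    rintro s₆ ⟨hf₆, -⟩
    refine ⟨fun k hk => ?_, fun n hn => hf₆.1 n hn⟩
    rw [Store.setN_mem, hf₆.2 _ (by omega), hlow k hk]
  · rintro s₃ ⟨⟨ha₃, ht₃⟩, hs₃⟩
    have hE₃ := hE₂.of_sameBelow hs₃ (by omega) (by omega)
    refine Runs.seq ((runs_kernel .sin g hE₃ hB fun r hr => ?_).mono le_rfl ?_)
    · rw [ha₃ _ (by omega), hg r hr]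
    rintro s₄ ⟨hf₄, hs₄⟩
    have hE₄ := hE₃.of_sameBelow hs₄ (by omega) (by omega)
    refine Runs.seq ((runs_conv_iterate (codeTable p q D g b p) _ hE₄ hB (by omega) hE₄.n1
      le_rfl (fun n hn => ?_) hf₄.1).mono le_rfl ?_)
    · rw [hf₄.2 _ (by omega), ht₃ n hn]
    rintro s₅ ⟨hK₅, hm₅, hs₅⟩
    have hE₅ := hE₄.of_sameBelow hs₅ (by omega) (by omega)
    have hval := hK₅ 0 hN
    rw [add_zero] at hval
    refine runs_code ?_ le_rfl ?_
    · simp [hE₅.n10, hE₅.n5, hE₅.n1]; omega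
    · simp [hE₅.n10, hE₅.n5, hE₅.n1, hE₅.n2, hE₅.c1, hval, CpxFun.eval]

end FiniteProgram

/-! ## Strings encoded by natural numbers -/

section Encoding

/-- The spin that is given by the bit `j` of `n`. -/
def bitSpin (n j : ℕ) : ℤˣ := if n.testBit j then -1 else 1

theorem bitSpin_xor (m n j : ℕ) : bitSpin (m ^^^ n) j = bitSpin m j * bitSpin n j := by
  unfold bitSpin
  rw [Nat.testBit_xor]
  cases m.testBit j <;> cases n.testBit j <;> rfl

/-- Bits beyond the code read as spin 1, so the digit after the last one acts as the centre and the
innermost factors of the weight need no special case. -/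
theorem bitSpin_of_lt {p n j : ℕ} (hn : n < 4 ^ p) (hj : 2 * p ≤ j) : bitSpin n j = 1 := by
  have h : n.testBit j = false := by
    refine Nat.testBit_lt_two_pow (hn.trans_le ?_)
    rw [show 4 = 2 ^ 2 by norm_num, ← pow_mul]
    exact Nat.pow_le_pow_right (by omega) hj
  simp [bitSpin, h]

theorem testBit_digit (n r i : ℕ) (hi : i < 2) : (n / 4 ^ r % 4).testBit i = n.testBit (2 * r + i) := by
  rw [show 4 ^ r = 2 ^ (2 * r) by rw [pow_mul]; norm_num, show 4 = 2 ^ 2 by norm_num,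
    Nat.testBit_mod_two_pow, Nat.testBit_div_two_pow]
  simp [hi, add_comm]

variable {p : ℕ}

/-- The string with central spin `1` that is encoded by `n`. -/
def str (p n : ℕ) : Bits p := fun k =>
  if k.val < p then bitSpin n (2 * k) else if k.val = p then 1 else bitSpin n (2 * (2 * p - k) + 1)

theorem str_fpos {n r : ℕ} (hn : n < 4 ^ p) (hr : r ≤ p) : str p n (fpos p r hr) = bitSpin n (2 * r) := by
  rcases hr.lt_or_eq with h | rfl
  · simp [str, fpos, h]
  · simp [str, fpos, bitSpin_of_lt hn]

theorem str_bpos {n r : ℕ} (hn : n < 4 ^ p) (hr : r ≤ p) :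
    str p n (bpos p r hr) = bitSpin n (2 * r + 1) := by
  rcases hr.lt_or_eq with h | rfl
  · have h1 : ¬ 2 * p - r < p := by omega
    have h2 : ¬ 2 * p - r = p := by omega
    have h3 : 2 * p - (2 * p - r) = r := by omega
    simp [str, bpos, h1, h2, h3]
  · have h1 : 2 * r - r = r := by omega
    simp [str, bpos, h1, bitSpin_of_lt hn]

theorem str_mid (n : ℕ) : str p n (mid p) = 1 := by simp [str, mid]

theorem str_xor (m n : ℕ) : str p (m ^^^ n) = str p m * str p n := by
  funext k
  simp only [str, Pi.mul_apply, bitSpin_xor]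
  split_ifs <;> simp

theorem str_zero : str p 0 = 1 := by
  funext k
  simp [str, bitSpin]

/-- A string is a global sign, its central spin, times a string with centre 1, and the latter are in
bijection with the numbers below 4^p. -/
theorem sum_bits {M : Type*} [AddCommMonoid M] (F : Bits p → M) :
    ∑ a, F a = ∑ n ∈ Finset.range (4 ^ p), (F (str p n) + F (-str p n)) := by
  let e : Fin (4 ^ p) × ℤˣ → Bits p := fun z k => z.2 * str p z.1 k
  have he : Function.Bijective e := by
    rw [Fintype.bijective_iff_injective_and_card]
    constructor
    · rintro ⟨n, x⟩ ⟨m, y⟩ h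
      have hxy : x = y := by simpa [e, str_mid] using congrFun h (mid p)
      subst hxy
      have hs : ∀ k, str p n k = str p m k := fun k => by simpa [e] using congrFun h k
      have hb : ∀ j, bitSpin n j = bitSpin m j := by
        intro j
        by_cases hj : 2 * p ≤ j
        · rw [bitSpin_of_lt n.2 hj, bitSpin_of_lt m.2 hj]
        · rcases Nat.even_or_odd' j with ⟨r, rfl | rfl⟩
          · rw [← str_fpos n.2 (by omega : r ≤ p), hs, str_fpos m.2]
          · rw [← str_bpos n.2 (by omega : r ≤ p), hs, str_bpos m.2]
      refine Prod.ext (Fin.ext (Nat.eq_of_testBit_eq fun j => ?_)) rfl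
      have := hb j
      unfold bitSpin at this
      cases h1 : n.val.testBit j <;> cases h2 : m.val.testBit j <;> simp [h1, h2] at this ⊢
    · simp only [Fintype.card_prod, Fintype.card_fin, Fintype.card_units_int, Fintype.card_fun]
      rw [pow_succ, pow_mul]; norm_num
  rw [← (Equiv.ofBijective e he).sum_comp, Fintype.sum_prod_type, ← Fin.sum_univ_eq_sum_range
    (fun n => F (str p n) + F (-str p n))]
  refine Finset.sum_congr rfl fun n _ => ?_
  have h2 : (Finset.univ : Finset ℤˣ) = {1, -1} := rfl
  rw [h2, Finset.sum_pair (by decide)]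
  congr 1 <;> congr 1 <;> funext k <;> simp [e]

theorem stepAmp_eq (θ : ℂ) {x : ℕ} (hx : x < 4) : stepAmp θ x =
    (if x.testBit 0 then Complex.I * Complex.sin θ else Complex.cos θ) *
      (if x.testBit 1 then -(Complex.I * Complex.sin θ) else Complex.cos θ) := by
  interval_cases x <;> simp [stepAmp, Nat.testBit]

theorem mixAmp_bitSpin (θ : ℝ) (n i j : ℕ) : mixAmp θ (bitSpin n i) (bitSpin n j) =
    if (n.testBit i).xor (n.testBit j) then Complex.I * Complex.sin θ else Complex.cos θ := by
  unfold mixAmp bitSpin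
  cases n.testBit i <;> cases n.testBit j <;> simp [(by decide : (1 : ℤˣ) ≠ -1), (by decide : (-1 : ℤˣ) ≠ 1)]

/-- The code omits the factor 1/2 of f; the resulting 2 accounts for summing only over strings with
centre 1. -/
theorem codeWeight_eq {β : Fin p → ℝ} {b : ℕ → ℂ} (hb : ∀ r : Fin p, b r = (β r : ℂ)) {n : ℕ}
    (hn : n < 4 ^ p) : codeWeight b p n = 2 * pathWeight β (str p n) := by
  rw [← openWeight_mid, str_mid, openWeight, ← mul_assoc, mul_one_div_cancel two_ne_zero, one_mul,
    codeWeight, ← Fin.prod_univ_eq_prod_range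
    (fun r => stepAmp (b r) ((n / 4 ^ r % 4) ^^^ (n / 4 ^ (r + 1) % 4)))]
  refine Finset.prod_congr rfl fun r _ => ?_
  have hy : (if r.val + 1 = p then 1 else str p n (bpos p (r + 1) r.2)) =
      bitSpin n (2 * (r + 1) + 1) := by
    split_ifs with h
    · rw [bitSpin_of_lt hn (by omega)]
    · rw [str_bpos hn]
  rw [hy, str_fpos hn, str_fpos hn, str_bpos hn, mixAmp_bitSpin, mixAmp_bitSpin, hb r,
    stepAmp_eq _ (xor_lt_four (Nat.mod_lt _ (by decide)) (Nat.mod_lt _ (by decide))),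
    Nat.testBit_xor, Nat.testBit_xor, testBit_digit _ _ _ (by decide),
    testBit_digit _ _ _ (by decide), testBit_digit _ _ _ (by decide),
    testBit_digit _ _ _ (by decide), Bool.xor_comm (n.testBit (2 * (r + 1) + 1))]
  simp

theorem spinDiff_digit (n r : ℕ) : spinDiff (n / 4 ^ r % 4) =
    ((bitSpin n (2 * r) : ℤ) : ℂ) - ((bitSpin n (2 * r + 1) : ℤ) : ℂ) := by
  have h0 := testBit_digit n r 0 (by decide)
  have h1 := testBit_digit n r 1 (by decide)
  have hx : n / 4 ^ r % 4 < 4 := Nat.mod_lt _ (by decide)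
  unfold bitSpin
  rw [add_zero] at h0
  rw [← h0, ← h1]
  generalize n / 4 ^ r % 4 = x at *
  interval_cases x <;> (simp [spinDiff, Nat.testBit]; try norm_num)

theorem codeDot_eq {γ : Fin p → ℝ} {g : ℕ → ℂ} (hg : ∀ r : Fin p, g r = (γ r : ℂ)) {n : ℕ}
    (hn : n < 4 ^ p) : codeDot g p n = gamDot γ (str p n) := by
  rw [gamDot_eq, codeDot, ← Fin.sum_univ_eq_sum_range (fun r => spinDiff (n / 4 ^ r % 4) * g r)]
  push_cast
  refine Finset.sum_congr rfl fun r _ => ?_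
  rw [spinDiff_digit, hg r, str_fpos hn, str_bpos hn]
  ring

theorem avg_succ {X : Type*} [Fintype X] (w : X → ℂ) (n : ℕ) (F : (Fin (n + 1) → X) → ℂ) :
    avg w F = ∑ x, w x * avg w fun a : Fin n → X => F (Fin.cons x a) := by
  rw [avg, ← (Fin.consEquiv fun _ => X).sum_comp, Fintype.sum_prod_type]
  refine Finset.sum_congr rfl fun x _ => ?_
  rw [avg, Finset.mul_sum]
  refine Finset.sum_congr rfl fun a _ => ?_
  simp only [Fin.consEquiv, Equiv.coe_fn_mk, Fin.prod_univ_succ, Fin.cons_zero, Fin.cons_succ]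
  ring

/-- A string and its negative contribute equally when `g` and `K` have the same parity `ε`, since ε²
= 1. Half of the strings therefore suffice, and the factor 2 is stored in the table `G`. -/
theorem codeConv_iterate {ε : ℂ} (hε : ε * ε = 1) {g K : Bits p → ℂ} (hg : ∀ a, g (-a) = ε * g a)
    (hK : ∀ a, K (-a) = ε * K a) {G L : ℕ → ℂ} (hG : ∀ n < 4 ^ p, G n = 2 * g (str p n))
    (hL : ∀ n < 4 ^ p, L n = K (str p n)) (m : ℕ) {c : ℕ} (hc : c < 4 ^ p) :
    (codeConv (4 ^ p) G)^[m] L c = avg g fun a : Fin m → Bits p => K (str p c * ∏ i, a i) := by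
  induction m generalizing c with
  | zero => simp [avg, hL c hc]
  | succ m ih =>
    rw [Function.iterate_succ_apply', avg_succ, sum_bits, codeConv]
    refine Finset.sum_congr rfl fun b hb => ?_
    have hb := Finset.mem_range.1 hb
    rw [ih (xor_lt_four_pow hc hb), str_xor, hG b hb, hg]
    have h : (avg g fun a : Fin m → Bits p => K (str p c * ∏ i, (Fin.cons (-str p b) a : Fin (m + 1) → Bits p) i)) =
        ε * avg g fun a : Fin m → Bits p => K (str p c * ∏ i, (Fin.cons (str p b) a : Fin (m + 1) → Bits p) i) := by
      rw [← avg_const_mul]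
      congr 1
      funext a
      rw [← hK]
      simp [Fin.prod_univ_succ]
    rw [h]
    simp only [Fin.prod_univ_succ, Fin.cons_zero, Fin.cons_succ, mul_assoc]
    linear_combination (-(g (str p b) * avg g fun a : Fin m → Bits p =>
      K (str p c * (str p b * ∏ i, a i)))) * hε

variable {q D : ℕ} {γ β : Fin p → ℝ} {g b : ℕ → ℂ}

theorem codePhase_eq (hg : ∀ r : Fin p, g r = (γ r : ℂ)) {n : ℕ} (hn : n < 4 ^ p) :
    codePhase g p D n = (((1 / √(D : ℝ)) * gamDot γ (str p n) : ℝ) : ℂ) := by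
  rw [codePhase, codeDot_eq hg hn]
  push_cast
  ring

theorem codeTable_eq (hg : ∀ r : Fin p, g r = (γ r : ℂ)) (hb : ∀ r : Fin p, b r = (β r : ℂ)) (m : ℕ)
    {n : ℕ} (hn : n < 4 ^ p) : codeTable p q D g b m n =
      2 * (pathWeight β (str p n) * treeH q D γ β m (str p n)) := by
  induction m generalizing n with
  | zero => rw [codeTable, codeWeight_eq hb hn, treeH_zero, mul_one]
  | succ m ih =>
    rw [codeTable, codeWeight_eq hb hn, codeConv_iterate (one_mul 1)
      (g := fun a => pathWeight β a * treeH q D γ β m a)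
      (K := fun a => (Real.cos ((1 / √(D : ℝ)) * gamDot γ a) : ℂ)) ?_ ?_ (fun n hn => ih hn) ?_ _ hn,
      treeH, mul_assoc]
    · congr 3
      rw [avg]
      exact Finset.sum_congr rfl fun a _ => mul_comm _ _
    · intro a; rw [pathWeight_neg, treeH_neg, one_mul]
    · intro a; rw [gamDot_neg, mul_neg, Real.cos_neg, one_mul]
    · intro n hn; rw [codePhase_eq hg hn, Complex.ofReal_cos]

/-- The odd case: the central spin is odd and so is the sine. On strings with centre 1 that spin is
1, so the table of f·H serves unchanged. -/
theorem codeTable_nuFormula (hg : ∀ r : Fin p, g r = (γ r : ℂ)) (hb : ∀ r : Fin p, b r = (β r : ℂ)) :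
    Complex.I * (((√(D : ℝ) : ℝ) : ℂ) / ((√((2 * q : ℕ) : ℝ) : ℝ) : ℂ)) *
        (codeConv (4 ^ p) (codeTable p q D g b p))^[q] (fun k => Complex.sin (codePhase g p D k)) 0 =
      nuFormula q D γ β := by
  rw [codeConv_iterate (ε := -1) (by norm_num)
      (g := fun a => spin a (mid p) * pathWeight β a * treeH q D γ β p a)
      (K := fun a => (Real.sin ((1 / √(D : ℝ)) * gamDot γ a) : ℂ)) ?_ ?_ ?_ ?_ _ (by positivity),
      nuFormula, Real.sqrt_div (Nat.cast_nonneg D), Complex.ofReal_div]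
  · push_cast
    congr 1
    rw [avg, str_zero]
    exact Finset.sum_congr rfl fun a _ => by rw [one_mul, mul_comm]
  · intro a; rw [spin_neg, pathWeight_neg, treeH_neg]; ring
  · intro a; rw [gamDot_neg, mul_neg, Real.sin_neg, Complex.ofReal_neg, neg_one_mul]
  · intro n hn; rw [codeTable_eq hg hb _ hn]; simp [spin, str_mid]
  · intro n hn; rw [codePhase_eq hg hn, Complex.ofReal_sin]

end Encoding

/-! ### Resource bounds for the finite-degree program. -/

section FiniteResult

/-- Equality holds at q = 2. A further step in q multiplies the left side by at most 4 and the right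
side by 4^p ≥ 4. This is how convolutions fit into the time bound p·4^{pq}. -/
theorem mul_sixteen_pow_le {p q : ℕ} (hq : 2 ≤ q) (hp : 1 ≤ p) : q * (4 ^ p * 4 ^ p) ≤ 2 * 4 ^ (p * q) := by
  induction q, hq using Nat.le_induction with
  | base => rw [mul_comm p 2, two_mul p, pow_add]
  | succ q hq ih =>
    have h4 : 4 ≤ 4 ^ p := Nat.le_self_pow (by omega) 4
    rw [mul_add p q 1, mul_one, pow_add]
    calc (q + 1) * (4 ^ p * 4 ^ p) ≤ (q * (4 ^ p * 4 ^ p)) * 4 := by nlinarith [Nat.zero_le (4 ^ p * 4 ^ p)]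
      _ ≤ 2 * 4 ^ (p * q) * 4 ^ p := Nat.mul_le_mul ih h4
      _ = _ := by ring

theorem computes_nuFormula {p q D : ℕ} (hq : 2 ≤ q) (hp : 1 ≤ p) (γ β : Fin p → ℝ) :
    ComputesWithin finProg (inputStore p q D γ β) (nuFormula q D γ β) (1000 * (p * 4 ^ (p * q)))
      (1000 * 4 ^ p) (1000 * (4 ^ p + q + D)) := by
  have hp4 : p < 4 ^ p := Nat.lt_pow_self (by norm_num)
  have hB : FinBound p q (1000 * 4 ^ p) (1000 * (4 ^ p + q + D)) := ⟨by omega, by omega⟩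
  set g : ℕ → ℂ := fun r => if h : r < p then (γ ⟨r, h⟩ : ℂ) else 0 with hg
  set b : ℕ → ℂ := fun r => if h : r < p then (β ⟨r, h⟩ : ℂ) else 0 with hb
  have h := runs_fin (M := 1000 * 4 ^ p) (W := 1000 * (4 ^ p + q + D)) (s := inputStore p q D γ β)
    (p := p) (q := q) (D := D) g b rfl rfl rfl rfl rfl hB (by omega)
    (fun r hr => by simp [hg, inputStore, hr])
    (fun r hr => by
      have h2 : p + r < 2 * p := by omega
      simp [hb, inputStore, hr, h2])
  rw [codeTable_nuFormula (γ := γ) (β := β) (fun r => by simp [hg]) (fun r => by simp [hb])] at h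
  obtain ⟨s', t, m, w, he, ht, hm, hw, hv⟩ := h
  refine ⟨s', t, m, w, he, hv, ht.trans ?_, hm, hw⟩
  have hX := mul_sixteen_pow_le hq hp
  have h2X : 2 * (4 ^ p * 4 ^ p) ≤ 2 * 4 ^ (p * q) := (Nat.mul_le_mul_right _ hq).trans hX
  have hq1 : (q - 1) * (4 ^ p * 4 ^ p) ≤ 2 * 4 ^ (p * q) :=
    (Nat.mul_le_mul_right _ (Nat.sub_le q 1)).trans hX
  generalize q - 1 = q' at *
  generalize 4 ^ (p * q) = X at *
  generalize 4 ^ p = N at *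
  have hN : N ≤ N * N := Nat.le_mul_self N
  have hNp : N * p ≤ N * N := Nat.mul_le_mul_left _ hp4.le
  have hc : ∀ k, k * (N * N) ≤ 2 * X → k * (N * (N * 9 + 13) + 6) ≤ 56 * X := fun k hk =>
    calc k * (N * (N * 9 + 13) + 6) ≤ k * (28 * (N * N)) := Nat.mul_le_mul_left _ (by nlinarith)
      _ = 28 * (k * (N * N)) := by ring
      _ ≤ 56 * X := by omega
  have e1 := hc q hX
  have e2 := hc q' hq1
  have e3 : N * (p * 24 + 12) ≤ 36 * X := by nlinarith
  have e4 : N * (p * 24 + 11) ≤ 35 * X := by nlinarith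
  have e5 : N * (p * 24 + 8) ≤ 32 * X := by nlinarith
  have hX1 : 1 ≤ X := by omega
  have e6 : p * ((N * (p * 24 + 11) + 2) + ((q' * (N * (N * 9 + 13) + 6) + 2) +
      (N * (p * 24 + 12) + 2)) + 2) ≤ p * (135 * X) := Nat.mul_le_mul_left _ (by omega)
  have e7 : X ≤ p * X := Nat.le_mul_of_pos_left _ hp
  have e8 : p ≤ p * X := Nat.le_mul_of_pos_right _ hX1
  have e9 : p * (135 * X) = 135 * (p * X) := by ring
  omega

end FiniteResult

/-! ## The central row of the matrices -/

section Row

/-- Here the two innermost spins of `b` around its centre may differ, so instead of cancelling they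
leave one term, evaluated at the centre of the shorter problem. -/
theorem sum_gam_collapse {p : ℕ} (γ : Fin (p + 1) → ℝ) {b : Bits (p + 1)} {a : Bits p}
    (hf : ∀ r (h : r < p), b (fpos (p + 1) r (by omega)) = a (fpos p r h.le))
    (hb : ∀ r (h : r < p), b (bpos (p + 1) r (by omega)) = a (bpos p r h.le))
    (R : Fin (2 * p + 1) → ℂ) :
    ∑ k, (Gam γ k : ℂ) * (spin b k * R (collapse k)) =
      ∑ k, (Gam (γ ∘ Fin.castSucc) k : ℂ) * (spin a k * R k) +
        (γ (Fin.last p) : ℂ) * (spin b (fpos (p + 1) p (by omega)) -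
          spin b (bpos (p + 1) p (by omega))) * R (mid p) := by
  rw [gam_sum_mul, gam_sum_mul, Fin.sum_univ_castSucc]
  congr 1
  · refine Finset.sum_congr rfl fun r _ => ?_
    simp only [Fin.val_castSucc, Function.comp, collapse_fpos _ r.2.le, collapse_bpos _ r.2.le, spin,
      hf r r.2, hb r r.2]
  · have : bpos p p le_rfl = mid p := by ext; simp only [bpos, mid]; omega
    simp only [Fin.val_last]
    rw [collapse_fpos p le_rfl, collapse_bpos p le_rfl, this, show fpos p p le_rfl = mid p from rfl]
    ring

theorem quadForm_eq_sum {p : ℕ} (q : ℕ) (γ : Fin p → ℝ)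
    (M : Matrix (Fin (2 * p + 1)) (Fin (2 * p + 1)) ℂ) (a : Bits p) : quadForm q γ M a =
      ∑ j, (Gam γ j : ℂ) * (spin a j * ∑ k, (Gam γ k : ℂ) * (spin a k * M j k ^ (q - 1))) := by
  simp only [quadForm, Finset.mul_sum]
  exact Finset.sum_congr rfl fun j _ => Finset.sum_congr rfl fun k _ => by ring

/-- The last angle acts as a single variable `u` located at the centre. Expanding a symmetric form
with diagonal entry 1 there gives u² plus twice u times a pairing with the central row. -/
theorem quadForm_collapse {p : ℕ} (q : ℕ) (γ : Fin (p + 1) → ℝ)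
    {M : Matrix (Fin (2 * p + 1)) (Fin (2 * p + 1)) ℂ} (hM : ∀ j k, M j k = M k j)
    (h1 : M (mid p) (mid p) = 1) {b : Bits (p + 1)} {a : Bits p} {u : ℂ}
    (hf : ∀ r (h : r < p), b (fpos (p + 1) r (by omega)) = a (fpos p r h.le))
    (hb : ∀ r (h : r < p), b (bpos (p + 1) r (by omega)) = a (bpos p r h.le))
    (hu : u = (γ (Fin.last p) : ℂ) * (spin b (fpos (p + 1) p (by omega)) -
          spin b (bpos (p + 1) p (by omega)))) :
    quadForm q γ (Matrix.of fun j k => M (collapse j) (collapse k)) b =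
      quadForm q (γ ∘ Fin.castSucc) M a + (u * u + 2 * (u *
        ∑ k, (Gam (γ ∘ Fin.castSucc) k : ℂ) * (spin a k * M (mid p) k ^ (q - 1)))) := by
  rw [quadForm_eq_sum, quadForm_eq_sum]
  simp only [Matrix.of_apply]
  simp only [fun j => sum_gam_collapse γ hf hb fun k => M (collapse j) k ^ (q - 1)]
  rw [sum_gam_collapse γ hf hb fun j => (∑ k, (Gam (γ ∘ Fin.castSucc) k : ℂ) *
    (spin a k * M j k ^ (q - 1))) + (γ (Fin.last p) : ℂ) * (spin b (fpos (p + 1) p (by omega)) -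
          spin b (bpos (p + 1) p (by omega))) * M j (mid p) ^ (q - 1), ← hu, h1, one_pow]
  simp only [mul_add, Finset.sum_add_distrib]
  have : ∑ k, (Gam (γ ∘ Fin.castSucc) k : ℂ) * (spin a k * (u * M k (mid p) ^ (q - 1))) =
      u * ∑ k, (Gam (γ ∘ Fin.castSucc) k : ℂ) * (spin a k * M (mid p) k ^ (q - 1)) := by
    rw [Finset.mul_sum]
    exact Finset.sum_congr rfl fun k _ => by rw [hM k]; ring
  rw [this]
  ring

theorem quadForm_neg {p : ℕ} (q : ℕ) (γ : Fin p → ℝ)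
    (M : Matrix (Fin (2 * p + 1)) (Fin (2 * p + 1)) ℂ) (a : Bits p) :
    quadForm q γ M (-a) = quadForm q γ M a := by
  simp only [quadForm, spin_neg]
  exact Finset.sum_congr rfl fun j _ => Finset.sum_congr rfl fun k _ => by ring

/-- The first `d` angles. -/
def firstAngles (d : ℕ) (γ : ℕ → ℝ) : Fin d → ℝ := fun i => γ i

variable (q : ℕ) (γ β : ℕ → ℝ)

/-- The position of `r + 1` for `t = 2r`, and of `-(r + 1)` for `t = 2r + 1`. -/
def rowPos (d t : ℕ) : Fin (2 * d + 1) :=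
  if h : t / 2 ≤ d then (if t % 2 = 0 then fpos d (t / 2) h else bpos d (t / 2) h) else mid d

/-- The entries of the central row for the first `d` angles. -/
noncomputable def centralRow (d t : ℕ) : ℂ :=
  matG q (firstAngles d γ) (firstAngles d β) d (mid d) (rowPos d t)

theorem rowPos_even {d r : ℕ} (h : r ≤ d) : rowPos d (2 * r) = fpos d r h := by
  simp [rowPos, h]

theorem rowPos_odd {d r : ℕ} (h : r ≤ d) : rowPos d (2 * r + 1) = bpos d r h := by
  have h1 : (2 * r + 1) / 2 = r := by omega
  have h2 : (2 * r + 1) % 2 = 1 := by omega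
  simp [rowPos, h1, h2, h]

/-- The spin `1 - 2x` that is encoded by a bit `x`. -/
noncomputable def bitSign (x : ℕ) : ℂ := 1 - ((x : ℂ) + (x : ℂ))

theorem bitSign_eq (n j : ℕ) : bitSign (n / 2 ^ j % 2) = ((bitSpin n j : ℤ) : ℂ) := by
  unfold bitSpin bitSign
  rw [Nat.testBit_eq_decide_div_mod_eq]
  rcases Nat.mod_two_eq_zero_or_one (n / 2 ^ j) with h | h <;> rw [h] <;> norm_num

theorem bitSign_even (n r : ℕ) : bitSign (n / 4 ^ r % 2) = ((bitSpin n (2 * r) : ℤ) : ℂ) := by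
  rw [← bitSign_eq, pow_mul]; norm_num

theorem bitSign_odd (n r : ℕ) : bitSign (n / 4 ^ r / 2 % 2) = ((bitSpin n (2 * r + 1) : ℤ) : ℂ) := by
  rw [← bitSign_eq, pow_succ, pow_mul, Nat.div_div_eq_div_mul]; norm_num

/-- The partial sums of the pairing of a string with powers of a row. -/
noncomputable def codeInner (m : ℕ) (g R : ℕ → ℂ) (n k : ℕ) : ℂ :=
  ∑ r ∈ Finset.range k, g r * (R (2 * r) ^ m * bitSign (n / 4 ^ r % 2) -
    R (2 * r + 1) ^ m * bitSign (n / 4 ^ r / 2 % 2))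

/-- The contribution of the angle `γ_s` to the quadratic form. -/
noncomputable def formStep (m : ℕ) (g : ℕ → ℂ) (R : ℕ → ℕ → ℂ) (n s : ℕ) : ℂ :=
  let u := spinDiff (n / 4 ^ s % 4) * g s
  (u * codeInner m g (R s) n s + u * codeInner m g (R s) n s) + u * u

/-- The quadratic form of the string that is encoded by `n`. -/
noncomputable def codeForm (m : ℕ) (g : ℕ → ℂ) (R : ℕ → ℕ → ℂ) (d n : ℕ) : ℂ :=
  ∑ s ∈ Finset.range d, formStep m g R n s

variable {q γ β} {g b : ℕ → ℂ}

theorem str_fpos_of_lt {p n r : ℕ} (hr : r < p) : str p n (fpos p r hr.le) = bitSpin n (2 * r) := by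
  simp [str, fpos, hr]

theorem str_bpos_of_lt {p n r : ℕ} (hr : r < p) :
    str p n (bpos p r hr.le) = bitSpin n (2 * r + 1) := by
  have h1 : ¬ 2 * p - r < p := by omega
  have h2 : ¬ 2 * p - r = p := by omega
  have h3 : 2 * p - (2 * p - r) = r := by omega
  simp [str, bpos, h1, h2, h3]

theorem codeInner_eq (hg : ∀ r, g r = (γ r : ℂ)) (m d n : ℕ) :
    codeInner m g (centralRow q γ β d) n d = ∑ k, (Gam (firstAngles d γ) k : ℂ) *
      (spin (str d n) k * matG q (firstAngles d γ) (firstAngles d β) d (mid d) k ^ m) := by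
  rw [gam_sum_mul, codeInner, ← Fin.sum_univ_eq_sum_range (fun r => g r *
    (centralRow q γ β d (2 * r) ^ m * bitSign (n / 4 ^ r % 2) -
      centralRow q γ β d (2 * r + 1) ^ m * bitSign (n / 4 ^ r / 2 % 2)))]
  refine Finset.sum_congr rfl fun r _ => ?_
  rw [centralRow, centralRow, rowPos_even r.2.le, rowPos_odd r.2.le, spin, spin, str_fpos_of_lt r.2,
    str_bpos_of_lt r.2, bitSign_even, bitSign_odd, hg, firstAngles]
  ring

/-- By stability and collapse, the form for d+1 angles uses only the matrix for d angles.
`quadForm_collapse` then isolates the contribution of the new angle, which involves row d alone, so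
a telescoping sum over the rows replaces the whole matrix. -/
theorem codeForm_eq (hg : ∀ r, g r = (γ r : ℂ)) (d n : ℕ) :
    codeForm (q - 1) g (centralRow q γ β) d n =
      quadForm q (firstAngles d γ) (matG q (firstAngles d γ) (firstAngles d β) d) (str d n) := by
  induction d with
  | zero =>
    have hj : ∀ j : Fin (2 * 0 + 1), Gam (firstAngles 0 γ) j = 0 := fun j => by
      rw [(by ext; simp [mid] : j = mid 0), Gam_mid]
    simp [codeForm, quadForm, hj]
  | succ d ih =>
    have hM : quadForm q (firstAngles (d + 1) γ)
        (matG q (firstAngles (d + 1) γ) (firstAngles (d + 1) β) (d + 1)) (str (d + 1) n) =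
        quadForm q (firstAngles (d + 1) γ) (Matrix.of fun j k =>
          matG q (firstAngles d γ) (firstAngles d β) d (collapse j) (collapse k)) (str (d + 1) n) := by
      refine quadForm_congr q _ (fun j hj k hk => ?_) fun _ _ => rfl
      rw [matG_collapse q _ _ _ hj hk, matG_stable q _ _ (Nat.le_succ d)]
      rfl
    have hu : spinDiff (n / 4 ^ d % 4) * g d = (firstAngles (d + 1) γ (Fin.last d) : ℂ) *
        (spin (str (d + 1) n) (fpos (d + 1) d (by omega)) -
          spin (str (d + 1) n) (bpos (d + 1) d (by omega))) := by
      rw [spin, spin, str_fpos_of_lt (Nat.lt_succ_self d), str_bpos_of_lt (Nat.lt_succ_self d),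
        spinDiff_digit, hg, mul_comm]
      rfl
    rw [hM, quadForm_collapse q (firstAngles (d + 1) γ) (matG_comm q _ _ d) (matG_self q _ _ d _)
      (a := str d n) ?_ ?_ hu, codeForm, Finset.sum_range_succ, ← codeForm, ih, formStep]
    · congr 1
      have := codeInner_eq (q := q) (β := β) hg (q - 1) d n
      rw [this]
      change _ = _ + 2 * (_ * ∑ k, ((Gam (firstAngles d γ) k : ℝ) : ℂ) * _)
      ring
    · intro r hr; rw [str_fpos_of_lt hr, str_fpos_of_lt (by omega)]
    · intro r hr; rw [str_bpos_of_lt hr, str_bpos_of_lt (by omega)]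

/-- Stability raises the level from d to d+1, so the exponent contains the stationary matrix. Its
form uses only the rows s < d, which makes this a recursion on d. Negation pairs the strings as
before. -/
theorem centralRow_eq (hg : ∀ r, g r = (γ r : ℂ)) (hb : ∀ r, b r = (β r : ℂ)) {d t : ℕ}
    (ht : t < 2 * d) : centralRow q γ β d t = ∑ n ∈ Finset.range (4 ^ d), bitSign (n / 2 ^ t % 2) *
      -- The code of the form here involves `centralRow q γ β s` for s < d only.
      (codeWeight b d n * Complex.exp ((0 - codeForm (q - 1) g (centralRow q γ β) d n) / 2)) := by
  rw [centralRow, ← matG_stable q _ _ (Nat.le_succ d), matG_apply, sum_bits]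
  refine Finset.sum_congr rfl fun n hn => ?_
  have hn := Finset.mem_range.1 hn
  have hs : spin (str d n) (rowPos d t) = bitSign (n / 2 ^ t % 2) := by
    rw [bitSign_eq, spin]
    rcases Nat.even_or_odd' t with ⟨r, rfl | rfl⟩
    · rw [rowPos_even (by omega), str_fpos_of_lt (by omega)]
    · rw [rowPos_odd (by omega), str_bpos_of_lt (by omega)]
  rw [pathWeight_neg, spin_neg, spin_neg, limH, limH, quadForm_neg, hs, codeForm_eq hg,
    codeWeight_eq (β := firstAngles d β) (fun r => hb r) hn, spin, str_mid]
  rw [show ∀ x : ℂ, (0 - x) / 2 = -(1 / 2) * x from fun x => by ring]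
  simp only [Units.val_one, Int.cast_one]
  ring

theorem nuLimitFormula_eq (hg : ∀ r, g r = (γ r : ℂ)) (p : ℕ) :
    nuLimitFormula q (firstAngles p γ) (firstAngles p β) =
      Complex.I / ((√((2 * q : ℕ) : ℝ) : ℝ) : ℂ) * ∑ r ∈ Finset.range p, g r *
        (centralRow q γ β p (2 * r) ^ q - centralRow q γ β p (2 * r + 1) ^ q) := by
  rw [nuLimitFormula, gam_sum_mul, ← Fin.sum_univ_eq_sum_range (fun r => g r *
        (centralRow q γ β p (2 * r) ^ q - centralRow q γ β p (2 * r + 1) ^ q))]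
  push_cast
  congr 1
  refine Finset.sum_congr rfl fun r _ => ?_
  rw [centralRow, centralRow, rowPos_even r.2.le, rowPos_odd r.2.le, hg, firstAngles]

end Row

/-! ## The program for infinite degree -/

section LimitProgram

/-- The address at which row `s` is stored. -/
def rowBase (p s : ℕ) : ℕ := 2 * p * (s + 1)

theorem rowBase_succ (p s : ℕ) : rowBase p (s + 1) = rowBase p s + 2 * p := by
  unfold rowBase; ring

theorem rowBase_add_le {p s d : ℕ} (h : s < d) : rowBase p s + 2 * p ≤ rowBase p d := by
  rw [← rowBase_succ]
  exact Nat.mul_le_mul_left _ (by omega)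

theorem two_mul_le_rowBase (p s : ℕ) : 2 * p ≤ rowBase p s :=
  Nat.le_mul_of_pos_right _ (by omega)

/-- The registers that hold constants during the computation of row `d`. -/
structure RowEnv (p q d : ℕ) (s : Store) : Prop extends Env p d s where
  n1 : s.nreg 1 = q
  n2 : s.nreg 2 = p + 1
  n9 : s.nreg 9 = 4 ^ d
  n10 : s.nreg 10 = rowBase p d
  n11 : s.nreg 11 = 2 * d
  n12 : s.nreg 12 = q - 1

theorem RowEnv.of_sameBelow {p q d n c : ℕ} {s s' : Store} (h : RowEnv p q d s)
    (hs : SameBelow n c s s') (hn : 13 ≤ n) (hc : 3 ≤ c) : RowEnv p q d s' :=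
  ⟨h.toEnv.of_sameBelow hs (by omega) hc, (hs.1 _ (by omega)).trans h.n1,
    (hs.1 _ (by omega)).trans h.n2, (hs.1 _ (by omega)).trans h.n9,
    (hs.1 _ (by omega)).trans h.n10, (hs.1 _ (by omega)).trans h.n11,
    (hs.1 _ (by omega)).trans h.n12⟩

/-- The bounds on memory and numbers. -/
structure RowBound (p q M W : ℕ) : Prop where
  mem : rowBase p p + 2 * p ≤ M
  word : rowBase p p + 2 * p + 4 * 4 ^ p + 2 * q + 4 ≤ W

/-- The memory contains the angles and the rows below `d`. -/
structure Rows (p d : ℕ) (g b : ℕ → ℂ) (R : ℕ → ℕ → ℂ) (m : ℕ → ℂ) : Prop where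
  fst : ∀ r < p, m r = g r
  snd : ∀ r < p, m (p + r) = b r
  row : ∀ s < d, ∀ t < 2 * s, m (rowBase p s + t) = R s t

variable {M W p q d : ℕ} {g b : ℕ → ℂ} {R : ℕ → ℕ → ℂ}

theorem Rows.congr {m m' : ℕ → ℂ} (h : Rows p d g b R m) (hd : d ≤ p + 1)
    (hm : ∀ k < rowBase p d, m' k = m k) : Rows p d g b R m' := by
  have h0 := two_mul_le_rowBase p d
  refine ⟨fun r hr => ?_, fun r hr => ?_, fun s hs t ht => ?_⟩
  · rw [hm _ (by omega), h.fst r hr]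
  · rw [hm _ (by omega), h.snd r hr]
  · have := rowBase_add_le (p := p) hs
    rw [hm _ (by omega), h.row s hs t ht]

/-- Compute the pairing of a string with powers of a row. -/
def innerProg : Prog :=
  forProg 24 20 (code (.natOp .mod 27 25 5) [.natOp .div 25 25 5, .natOp .mod 28 25 5,
    .natOp .div 25 25 5, .load 23 26, .natOp .add 26 26 4, .load 24 26, .natOp .add 26 26 4,
    .cpxPow 23 23 12, .cpxPow 24 24 12, .cpxOfNat 25 27, .cpxOfNat 26 28, .cpxOfNat 27 4,
    .cpxOp .add 25 25 25, .cpxOp .sub 25 27 25, .cpxOp .add 26 26 26, .cpxOp .sub 26 27 26,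
    .cpxOp .mul 23 23 25, .cpxOp .mul 24 24 26, .cpxOp .sub 23 23 24, .load 24 24,
    .cpxOp .mul 23 24 23, .cpxOp .add 22 22 23])

theorem codeInner_succ (m : ℕ) (g R : ℕ → ℂ) (n k : ℕ) : codeInner m g R n (k + 1) =
    codeInner m g R n k + g k * (R (2 * k) ^ m * bitSign (n / 4 ^ k % 2) -
      R (2 * k + 1) ^ m * bitSign (n / 4 ^ k / 2 % 2)) :=
  Finset.sum_range_succ _ _

theorem runs_inner {s : Store} {n k base : ℕ} {R : ℕ → ℂ} (hs : RowEnv p q d s)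
    (hk : s.nreg 20 = k) (hn : s.nreg 25 = n) (ha : s.nreg 26 = base) (hc : s.creg 22 = 0)
    (hg : ∀ r < k, s.mem r = g r) (hR : ∀ t < 2 * k, s.mem (base + t) = R t)
    (hM : base + 2 * k ≤ M) (hW : base + 2 * k + 2 ≤ W) (hnW : n ≤ W) :
    Runs M W innerProg (k * 25 + 2) s fun s' => s'.creg 22 = codeInner (q - 1) g R n k := by
  refine (runs_for_const (c := 22) (N := k) (T := 23) (fun r s' => s'.nreg 25 = n / 4 ^ r ∧
    s'.nreg 26 = base + 2 * r ∧ s'.creg 22 = codeInner (q - 1) g R n r ∧ s'.mem = s.mem)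
    (by decide) (by decide) (by decide) hs.n4 hk (by omega) ?_ ?_).mono le_rfl
    fun s' h => h.1.2.2.1
  · simp [hn, ha, hc, codeInner]
  · intro r hr s₁ hs₁ hr₁ ⟨hn₁, ha₁, hc₁, hm₁⟩
    have hE := hs.of_sameBelow hs₁ (by omega) (by omega)
    have htn : n / 4 ^ r ≤ n := Nat.div_le_self _ _
    have hdiv : n / 4 ^ (r + 1) = n / 4 ^ r / 2 / 2 := by
      rw [pow_succ, Nat.div_div_eq_div_mul, Nat.div_div_eq_div_mul]
    have hgr : s₁.mem r = g r := by rw [hm₁, hg r hr]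
    have hR0 : s₁.mem (base + 2 * r) = R (2 * r) := by rw [hm₁, hR _ (by omega)]
    have hR1 : s₁.mem (base + 2 * r + 1) = R (2 * r + 1) := by
      rw [hm₁, add_assoc, hR _ (by omega)]
    have hcw := codeInner_succ (q - 1) g R n r
    rw [hdiv]
    generalize n / 4 ^ r = t at *
    refine runs_code ?_ le_rfl ?_
    · simp [hn₁, ha₁, hE.n4, hE.n5, hr₁]
      refine ⟨?_, ?_, ?_, ?_, ?_, ?_, ?_, ?_, ?_⟩ <;> omega
    · simp [hn₁, ha₁, hc₁, hE.n4, hE.n5, hE.n12, hr₁, hgr, hR0, hR1, hcw, bitSign, ← hm₁]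
      omega

/-- Compute the exponent of the string in register `15` into the complex register `20`. -/
def formProg : Prog :=
  .seq (code (.natOp .add 21 15 3) [.natOp .add 22 7 3, .cpxOp .add 20 2 2])
  (.seq (forProg 20 8
    (.seq (code (.natOp .mod 23 21 6) [.natOp .div 21 21 6, .natOp .div 24 23 5,
      .natOp .mod 23 23 5, .cpxOfNat 21 24, .cpxOfNat 23 23, .cpxOp .sub 21 21 23,
      .cpxOp .add 21 21 21, .load 23 20, .cpxOp .mul 21 21 23, .cpxOp .add 22 2 2])
    (.seq (code (.natOp .add 25 15 3) [.natOp .add 26 22 3])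
    (.seq innerProg
    (code (.cpxOp .mul 22 21 22) [.cpxOp .add 22 22 22, .cpxOp .mul 21 21 21, .cpxOp .add 22 22 21,
      .cpxOp .add 20 20 22, .natOp .add 22 22 7])))))
  (code (.cpxOfNat 21 5) [.cpxOp .sub 20 2 20, .cpxOp .div 20 20 21]))

theorem codeForm_succ (m : ℕ) (g : ℕ → ℂ) (R : ℕ → ℕ → ℂ) (d n : ℕ) :
    codeForm m g R (d + 1) n = codeForm m g R d n + formStep m g R n d :=
  Finset.sum_range_succ _ _

theorem runs_form {s : Store} {n : ℕ} (hs : RowEnv p q d s) (hd : d ≤ p) (hB : RowBound p q M W)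
    (hn : s.nreg 15 = n) (hnW : n ≤ W) (hR : Rows p d g b R s.mem) :
    Runs M W formProg (d * (d * 25 + 24) + 8) s
      fun s' => s'.creg 20 = (0 - codeForm (q - 1) g R d n) / 2 := by
  have hM := hB.mem
  have hW := hB.word
  have h0 := two_mul_le_rowBase p p
  have hrun : Runs M W formProg (3 + ((d * ((11 + (2 + ((d * 25 + 2) + 6))) + 2) + 2) + 3)) s
      fun s' => s'.creg 20 = (0 - codeForm (q - 1) g R d n) / 2 := by
    refine Runs.seq (((runs_code (Q := fun s' => s'.nreg 21 = n ∧ s'.nreg 22 = rowBase p 0 ∧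
      s'.creg 20 = 0 ∧ s'.mem = s.mem) ?_ le_rfl ?_).frame (n := 20) (c := 20) (by decide)).mono
      le_rfl ?_)
    · simp [hn, hs.n3, hs.n7, hnW]; omega
    · simp [hn, hs.n3, hs.n7, hs.c2, rowBase]
    · rintro s₁ ⟨⟨h21, h22, hc20, hm₁⟩, hs₁⟩
      have hE₁ := hs.of_sameBelow hs₁ (by omega) (by omega)
      have hn₁ : s₁.nreg 15 = n := by rw [hs₁.1 _ (by omega), hn]
      refine Runs.seq ((runs_for_const (c := 20) (N := d) (fun k s' => s'.nreg 21 = n / 4 ^ k ∧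
        s'.nreg 22 = rowBase p k ∧ s'.creg 20 = codeForm (q - 1) g R k n ∧ s'.mem = s.mem)
        (by decide) (by decide) (by decide) hE₁.n4 hE₁.n8 (by omega) ?_ ?_).mono le_rfl ?_)
      · simp [h21, h22, hc20, hm₁, codeForm]
      · intro k hk s₂ hs₂ hk₂ ⟨ht₂, ha₂, hc₂, hm₂⟩
        have hE₂ := hE₁.of_sameBelow hs₂ (by omega) (by omega)
        have hn₂ : s₂.nreg 15 = n := by rw [hs₂.1 _ (by omega), hn₁]
        have hgk : s₂.mem k = g k := by rw [hm₂, hR.fst k (by omega)]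
        have htn : n / 4 ^ k ≤ n := Nat.div_le_self _ _
        have hdiv : n / 4 ^ (k + 1) = n / 4 ^ k / 4 := by rw [pow_succ, Nat.div_div_eq_div_mul]
        have hbase := rowBase_add_le (p := p) (show k < p by omega)
        rw [hdiv]
        have hstep : formStep (q - 1) g R n k =
          (spinDiff (n / 4 ^ k % 4) * g k * codeInner (q - 1) g (R k) n k +
            spinDiff (n / 4 ^ k % 4) * g k * codeInner (q - 1) g (R k) n k) +
            spinDiff (n / 4 ^ k % 4) * g k * (spinDiff (n / 4 ^ k % 4) * g k) := rfl
        generalize n / 4 ^ k = t at *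
        refine Runs.seq (((runs_code (Q := fun s' => s'.nreg 21 = t / 4 ∧
          s'.creg 21 = spinDiff (t % 4) * g k ∧ s'.creg 22 = 0 ∧ s'.nreg 22 = rowBase p k ∧
          s'.nreg 20 = k ∧ s'.mem = s.mem) ?_ le_rfl ?_).frame (n := 20) (c := 21) (by decide)).mono
            le_rfl ?_)
        · simp [ht₂, hE₂.n5, hE₂.n6, hk₂]
          refine ⟨?_, ?_, ?_, ?_, ?_⟩ <;> omega
        · simp [ht₂, hE₂.n5, hE₂.n6, hE₂.c2, hk₂, hgk, ha₂, hm₂, spinDiff]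
        rintro s₃ ⟨⟨h21₃, hc21₃, hc22₃, h22₃, h20₃, hm₃⟩, hs₃⟩
        have hE₃ := hE₂.of_sameBelow hs₃ (by omega) (by omega)
        have hn₃ : s₃.nreg 15 = n := by rw [hs₃.1 _ (by omega), hn₂]
        have hc₃ : s₃.creg 20 = codeForm (q - 1) g R k n := by
          rw [hs₃.2 _ (by omega), hc₂]
        refine Runs.seq (((runs_code (Q := fun s' => s'.nreg 25 = n ∧ s'.nreg 26 = rowBase p k ∧
          s'.mem = s.mem) ?_ le_rfl ?_).frame (n := 25) (c := 23) (by decide)).mono le_rfl ?_)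
        · simp [hn₃, h22₃, hE₃.n3, hnW]; omega
        · simp [hn₃, h22₃, hE₃.n3, hm₃]
        rintro s₄ ⟨⟨h25₄, h26₄, hm₄⟩, hs₄⟩
        have hE₄ := hE₃.of_sameBelow hs₄ (by omega) (by omega)
        refine Runs.seq ((((runs_inner (R := R k) (g := g) hE₄ (k := k)
          (by rw [hs₄.1 _ (by omega), h20₃]) h25₄ h26₄
          (by rw [hs₄.2 _ (by omega), hc22₃]) (fun r hr => ?_) (fun t ht => ?_) (by omega)
          (by omega) hnW).frame (n := 24) (c := 22) (by decide)).frame_mem (by decide)).mono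
            (by omega) ?_)
        · rw [hm₄, hR.fst r (by omega)]
        · rw [hm₄, hR.row k hk t ht]
        rintro s₅ ⟨⟨hc22₅, hs₅⟩, hm₅⟩
        have hE₅ := hE₄.of_sameBelow hs₅ (by omega) (by omega)
        have h21₅ : s₅.nreg 21 = t / 4 := by rw [hs₅.1 _ (by omega), hs₄.1 _ (by omega), h21₃]
        have h22₅ : s₅.nreg 22 = rowBase p k := by
          rw [hs₅.1 _ (by omega), hs₄.1 _ (by omega), h22₃]
        have hc21₅ : s₅.creg 21 = spinDiff (t % 4) * g k := by
          rw [hs₅.2 _ (by omega), hs₄.2 _ (by omega), hc21₃]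
        have hc20₅ : s₅.creg 20 = codeForm (q - 1) g R k n := by
          rw [hs₅.2 _ (by omega), hs₄.2 _ (by omega), hc₃]
        refine runs_code ?_ le_rfl ?_
        · simp [h22₅, hE₅.n7]; omega
        · simp [h22₅, h21₅, hc21₅, hc20₅, hc22₅, hE₅.n7, hm₅, hm₄, rowBase_succ, codeForm_succ, hstep]
      · rintro s₂ ⟨⟨-, -, hc₂, -⟩, hs₂⟩
        have hE₂ := hE₁.of_sameBelow hs₂ (by omega) (by omega)
        refine runs_code ?_ le_rfl ?_
        · simp
        · simp [hE₂.n5, hE₂.c2, hc₂]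
  exact hrun.mono (by ring_nf; omega) fun _ h => h

/-- Add the complex register `10`, with the signs of the string in register `15`, to the row. -/
def signProg : Prog :=
  .seq (code (.natOp .add 17 15 3) [])
  (forProg 16 11 (code (.natOp .mod 20 17 5) [.natOp .div 17 17 5, .cpxOfNat 20 20, .cpxOfNat 21 4,
    .cpxOp .add 20 20 20, .cpxOp .sub 20 21 20, .cpxOp .mul 20 20 10, .natOp .add 21 10 16,
    .load 21 21, .cpxOp .add 20 21 20, .store 21 20]))

/-- A string is added to all 2d entries in one pass, so its weight and exponent are computed once.
This keeps the work per string quadratic in d. -/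
theorem runs_sign {s : Store} {n : ℕ} {S : ℕ → ℂ} (hs : RowEnv p q d s) (hd : d ≤ p)
    (hB : RowBound p q M W) (hn : s.nreg 15 = n) (hnW : n ≤ W)
    (hS : ∀ t < 2 * d, s.mem (rowBase p d + t) = S t) :
    Runs M W signProg (d * 26 + 3) s fun s' =>
      (∀ t < 2 * d, s'.mem (rowBase p d + t) = S t + bitSign (n / 2 ^ t % 2) * s.creg 10) ∧
        ∀ k < rowBase p d, s'.mem k = s.mem k := by
  have hM := hB.mem
  have hW := hB.word
  have hbase : rowBase p d ≤ rowBase p p := Nat.mul_le_mul_left _ (by omega)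
  have hrun : Runs M W signProg (1 + (2 * d * (11 + 2) + 2)) s fun s' =>
      (∀ t < 2 * d, s'.mem (rowBase p d + t) = S t + bitSign (n / 2 ^ t % 2) * s.creg 10) ∧
        ∀ k < rowBase p d, s'.mem k = s.mem k := by
    refine Runs.seq (((runs_code (Q := fun s' => s'.nreg 17 = n ∧ s'.mem = s.mem)
      ?_ le_rfl ?_).frame (n := 16) (c := 20) (by decide)).mono le_rfl ?_)
    · simp [hn, hs.n3, hnW]
    · simp [hn, hs.n3]
    rintro s₁ ⟨⟨h17, hm₁⟩, hs₁⟩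
    have hE₁ := hs.of_sameBelow hs₁ (by omega) (by omega)
    have hc₁ := hs₁.2 10 (by omega)
    refine (runs_for_const (c := 20) (N := 2 * d) (fun t s' => s'.nreg 17 = n / 2 ^ t ∧
      (∀ u < t, s'.mem (rowBase p d + u) = S u + bitSign (n / 2 ^ u % 2) * s.creg 10) ∧
        (∀ u < 2 * d, t ≤ u → s'.mem (rowBase p d + u) = S u) ∧
        ∀ k < rowBase p d, s'.mem k = s.mem k)
      (by decide) (by decide) (by decide) hE₁.n4 hE₁.n11 (by omega) ?_ ?_).mono le_rfl
      fun s' h => ⟨h.1.2.1, h.1.2.2.2⟩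
    · simp [h17, hm₁]
      exact hS
    · intro t ht s₂ hs₂ ht₂ ⟨h17₂, hdone, htodo, hlow⟩
      have hE₂ := hE₁.of_sameBelow hs₂ (by omega) (by omega)
      have hc₂ : s₂.creg 10 = s.creg 10 := by rw [hs₂.2 _ (by omega), hc₁]
      have htn : n / 2 ^ t ≤ n := Nat.div_le_self _ _
      have hcur := htodo t ht le_rfl
      have hdiv : n / 2 ^ (t + 1) = n / 2 ^ t / 2 := by rw [pow_succ, Nat.div_div_eq_div_mul]
      refine runs_code ?_ le_rfl ?_
      · simp [h17₂, hE₂.n5, hE₂.n10, ht₂]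
        refine ⟨?_, ?_, ?_, ?_⟩ <;> omega
      · refine ⟨?_, fun u hu => ?_, fun u hu htu => ?_, fun k hk => ?_⟩
        · simp [h17₂, hE₂.n5, hdiv]
        · simp only [List.foldl, Instr.run, NatOp.eval, CpxOp.eval, Store.setN_mem, Store.setC_mem,
            Store.setM_mem, Store.setN_nreg, Store.setC_nreg, Store.setN_creg, Store.setC_creg]
          simp [h17₂, hE₂.n5, hE₂.n4, hE₂.n10, ht₂, hc₂, hcur]
          by_cases hut : u = t
          · subst hut; simp [bitSign]
          · rw [if_neg hut, hdone u (by omega)]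
        · have h1 : u ≠ t := by omega
          simp [hE₂.n10, ht₂, h1]
          exact htodo u hu (by omega)
        · have h1 : k ≠ rowBase p d + t := by omega
          simp [hE₂.n10, ht₂, h1]
          exact hlow k hk
  exact hrun.mono (by omega) fun _ h => h

/-- The contribution of a string to the row. -/
noncomputable def rowTerm (q d : ℕ) (g b : ℕ → ℂ) (R : ℕ → ℕ → ℂ) (n : ℕ) : ℂ :=
  codeWeight b d n * Complex.exp ((0 - codeForm (q - 1) g R d n) / 2)

/-- Add the contributions of all strings to the row. -/
def rowSumProg : Prog :=
  forProg 15 9 (.seq weightProg (.seq (code (.cpxOp .add 10 20 2) []) (.seq formProg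
    (.seq (code (.cpxFun .exp 20 20) [.cpxOp .mul 10 10 20]) signProg))))

theorem runs_rowSum {s : Store} (hs : RowEnv p q d s) (hd : d ≤ p) (hB : RowBound p q M W)
    (hR : Rows p d g b R s.mem) (h0 : ∀ t < 2 * d, s.mem (rowBase p d + t) = 0) :
    Runs M W rowSumProg (4 ^ d * (d * (d * 25 + 74) + 20) + 2) s fun s' =>
      ((∀ t < 2 * d, s'.mem (rowBase p d + t) =
        ∑ n ∈ Finset.range (4 ^ d), bitSign (n / 2 ^ t % 2) * rowTerm q d g b R n) ∧
        ∀ k < rowBase p d, s'.mem k = s.mem k) ∧ SameBelow 15 10 s s' := by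
  have hM := hB.mem
  have hW := hB.word
  have hbase : rowBase p d ≤ rowBase p p := Nat.mul_le_mul_left _ (by omega)
  have hpow : 4 ^ d ≤ 4 ^ p := Nat.pow_le_pow_right (by omega) hd
  have h2p := two_mul_le_rowBase p d
  refine (runs_for_const (c := 10) (N := 4 ^ d)
    (T := (d * 24 + 4) + (1 + ((d * (d * 25 + 24) + 8) + (2 + (d * 26 + 3))))) (fun N s' =>
      (∀ t < 2 * d, s'.mem (rowBase p d + t) =
        ∑ n ∈ Finset.range N, bitSign (n / 2 ^ t % 2) * rowTerm q d g b R n) ∧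
        ∀ k < rowBase p d, s'.mem k = s.mem k)
      (by decide) (by decide) (by decide) hs.n4 hs.n9 (by omega) ?_ ?_).mono (le_of_eq (by ring))
      fun s' h => h
  · refine ⟨fun t ht => ?_, fun _ _ => rfl⟩
    rw [Store.setN_mem, h0 t ht, Finset.range_zero, Finset.sum_empty]
  · intro n hn s₁ hs₁ hn₁ ⟨hrow, hlow⟩
    have hE₁ := hs.of_sameBelow hs₁ (by omega) (by omega)
    have hR₁ := hR.congr (by omega) hlow
    refine Runs.seq ((((runs_weight b hE₁.toEnv hd hn₁ (fun r hr => hR₁.snd r (by omega)) (by omega)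
      (by omega) (by omega) (by omega)).frame (n := 20) (c := 20) (by decide)).frame_mem
      (by decide)).mono le_rfl ?_)
    rintro s₂ ⟨⟨hc₂, hs₂⟩, hm₂⟩
    have hE₂ := hE₁.of_sameBelow hs₂ (by omega) (by omega)
    refine Runs.seq ((((runs_code (Q := fun s' => s'.creg 10 = codeWeight b d n) (by simp) le_rfl
      (by simp [hc₂, hE₂.c2])).frame (n := 20) (c := 10) (by decide)).frame_mem (by decide)).mono
      le_rfl ?_)
    rintro s₃ ⟨⟨hc₃, hs₃⟩, hm₃⟩
    have hE₃ := hE₂.of_sameBelow hs₃ (by omega) (by omega)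
    have hn₃ : s₃.nreg 15 = n := by rw [hs₃.1 _ (by omega), hs₂.1 _ (by omega), hn₁]
    refine Runs.seq ((((runs_form (n := n) (g := g) (b := b) (R := R) hE₃ hd hB hn₃ (by omega)
      (by rw [hm₃, hm₂]; exact hR₁)).frame (n := 20) (c := 20) (by decide)).frame_mem
      (by decide)).mono le_rfl ?_)
    rintro s₄ ⟨⟨hc₄, hs₄⟩, hm₄⟩
    have hE₄ := hE₃.of_sameBelow hs₄ (by omega) (by omega)
    have hc10 : s₄.creg 10 = codeWeight b d n := by rw [hs₄.2 _ (by omega), hc₃]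
    refine Runs.seq ((((runs_code (Q := fun s' => s'.creg 10 = rowTerm q d g b R n) (by simp) le_rfl
      (by simp [hc₄, hc10, rowTerm])).frame (n := 20) (c := 10) (by decide)).frame_mem
      (by decide)).mono le_rfl ?_)
    rintro s₅ ⟨⟨hc₅, hs₅⟩, hm₅⟩
    have hE₅ := hE₄.of_sameBelow hs₅ (by omega) (by omega)
    have hn₅ : s₅.nreg 15 = n := by rw [hs₅.1 _ (by omega), hs₄.1 _ (by omega), hn₃]
    have hm : s₅.mem = s₁.mem := by rw [hm₅, hm₄, hm₃, hm₂]
    refine (runs_sign (n := n) (S := fun t => ∑ n ∈ Finset.range n,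
      bitSign (n / 2 ^ t % 2) * rowTerm q d g b R n) hE₅ hd hB hn₅ (by omega)
      (fun t ht => by rw [hm, hrow t ht])).mono le_rfl ?_
    rintro s₆ ⟨ha, hb⟩
    refine ⟨fun t ht => ?_, fun k hk => ?_⟩
    · rw [Store.setN_mem, ha t ht, hc₅, Finset.sum_range_succ]
    · rw [Store.setN_mem, hb k hk, hm, hlow k hk]

/-- Compute row `d` and move on to the next one. -/
def rowProg : Prog :=
  .seq (forProg 15 11 (code (.natOp .add 20 10 15) [.store 20 2]))
    (.seq rowSumProg (code (.natOp .mul 9 9 6) [.natOp .add 10 10 7, .natOp .add 11 11 5]))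

/-- The right side of `hrec` refers only to rows below d, which are already stored. Register 8,
holding d, is the counter of the enclosing loop, so the new environment is stated after its
increment. -/
theorem runs_row {s : Store} (hs : RowEnv p q d s) (hd : d ≤ p) (hB : RowBound p q M W)
    (hR : Rows p d g b R s.mem) (hrec : ∀ t < 2 * d, R d t =
      ∑ n ∈ Finset.range (4 ^ d), bitSign (n / 2 ^ t % 2) * rowTerm q d g b R n) :
    Runs M W rowProg (4 ^ d * (d * (d * 25 + 74) + 20) + d * 8 + 7) s fun s' =>
      RowEnv p q (d + 1) (s'.setN 8 (d + 1)) ∧ Rows p (d + 1) g b R s'.mem := by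
  have hM := hB.mem
  have hW := hB.word
  have hbase : rowBase p d ≤ rowBase p p := Nat.mul_le_mul_left _ (by omega)
  have hpow : 4 ^ d ≤ 4 ^ p := Nat.pow_le_pow_right (by omega) hd
  have hrun : Runs M W rowProg ((2 * d * (2 + 2) + 2) +
      ((4 ^ d * (d * (d * 25 + 74) + 20) + 2) + 3)) s fun s' =>
      RowEnv p q (d + 1) (s'.setN 8 (d + 1)) ∧ Rows p (d + 1) g b R s'.mem := by
    refine Runs.seq ((runs_fill (base := rowBase p d) (c := 10) (fun _ => 0) (by decide) (by decide)
      (by decide) hs.n4 hs.n11 (by omega) fun k hk s₁ hs₁ hk₁ hf => ?_).mono le_rfl ?_)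
    · have hE₁ := hs.of_sameBelow hs₁ (by omega) (by omega)
      refine runs_code ?_ le_rfl ?_
      · simp [hE₁.n10, hk₁]; omega
      · funext j; simp [hE₁.n10, hE₁.c2, hk₁, Function.update_apply]
    rintro s₁ ⟨hf₁, hs₁⟩
    have hE₁ := hs.of_sameBelow hs₁ (by omega) (by omega)
    refine Runs.seq ((runs_rowSum (g := g) (b := b) (R := R) hE₁ hd hB
      (hR.congr (by omega) fun k hk => hf₁.2 k (by omega)) hf₁.1).mono le_rfl ?_)
    rintro s₂ ⟨⟨hrow, hlow⟩, hs₂⟩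
    have hE₂ := hE₁.of_sameBelow hs₂ (by omega) (by omega)
    have hR₂ : Rows p d g b R s₂.mem :=
      hR.congr (by omega) fun k hk => by rw [hlow k hk, hf₁.2 k (by omega)]
    refine runs_code ?_ le_rfl ?_
    · simp [hE₂.n9, hE₂.n6, hE₂.n10, hE₂.n7, hE₂.n11, hE₂.n5]
      refine ⟨?_, ?_, ?_⟩ <;> omega
    · refine ⟨⟨⟨?_, ?_, ?_, ?_, ?_, ?_, ?_, ?_, ?_⟩, ?_, ?_, ?_, ?_, ?_, ?_⟩, ?_⟩
      · simp [hE₂.n0]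
      · simp [hE₂.n3]
      · simp [hE₂.n4]
      · simp [hE₂.n5]
      · simp [hE₂.n6]
      · simp [hE₂.n7]
      · simp
      · simp [hE₂.c1]
      · simp [hE₂.c2]
      · simp [hE₂.n1]
      · simp [hE₂.n2]
      · simp [hE₂.n9, hE₂.n6, pow_succ]
      · simp [hE₂.n10, hE₂.n7, rowBase_succ]
      · simp [hE₂.n11, hE₂.n5]; omega
      · simp [hE₂.n12]
      · refine ⟨fun r hr => ?_, fun r hr => ?_, fun k hk t ht => ?_⟩
        · simp [hR₂.fst r hr]
        · simp [hR₂.snd r hr]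
        · rcases Nat.lt_succ_iff_lt_or_eq.1 hk with h | rfl
          · simp [hR₂.row k h t ht]
          · simp [hrow t ht, hrec t ht]
  exact hrun.mono (by omega) fun _ h => h

/-- The program for the limit. -/
def limProg : Prog :=
  .seq (code (.natConst 4 1) [.natConst 5 2, .natConst 6 4, .natOp .mul 7 5 0, .natOp .add 2 0 4,
    .natOp .sub 12 1 4, .natConst 9 1, .natOp .mul 10 5 0, .natConst 11 0, .cpxI 1])
  (.seq (forProg 8 2 rowProg)
  (.seq (code (.natOp .sub 16 10 7) [.cpxOp .add 10 2 2])
  (.seq (forProg 15 0 (code (.load 20 16) [.natOp .add 16 16 4, .load 21 16, .natOp .add 16 16 4,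
    .cpxPow 20 20 1, .cpxPow 21 21 1, .cpxOp .sub 20 20 21, .load 21 15, .cpxOp .mul 20 21 20,
    .cpxOp .add 10 10 20]))
  (code (.natOp .mul 20 5 1) [.cpxSqrt 11 20, .cpxOp .div 11 1 11, .cpxOp .mul 0 11 10]))))

/-- Rows 0, …, p are needed, the last one only for the final sum, so register 2 is reused for the
loop bound p+1. After the loop register 10 points one row too far, and 2p is subtracted to return to
row p. -/
theorem runs_lim {s : Store} (h0 : s.nreg 0 = p) (h1 : s.nreg 1 = q) (h3 : s.nreg 3 = 0)
    (hc2 : s.creg 2 = 0) (hB : RowBound p q M W) (hg : ∀ r < p, s.mem r = g r)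
    (hb : ∀ r < p, s.mem (p + r) = b r) (hrec : ∀ d ≤ p, ∀ t < 2 * d, R d t =
      ∑ n ∈ Finset.range (4 ^ d), bitSign (n / 2 ^ t % 2) * rowTerm q d g b R n) :
    Runs M W limProg (10 + ((∑ d ∈ Finset.range (p + 1),
      ((4 ^ d * (d * (d * 25 + 74) + 20) + d * 8 + 7) + 2) + 2) + (2 + ((p * (10 + 2) + 2) + 4)))) s
      fun s' => s'.creg 0 = Complex.I / ((√((2 * q : ℕ) : ℝ) : ℝ) : ℂ) * ∑ r ∈ Finset.range p,
        g r * (R p (2 * r) ^ q - R p (2 * r + 1) ^ q) := by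
  have hM := hB.mem
  have hW := hB.word
  have h2p := two_mul_le_rowBase p p
  have hp4 : p < 4 ^ p := Nat.lt_pow_self (by norm_num)
  refine Runs.seq ((runs_code (Q := fun s' => RowEnv p q 0 (s'.setN 8 0) ∧ s'.mem = s.mem)
    ?_ le_rfl ?_).mono le_rfl ?_)
  · simp [h0, h1]
    refine ⟨?_, ?_, ?_, ?_, ?_, ?_⟩ <;> omega
  · refine ⟨⟨⟨?_, ?_, ?_, ?_, ?_, ?_, ?_, ?_, ?_⟩, ?_, ?_, ?_, ?_, ?_, ?_⟩, ?_⟩ <;>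
      simp [h0, h1, h3, hc2, rowBase]
  rintro s₁ ⟨hE₁, hm₁⟩
  have h4₁ : s₁.nreg 4 = 1 := by simpa using hE₁.n4
  have h2₁ : s₁.nreg 2 = p + 1 := by simpa using hE₁.n2
  refine Runs.seq ((runs_for (c := 10) (N := p + 1)
    (T := fun d => 4 ^ d * (d * (d * 25 + 74) + 20) + d * 8 + 7)
    (fun d s' => RowEnv p q d s' ∧ Rows p d g b R s'.mem) (by decide) (by decide) (by decide) h4₁ h2₁
    (by omega) ?_ ?_).mono le_rfl ?_)
  · refine ⟨hE₁, fun r hr => ?_, fun r hr => ?_, fun d hd => absurd hd (by omega)⟩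
    · rw [Store.setN_mem, hm₁, hg r hr]
    · rw [Store.setN_mem, hm₁, hb r hr]
  · intro d hd s₂ _ _ ⟨hE₂, hR₂⟩
    exact (runs_row hE₂ (by omega) hB hR₂ (hrec d (by omega))).mono le_rfl fun s' h => h
  rintro s₂ ⟨⟨hE₂, hR₂⟩, -⟩
  have hsucc := rowBase_succ p p
  refine Runs.seq (((runs_code (Q := fun s' => s'.nreg 16 = rowBase p p ∧ s'.creg 10 = 0 ∧
    s'.mem = s₂.mem) ?_ le_rfl ?_).frame (n := 16) (c := 10) (by decide)).mono le_rfl ?_)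
  · simp [hE₂.n10, hE₂.n7]; omega
  · simp [hE₂.n10, hE₂.n7, hE₂.c2]; omega
  rintro s₃ ⟨⟨h16, hc₃, hm₃⟩, hs₃⟩
  have hE₃ := hE₂.of_sameBelow hs₃ (by omega) (by omega)
  refine Runs.seq ((runs_for_const (c := 10) (N := p) (T := 10) (fun k s' =>
    s'.nreg 16 = rowBase p p + 2 * k ∧ s'.creg 10 = (∑ r ∈ Finset.range k,
        g r * (R p (2 * r) ^ q - R p (2 * r + 1) ^ q)) ∧ s'.mem = s₂.mem) (by decide) (by decide)
        (by decide) hE₃.n4 hE₃.n0 (by omega) ?_ ?_).mono le_rfl ?_)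
  · simp [h16, hc₃, hm₃]
  · intro k hk s₄ hs₄ hk₄ ⟨h16₄, hc₄, hm₄⟩
    have hE₄ := hE₃.of_sameBelow hs₄ (by omega) (by omega)
    have hgk : s₄.mem k = g k := by rw [hm₄, hR₂.fst k hk]
    have hR0 : s₄.mem (rowBase p p + 2 * k) = R p (2 * k) := by
      rw [hm₄, hR₂.row p (by omega) _ (by omega)]
    have hR1 : s₄.mem (rowBase p p + 2 * k + 1) = R p (2 * k + 1) := by
      rw [hm₄, add_assoc, hR₂.row p (by omega) _ (by omega)]
    refine runs_code ?_ le_rfl ?_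
    · simp [h16₄, hE₄.n4, hk₄]
      refine ⟨?_, ?_, ?_, ?_, ?_⟩ <;> omega
    · rw [Finset.sum_range_succ]
      simp [h16₄, hE₄.n4, hE₄.n1, hk₄, hc₄, hgk, hR0, hR1, ← hm₄]
      omega
  · rintro s₄ ⟨⟨-, hc₄, -⟩, hs₄⟩
    have hE₄ := hE₃.of_sameBelow hs₄ (by omega) (by omega)
    refine runs_code ?_ le_rfl ?_
    · simp [hE₄.n5, hE₄.n1]; omega
    · simp [hE₄.n5, hE₄.n1, hE₄.c1, hc₄]

theorem sum_four_pow_le (p : ℕ) : ∑ d ∈ Finset.range (p + 1), 4 ^ d ≤ 2 * 4 ^ p := by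
  induction p with
  | zero => simp
  | succ p ih => rw [Finset.sum_range_succ, pow_succ]; omega

theorem computes_nuLimitFormula {p q : ℕ} (hp : 1 ≤ p) (γ β : Fin p → ℝ) :
    ComputesWithin limProg (inputStore p q 0 γ β) (nuLimitFormula q γ β) (1000 * (p ^ 2 * 4 ^ p))
      (1000 * p ^ 2) (1000 * (4 ^ p + q)) := by
  have hpp : p ^ 2 < 4 ^ p := by
    rw [show 4 = 2 ^ 2 by norm_num, ← pow_mul, mul_comm 2 p, pow_mul]
    exact Nat.pow_lt_pow_left (Nat.lt_pow_self (by norm_num)) (by norm_num)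
  have hp2 : p ≤ p ^ 2 := Nat.le_self_pow (by norm_num) p
  have hbase : rowBase p p = 2 * p ^ 2 + 2 * p := by unfold rowBase; ring
  have hB : RowBound p q (1000 * p ^ 2) (1000 * (4 ^ p + q)) :=
    ⟨by rw [hbase]; omega, by rw [hbase]; omega⟩
  -- Angles extended by zero to all of ℕ, so that the problems for all d ≤ p share one sequence.
  set γ' : ℕ → ℝ := fun r => if h : r < p then γ ⟨r, h⟩ else 0 with hγ'
  set β' : ℕ → ℝ := fun r => if h : r < p then β ⟨r, h⟩ else 0 with hβ'
  have hγ : firstAngles p γ' = γ := by funext i; simp [firstAngles, hγ']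
  have hβ : firstAngles p β' = β := by funext i; simp [firstAngles, hβ']
  have h := runs_lim (M := 1000 * p ^ 2) (W := 1000 * (4 ^ p + q)) (s := inputStore p q 0 γ β)
    (p := p) (q := q) (g := fun r => (γ' r : ℂ)) (b := fun r => (β' r : ℂ))
    (R := centralRow q γ' β') rfl rfl rfl rfl hB (fun r hr => by simp [hγ', inputStore, hr])
    (fun r hr => by
      have h2 : p + r < 2 * p := by omega
      simp [hβ', inputStore, hr, h2])
    (fun d hd t ht => centralRow_eq (fun _ => rfl) (fun _ => rfl) ht)
  rw [← nuLimitFormula_eq (γ := γ') (β := β') (fun _ => rfl) p, hγ, hβ] at h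
  obtain ⟨s', t, m, w, he, ht, hm, hw, hv⟩ := h
  refine ⟨s', t, m, w, he, hv, ht.trans ?_, hm, hw⟩
  -- The quadratic factor is bounded by its value at d = p, which leaves a geometric sum of powers
  -- of 4.
  have hsum : ∑ d ∈ Finset.range (p + 1), ((4 ^ d * (d * (d * 25 + 74) + 20) + d * 8 + 7) + 2) ≤
      (∑ d ∈ Finset.range (p + 1), 4 ^ d) * (136 * p ^ 2) := by
    rw [Finset.sum_mul]
    refine Finset.sum_le_sum fun d hd => ?_
    have hd : d ≤ p := Nat.lt_succ_iff.1 (Finset.mem_range.1 hd)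
    have h1 : d * (d * 25 + 74) ≤ p * (p * 25 + 74) := Nat.mul_le_mul hd (by omega)
    have h2 : p * (p * 25 + 74) = 25 * p ^ 2 + 74 * p := by ring
    have h3 : 1 ≤ 4 ^ d := Nat.one_le_pow _ _ (by norm_num)
    have h4 : d * 8 + 9 ≤ 4 ^ d * (17 * p ^ 2) :=
      le_trans (by omega) (Nat.le_mul_of_pos_left _ h3)
    calc _ = 4 ^ d * (d * (d * 25 + 74) + 20) + (d * 8 + 9) := by ring
      _ ≤ 4 ^ d * (119 * p ^ 2) + 4 ^ d * (17 * p ^ 2) :=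
        Nat.add_le_add (Nat.mul_le_mul_left _ (by omega)) h4
      _ = _ := by ring
  have hsum2 := hsum.trans (Nat.mul_le_mul_right _ (sum_four_pow_le p))
  have e : 2 * 4 ^ p * (136 * p ^ 2) = 272 * (p ^ 2 * 4 ^ p) := by ring
  have e2 : p ^ 2 ≤ p ^ 2 * 4 ^ p := Nat.le_mul_of_pos_right _ (by positivity)
  omega

end LimitProgram

end QAOA

/-! ### Assembly of the theorem. -/

theorem theorem2 :
    ∃ (ν : (q p D : ℕ) → (Fin p → ℝ) → (Fin p → ℝ) → ℝ)
      (νlim : (q p : ℕ) → (Fin p → ℝ) → (Fin p → ℝ) → ℝ),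
      -- the satisfied fraction on every hypergraph, for every choice of signs
      (∀ (q p D : ℕ), 2 ≤ q → 1 ≤ p → 1 ≤ D → ∀ (γ β : Fin p → ℝ)
        (V : Type*) [Fintype V] [DecidableEq V] [Nonempty V] (E : Finset (Finset V)),
        QAOA.IsUniform E q → QAOA.IsRegular E (D + 1) →
        ((2 * p + 1 : ℕ) : ℕ∞) < QAOA.bergeGirth E →
        ∀ J : Finset V → ℤˣ,
          QAOA.satisfiedFraction D E J γ β =
            ((1 / 2 + ν q p D γ β * √((q : ℝ) / (2 * D)) : ℝ) : ℂ)) ∧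
      -- the finite iteration
      (∀ (q p D : ℕ), 2 ≤ q → 1 ≤ p → 1 ≤ D → ∀ γ β : Fin p → ℝ,
        (ν q p D γ β : ℂ) = QAOA.nuFormula q D γ β) ∧
      -- its limit
      (∀ (q p : ℕ), 2 ≤ q → 1 ≤ p → ∀ γ β : Fin p → ℝ,
        Tendsto (fun D : ℕ => ν q p D γ β) atTop (𝓝 (νlim q p γ β)) ∧
          (νlim q p γ β : ℂ) = QAOA.nuLimitFormula q γ β) ∧
      -- complexity of the finite value: time O(p 4^(pq)), memory O(4^p)
      (∃ (P : QAOA.Prog) (K : ℕ), ∀ (q p D : ℕ), 2 ≤ q → 1 ≤ p → 1 ≤ D → ∀ γ β : Fin p → ℝ,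
        QAOA.ComputesWithin P (QAOA.inputStore p q D γ β) (ν q p D γ β : ℂ)
          (K * (p * 4 ^ (p * q))) (K * 4 ^ p) (K * (4 ^ p + q + D))) ∧
      -- complexity of the limit: time O(p^2 4^p), memory O(p^2)
      (∃ (P : QAOA.Prog) (K : ℕ), ∀ (q p : ℕ), 2 ≤ q → 1 ≤ p → ∀ γ β : Fin p → ℝ,
        QAOA.ComputesWithin P (QAOA.inputStore p q 0 γ β) (νlim q p γ β : ℂ)
          (K * (p ^ 2 * 4 ^ p)) (K * p ^ 2) (K * (4 ^ p + q))) := by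
  have hν : ∀ (q p D : ℕ) (γ β : Fin p → ℝ),
      (((QAOA.nuFormula q D γ β).re : ℝ) : ℂ) = QAOA.nuFormula q D γ β :=
    fun q p D γ β => Complex.conj_eq_iff_re.1 (QAOA.conj_nuFormula q D γ β)
  have hlim : ∀ (q p : ℕ) (γ β : Fin p → ℝ),
      (((QAOA.nuLimitFormula q γ β).re : ℝ) : ℂ) = QAOA.nuLimitFormula q γ β :=
    fun q p γ β => Complex.conj_eq_iff_re.1 (QAOA.conj_nuLimitFormula q γ β)
  -- Both formulas are invariant under conjugation, so their real parts serve as the required real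
  -- numbers.
  refine ⟨fun q p D γ β => (QAOA.nuFormula q D γ β).re, fun q p γ β => (QAOA.nuLimitFormula q γ β).re,
    ?_, fun q p D _ _ _ γ β => hν q p D γ β, ?_, ⟨QAOA.finProg, 1000, ?_⟩, ⟨QAOA.limProg, 1000, ?_⟩⟩
  · intro q p D hq hp hD γ β V _ _ _ E hE hreg hg J
    rw [QAOA.satisfiedFraction_eq hq hD J γ β hE hreg hg, ← hν]
    push_cast
    rfl
  · intro q p _ _ γ β
    exact ⟨(Complex.continuous_re.tendsto _).comp (QAOA.tendsto_nuFormula q γ β), hlim q p γ β⟩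
  · intro q p D hq hp _ γ β
    rw [hν]
    exact QAOA.computes_nuFormula hq hp γ β
  · intro q p _ hp γ β
    rw [hlim]
    exact QAOA.computes_nuLimitFormula hp γ β
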